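/- Let $M$ be a smooth finite-dimensional manifold with a smooth field of hyperplanes $C\subset TM$. Let $\tau_C:C\wedge C\to TM/C$, $\tau_C(v,w)=[v,w]\bmod C$, let $K_x\subset C_x$ be the kernel of $\tau_C$ at $x$, and suppose that $\dim K_x$ does not depend on $x$. A curve is a smooth map from an open interval. A curve is a characteristic curve if its velocity lies in $K$ everywhere, and the characteristic of $(M,C)$ through $x$ is the leaf of $K$ through $x$, i.e. the set of points joined to $x$ by characteristic curves; the characteristics of an open set $U\subset M$ are those of $(U,C|_U)$. For any other field of hyperplanes the same definitions (without the constancy of the dimension) are used. Let a Lie group $G$ with Lie algebra $\mathfrak g$ act smoothly (possibly only locally) on $M$, preserving $C$. For $x\in M$ let $\mathfrak l(x)\subset\mathfrak g$ be the set of all $\xi$ whose generated vector field $\xi_M$ satisfies $\xi_M(x)\in C_x$. For a subspace $\mathfrak l\subset\mathfrak g$ put $M_{\mathfrak l}=\{x:\mathfrak l(x)=\mathfrak l\}$ and $\mathfrak g_{\mathfrak l}=\{\xi\in\mathfrak l:[\xi,\mathfrak l]\subset\mathfrak l\}$. Then: 1. (Contact Noether theorem) The map $x\mapsto\mathfrak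 l(x)$ is constant along the characteristics; hence the characteristic through $x$ lies in $M_{\mathfrak l(x)}$. 2. Suppose that $M_{\mathfrak l}$ is an embedded submanifold on which $C$ cuts a field of hyperplanes $C'=C\cap TM_{\mathfrak l}$, and that $p:M_{\mathfrak l}\to Q_{\mathfrak l}=M_{\mathfrak l}/\exp\mathfrak g_{\mathfrak l}$ is a quotient manifold (a surjective submersion whose fibres are connected and whose fibre tangent spaces are the spaces $\{\xi_M(x):\xi\in\mathfrak g_{\mathfrak l}\}$). Then the spaces $dp(C'_x)$ depend only on $p(x)$ and form a smooth field of hyperplanes $C_{\mathfrak l}$ on $Q_{\mathfrak l}$. The characteristic of $(M,C)$ through $x\in M_{\mathfrak l}$ is contained in the preimage under $p$ of the characteristic of $(Q_{\mathfrak l},C_{\mathfrak l})$ through $p(x)$. The space $P_x\subset T_xM_{\mathfrak l}$ of vectors projected by $dp$ to characteristic directions of $C_{\mathfrak l}$ (the tangent space of this preimage) satisfies $K_x\subset P_x\subset C_x$. 3. Let $U\subset M$ be open and let $\pi:U\to B$ be a smooth submersion to a manifold (for instance a fibration) such that every characteristic of $U$ is contained in a fibre of $\pi$ and $\ker d\pi_x\subset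 C_x$ for all $x\in U$. Then each $d\pi(C_x)$ is a hyperplane in $T_{\pi(x)}B$. A curve in $U$ is a characteristic curve if and only if the pair $(\pi(x),d\pi(C_x))$ (the projected hyperplane together with its base point) is constant along it. Moreover, the characteristic of $U$ through $x$ is the connected component containing $x$ of the set $\{y\in U: \pi(y)=\pi(x),\ d\pi(C_y)=d\pi(C_x)\}$. 4. Consequently, solving the reduced problems gives the original characteristics without further integration: if $U$ is covered by subspaces $M_{\mathfrak l}$ as in 2, and if $\pi:U\to B$ is a smooth submersion with $\ker d\pi_x=P_x$ for all $x\in U$ (its fibres are those of the foliation formed by the preimages of the reduced characteristics), then the conclusions of 3 hold for $\pi$. -/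

import Mathlib

open Set Manifold VectorField
open scoped Topology ContDiff Manifold

noncomputable section

namespace ContactRed

section Fields

variable {E : Type*} [NormedAddCommGroup E] [NormedSpace ℝ E]
  {M : Type*} [TopologicalSpace M] [ChartedSpace E M]

variable {F : Type*} [NormedAddCommGroup F] [NormedSpace ℝ F]
  {B : Type*} [TopologicalSpace B] [ChartedSpace F B]

/-- The projection `dπ (C x)` of `C x`, as a linear subspace of the tangent space of `B` at `π x`,
together with its base point `π x`. -/
def proj (C : ∀ x : M, Submodule ℝ (TangentSpace 𝓘(ℝ, E) x)) (π : M → B) (x : M) :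
    Σ b : B, Submodule ℝ (TangentSpace 𝓘(ℝ, F) b) :=
  ⟨π x, (C x).map (mfderiv 𝓘(ℝ, E) 𝓘(ℝ, F) π x : TangentSpace 𝓘(ℝ, E) x →ₗ[ℝ] _)⟩

/-- The field cut by `C` on a manifold `N` mapped to `M` by `ι`: the vectors `v` of `TN` with
`dι v ∈ C`. -/
def cut (C : ∀ x : M, Submodule ℝ (TangentSpace 𝓘(ℝ, E) x)) (ι : B → M) (n : B) :
    Submodule ℝ (TangentSpace 𝓘(ℝ, F) n) :=
  (C (ι n)).comap (mfderiv 𝓘(ℝ, F) 𝓘(ℝ, E) ι n : TangentSpace 𝓘(ℝ, F) n →ₗ[ℝ] _)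

variable [IsManifold 𝓘(ℝ, E) ∞ M]

/-- A smooth field of hyperplanes on `M`: near every point it is the kernel of a nowhere vanishing
smooth 1-form. -/
def IsHyperplaneField
    (C : ∀ x : M, Submodule ℝ (TangentSpace 𝓘(ℝ, E) x)) : Prop :=
  ∀ x : M, ∃ W : Set M, IsOpen W ∧ x ∈ W ∧
    ∃ α : ∀ y : M, TangentSpace 𝓘(ℝ, E) y →L[ℝ] ℝ,
      ContMDiffOn 𝓘(ℝ, E) (𝓘(ℝ, E).prod 𝓘(ℝ, E →L[ℝ] ℝ)) ∞
        (fun y ↦ Bundle.TotalSpace.mk' (E →L[ℝ] ℝ)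
          (E := fun z : M ↦ (TangentSpace 𝓘(ℝ, E) z →L[ℝ] Bundle.Trivial M ℝ z)) y (α y)) W ∧
      ∀ y ∈ W, α y ≠ 0 ∧ C y = LinearMap.ker (α y : TangentSpace 𝓘(ℝ, E) y →ₗ[ℝ] ℝ)

/-- `V` restricts to a smooth section of `C` on some open neighbourhood of `x`. -/
def IsSectionNear (C : ∀ x : M, Submodule ℝ (TangentSpace 𝓘(ℝ, E) x))
    (V : ∀ x : M, TangentSpace 𝓘(ℝ, E) x) (x : M) : Prop :=
  ∃ W : Set M, IsOpen W ∧ x ∈ W ∧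
    ContMDiffOn 𝓘(ℝ, E) 𝓘(ℝ, E).tangent ∞
      (fun y ↦ (⟨y, V y⟩ : TangentBundle 𝓘(ℝ, E) M)) W ∧
    ∀ y ∈ W, V y ∈ C y

lemma IsSectionNear.mdifferentiableAt {C : ∀ x : M, Submodule ℝ (TangentSpace 𝓘(ℝ, E) x)}
    {V : ∀ x : M, TangentSpace 𝓘(ℝ, E) x} {x : M} (h : IsSectionNear C V x) :
    MDifferentiableAt 𝓘(ℝ, E) 𝓘(ℝ, E).tangent
      (fun y ↦ (⟨y, V y⟩ : TangentBundle 𝓘(ℝ, E) M)) x := by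
  obtain ⟨W, hW, hx, hV, -⟩ := h
  exact (hV.contMDiffAt (hW.mem_nhds hx)).mdifferentiableAt (by simp)

variable [FiniteDimensional ℝ E]

/-- The kernel at `x` of the form `τ_C : C ∧ C → TM / C`, `τ_C(V, W) = [V, W] mod C`:
the vectors `u ∈ C x` having an extension to a local section `V` of `C` such that
`[V, W] x ∈ C x` for all local sections `W` of `C`. Since `τ_C` is tensorial, the choice of the
extension is irrelevant. These are the characteristic directions of `C` at `x`. -/
def charSpace (C : ∀ x : M, Submodule ℝ (TangentSpace 𝓘(ℝ, E) x)) (x : M) :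
    Submodule ℝ (TangentSpace 𝓘(ℝ, E) x) where
  carrier := {u | ∃ V : ∀ y : M, TangentSpace 𝓘(ℝ, E) y, IsSectionNear C V x ∧ V x = u ∧
    ∀ W : ∀ y : M, TangentSpace 𝓘(ℝ, E) y, IsSectionNear C W x →
      mlieBracket 𝓘(ℝ, E) V W x ∈ C x}
  zero_mem' := by
    refine ⟨0, ⟨univ, isOpen_univ, mem_univ x, ?_, fun y _ ↦ (C y).zero_mem⟩, rfl, fun W _ ↦ ?_⟩
    · exact (Bundle.contMDiff_zeroSection ℝ (TangentSpace 𝓘(ℝ, E) (M := M))).contMDiffOn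
    · simp only [mlieBracket_zero_left]; exact (C x).zero_mem
  add_mem' := by
    rintro u v ⟨V, hV, rfl, hV'⟩ ⟨V₁, hV₁, rfl, hV₁'⟩
    refine ⟨V + V₁, ?_, rfl, fun W hW ↦ ?_⟩
    · obtain ⟨A, hA, hxA, hsA, hcA⟩ := hV
      obtain ⟨B, hB, hxB, hsB, hcB⟩ := hV₁
      refine ⟨A ∩ B, hA.inter hB, ⟨hxA, hxB⟩, ?_, fun y hy ↦ (C y).add_mem (hcA y hy.1) (hcB y hy.2)⟩
      exact (hsA.mono inter_subset_left).add_section (hsB.mono inter_subset_right)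
    · have : CompleteSpace E := FiniteDimensional.complete ℝ E
      rw [mlieBracket_add_left hV.mdifferentiableAt hV₁.mdifferentiableAt]
      exact (C x).add_mem (hV' W hW) (hV₁' W hW)
  smul_mem' := by
    rintro c u ⟨V, hV, rfl, hV'⟩
    refine ⟨c • V, ?_, rfl, fun W hW ↦ ?_⟩
    · obtain ⟨A, hA, hxA, hsA, hcA⟩ := hV
      exact ⟨A, hA, hxA, hsA.const_smul_section, fun y hy ↦ (C y).smul_mem c (hcA y hy)⟩
    · have : CompleteSpace E := FiniteDimensional.complete ℝ E
      rw [mlieBracket_const_smul_left hV.mdifferentiableAt]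
      exact (C x).smul_mem c (hV' W hW)

/-- `γ` is smooth on the open interval `J` with values in `U`. -/
def IsCurveIn (U : Set M) (γ : ℝ → M) (J : Set ℝ) : Prop :=
  IsOpen J ∧ J.OrdConnected ∧ ContMDiffOn 𝓘(ℝ, ℝ) 𝓘(ℝ, E) ∞ γ J ∧ ∀ t ∈ J, γ t ∈ U

/-- The velocity of `γ` on `J` is everywhere a characteristic direction of `C`. -/
def IsCharacteristic (C : ∀ x : M, Submodule ℝ (TangentSpace 𝓘(ℝ, E) x))
    (γ : ℝ → M) (J : Set ℝ) : Prop :=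
  ∀ t ∈ J, mfderiv 𝓘(ℝ, ℝ) 𝓘(ℝ, E) γ t (1 : ℝ) ∈ charSpace C (γ t)

/-- The characteristic through `x` of the restriction of `C` to the open set `U` (the leaf through
`x` of the characteristic foliation of `U`): the points that can be joined to `x` by a smooth curve
in `U` tangent to the characteristic directions. -/
def leaf (C : ∀ x : M, Submodule ℝ (TangentSpace 𝓘(ℝ, E) x)) (U : Set M) (x : M) : Set M :=
  {y | ∃ (γ : ℝ → M) (J : Set ℝ), IsCurveIn (E := E) U γ J ∧ IsCharacteristic C γ J ∧
    ∃ s ∈ J, ∃ t ∈ J, γ s = x ∧ γ t = y}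

/-- The projections of `C` to the tangent spaces of `B` are hyperplanes; the characteristic curves
of `C` in `U` are exactly the curves along which this projected hyperplane is constant; and the
characteristics of `C` in `U` are the connected components of the sets on which it is constant. -/
def DeterminesCharacteristics (C : ∀ x : M, Submodule ℝ (TangentSpace 𝓘(ℝ, E) x))
    (U : Set M) (π : M → B) : Prop :=
  (∀ x ∈ U, IsCoatom (proj (F := F) C π x).2) ∧
  (∀ (γ : ℝ → M) (J : Set ℝ), IsCurveIn (E := E) U γ J →
    (IsCharacteristic C γ J ↔
      ∀ s ∈ J, ∀ t ∈ J, proj (F := F) C π (γ s) = proj C π (γ t))) ∧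
  (∀ x ∈ U, leaf C U x =
    connectedComponentIn {y | y ∈ U ∧ proj (F := F) C π y = proj C π x} x)

end Fields

section Actions

/-- A smooth local action of the Lie group `G` on `M`: `g · x` is defined for `(g, x)` in an open
neighbourhood `dom` of `{1} × M` (a global action is the case `dom = univ`; outside `dom` the value
of `act` is irrelevant). -/
structure LocalAction {EG : Type*} [NormedAddCommGroup EG] [NormedSpace ℝ EG]
    (G : Type*) [TopologicalSpace G] [ChartedSpace EG G] [Group G]
    {E : Type*} [NormedAddCommGroup E] [NormedSpace ℝ E]
    (M : Type*) [TopologicalSpace M] [ChartedSpace E M] where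
  dom : Set (G × M)
  act : G → M → M
  isOpen_dom : IsOpen dom
  one_mem : ∀ x, ((1 : G), x) ∈ dom
  one_act : ∀ x, act 1 x = x
  mul_act : ∀ g h x, (h, x) ∈ dom → (g, act h x) ∈ dom → (g * h, x) ∈ dom →
    act g (act h x) = act (g * h) x
  smooth : ContMDiffOn (𝓘(ℝ, EG).prod 𝓘(ℝ, E)) 𝓘(ℝ, E) ∞ (fun q : G × M ↦ act q.1 q.2) dom

variable {EG : Type*} [NormedAddCommGroup EG] [NormedSpace ℝ EG]
  {G : Type*} [TopologicalSpace G] [ChartedSpace EG G] [Group G]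
  {E : Type*} [NormedAddCommGroup E] [NormedSpace ℝ E]
  {M : Type*} [TopologicalSpace M] [ChartedSpace E M]

/-- The action maps `C x` into `C (g · x)`. -/
def LocalAction.Preserves (A : LocalAction (EG := EG) G (E := E) M)
    (C : ∀ x : M, Submodule ℝ (TangentSpace 𝓘(ℝ, E) x)) : Prop :=
  ∀ g x, (g, x) ∈ A.dom → ∀ v ∈ C x, mfderiv 𝓘(ℝ, E) 𝓘(ℝ, E) (A.act g) x v ∈ C (A.act g x)

/-- The value at `x` of the vector field on `M` generated by an element of the Lie algebra, i.e. the
differential at `1` of the orbit map `g ↦ g · x` (recall that `1 · x = x`). -/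
def LocalAction.generator (A : LocalAction (EG := EG) G (E := E) M) (x : M) :
    GroupLieAlgebra 𝓘(ℝ, EG) G →L[ℝ] TangentSpace 𝓘(ℝ, E) x :=
  mfderiv 𝓘(ℝ, EG) 𝓘(ℝ, E) (fun g ↦ A.act g x) (1 : G)

/-- `𝔩(x)`: the elements of the Lie algebra that are mapped into `C` at `x`. -/
def LocalAction.lie (A : LocalAction (EG := EG) G (E := E) M)
    (C : ∀ x : M, Submodule ℝ (TangentSpace 𝓘(ℝ, E) x)) (x : M) :
    Submodule ℝ (GroupLieAlgebra 𝓘(ℝ, EG) G) :=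
  (C x).comap (A.generator x : GroupLieAlgebra 𝓘(ℝ, EG) G →ₗ[ℝ] _)

/-- `M_𝔩`: the points `x` with `𝔩(x) = 𝔩`. -/
def LocalAction.level (A : LocalAction (EG := EG) G (E := E) M)
    (C : ∀ x : M, Submodule ℝ (TangentSpace 𝓘(ℝ, E) x))
    (l : Submodule ℝ (GroupLieAlgebra 𝓘(ℝ, EG) G)) : Set M :=
  {x | A.lie C x = l}

/-- `𝔤_𝔩`: the intersection of `𝔩` with its stabilizer `{ξ | [ξ, 𝔩] ⊆ 𝔩}`. -/
def isotropy (l : Submodule ℝ (GroupLieAlgebra 𝓘(ℝ, EG) G)) :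
    Set (GroupLieAlgebra 𝓘(ℝ, EG) G) :=
  {ξ | ξ ∈ l ∧ ∀ η ∈ l, ⁅ξ, η⁆ ∈ l}

variable {EN : Type*} [NormedAddCommGroup EN] [NormedSpace ℝ EN]
  {N : Type*} [TopologicalSpace N] [ChartedSpace EN N]
  {EQ : Type*} [NormedAddCommGroup EQ] [NormedSpace ℝ EQ]
  {Q : Type*} [TopologicalSpace Q] [ChartedSpace EQ Q]

/-- The reduction of `(M, C)` at `l` makes sense, with quotient `Q`: `M_𝔩` is an embedded
submanifold (the image of the embedding `ι` of `N`) on which `C` cuts a field of hyperplanes, and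
`p : N → Q` is the quotient by `exp 𝔤_𝔩`, i.e. a surjective submersion whose fibres are connected
and tangent to the directions of the action of `𝔤_𝔩`. -/
structure IsReduction (A : LocalAction (EG := EG) G (E := E) M)
    (C : ∀ x : M, Submodule ℝ (TangentSpace 𝓘(ℝ, E) x))
    (l : Submodule ℝ (GroupLieAlgebra 𝓘(ℝ, EG) G)) (ι : N → M) (p : N → Q) : Prop where
  embedding : IsSmoothEmbedding 𝓘(ℝ, EN) 𝓘(ℝ, E) ∞ ι
  range_eq : range ι = A.level C l
  hyperplane : ∀ n, IsCoatom (cut (F := EN) C ι n)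
  submersion : IsSubmersion 𝓘(ℝ, EN) 𝓘(ℝ, EQ) ∞ p
  surjective : Function.Surjective p
  connected : ∀ q, IsConnected (p ⁻¹' {q})
  orbits : ∀ n, mfderiv 𝓘(ℝ, EN) 𝓘(ℝ, E) ι n '' {v | mfderiv 𝓘(ℝ, EN) 𝓘(ℝ, EQ) p n v = 0} =
    A.generator (ι n) '' isotropy l

/-- The field on the quotient `Q` obtained by projecting the field that `C` cuts on `N`. -/
def reducedField (C : ∀ x : M, Submodule ℝ (TangentSpace 𝓘(ℝ, E) x)) (ι : N → M) (p : N → Q)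
    (q : Q) : Submodule ℝ (TangentSpace 𝓘(ℝ, EQ) q) :=
  sSup {S | ∃ n : N, proj (cut (F := EN) C ι) p n = ⟨q, S⟩}

/-- The linear subspace of `T_{ι n} M` tangent to `ι (p⁻¹ L)`, for `L ⊆ Q` through `p n` with tangent
space `S` at `p n`. -/
def tangentPreimage (ι : N → M) (p : N → Q) (n : N)
    (S : Submodule ℝ (TangentSpace 𝓘(ℝ, EQ) (p n))) :
    Submodule ℝ (TangentSpace 𝓘(ℝ, E) (ι n)) :=
  (S.comap (mfderiv 𝓘(ℝ, EN) 𝓘(ℝ, EQ) p n : TangentSpace 𝓘(ℝ, EN) n →ₗ[ℝ] _)).map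
    (mfderiv 𝓘(ℝ, EN) 𝓘(ℝ, E) ι n : TangentSpace 𝓘(ℝ, EN) n →ₗ[ℝ] _)

end Actions

end ContactRed

end

set_option linter.unusedSectionVars false

noncomputable section

namespace ContactRed

/-! ### Kernels of varying functionals and maps, constant rank, integral curves, pullback of `d`. -/

section Calculus

/-! In a chart `C` is the kernel of a 1-form `a`, and Cartan's formula turns the bracket definition
of `K` into a pointwise one (`IsCoordForm.mem_charSpace_iff`): `v` is characteristic when `a v = 0`
and `da(v, w) = 0` for all `w ∈ ker a`. All parts are computations with this condition.

Noether: let `X` be the coordinate field of a generator. Invariance of `C` says that the Lie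
derivative of `a` along `X` vanishes on `ker a`. Hence along a characteristic curve the function `f
= a(X)` satisfies a linear equation `f' = μ f` (`IsCharVec.deriv_pairing`), and if it vanishes once
it vanishes everywhere.

Reduction: for `ξ ∈ 𝔩` the function `a(X)` vanishes on `M_𝔩`. Differentiating this along `M_𝔩` and
using invariance shows that the orbit directions tangent to `M_𝔩` are characteristic for `C'`
(`mem_charSpace_cut_of_generator`). A hyperplane field is constant along fibres whose directions are
characteristic, so `C'` descends to `C_𝔩`. Since `C'` is the field cut by `C_𝔩` along the submersion
`p`, the map `dp` sends characteristic directions of `C'` to those of `C_𝔩`. By Noether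
characteristic curves stay in `M_𝔩`, so `K` is tangent to it, and a characteristic direction of `C`
tangent to `M_𝔩` is one of `C'`. This gives `K ⊂ P`; and `P ⊂ C` because characteristic directions
of `C_𝔩` lie in `C_𝔩`.

Fibrations: take charts in which `π` is a linear map `L`, with `ker L ⊂ ker a`. For vertical `v` the
term `(D_w a) v` of `da(v, w)` vanishes (`IsFibredForm.fderiv_eq_zero`), so `v` is characteristic
exactly when `D_v a` kills `ker a`, that is, when `ker a` is stationary in the direction `v`. This
settles the statement on curves. For the components, `(L, a / a R)` has derivative with kernel `K`,
of constant rank, so that nearby points of one of its level sets are joined by a characteristic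
curve (`IsFibredForm.eventually_mem_leaf`). The last assertion follows from `K ⊂ P ⊂ C`. -/

lemma ker_transport {E : Type*} [NormedAddCommGroup E] [NormedSpace ℝ E]
    {β β' : ℝ → E →L[ℝ] ℝ} {J : Set ℝ} (hJo : IsOpen J) (hJ : J.OrdConnected)
    (hβ : ∀ t ∈ J, HasDerivAt β (β' t) t) (h0 : ∀ t ∈ J, β t ≠ 0)
    (h : ∀ t ∈ J, ∀ w, β t w = 0 → β' t w = 0) {s t : ℝ} (hs : s ∈ J) (ht : t ∈ J) (w : E) :
    β s w = 0 ↔ β t w = 0 := by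
  refine hJ.isPreconnected.induction₂ (fun s t ↦ (β s w = 0 ↔ β t w = 0)) ?_
    (fun _ _ _ _ _ _ ↦ Iff.trans) (fun _ _ _ _ ↦ Iff.symm) hs ht
  intro x hx
  obtain ⟨R, hR⟩ : ∃ R, β x R ≠ 0 := by
    by_contra! hc
    exact h0 x hx (ContinuousLinearMap.ext hc)
  have hd : ∀ t ∈ J, ∀ v, HasDerivAt (fun t ↦ β t v) (β' t v) t := fun t ht v ↦ by
    simpa using (hβ t ht).clm_apply (hasDerivAt_const t v)
  have hn : {y | y ∈ J ∧ β y R ≠ 0} ∈ 𝓝 x :=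
    Filter.inter_mem (hJo.mem_nhds hx) ((hd x hx R).continuousAt.eventually_ne hR)
  obtain ⟨ε, hε, hball⟩ := Metric.mem_nhds_iff.1 hn
  -- The vector `β y R • w - β y w • R` lies in `ker (β y)`, hence is killed by `β' y`; this is the
  -- vanishing of the numerator in the quotient rule.
  have hq : ∀ y ∈ Metric.ball x ε, HasDerivAt (fun y ↦ β y w / β y R) 0 y := fun y hy ↦ by
    obtain ⟨hyJ, hyR⟩ := hball hy
    have := h y hyJ (β y R • w - β y w • R) (by simp [mul_comm])
    simp only [map_sub, map_smul, smul_eq_mul] at this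
    refine ((hd y hyJ w).div (hd y hyJ R) hyR).congr_deriv ?_
    rw [show β' y w * β y R - β y w * β' y R = 0 by linarith, zero_div]
  have hc : ∀ y ∈ Metric.ball x ε, β y w / β y R = β x w / β x R := fun y hy ↦
    (convex_ball x ε).is_const_of_fderivWithin_eq_zero (𝕜 := ℝ)
      (fun z hz ↦ (hq z hz).differentiableAt.differentiableWithinAt)
      (fun z hz ↦ by
        rw [fderivWithin_of_isOpen Metric.isOpen_ball hz, (hq z hz).hasFDerivAt.fderiv]; ext; simp) hy
      (Metric.mem_ball_self hε)
  refine Filter.Eventually.filter_mono nhdsWithin_le_nhds ?_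
  filter_upwards [Metric.ball_mem_nhds x hε] with y hy
  have h1 := hc y hy
  have h2 := (hball hy).2
  constructor
  · intro h3
    rw [h3, zero_div, div_eq_zero_iff] at h1
    exact h1.resolve_right h2
  · intro h3
    rw [h3, zero_div, eq_comm, div_eq_zero_iff] at h1
    exact h1.resolve_right hR

/-- Grönwall's inequality gives the propagation of zeros forward in time; the backward direction
follows by the reflection `u ↦ -u`. -/
lemma zero_iff_of_abs_deriv_le {f f' : ℝ → ℝ} {a b K : ℝ}
    (hf : ∀ t ∈ Ioo a b, HasDerivAt f (f' t) t) (h : ∀ t ∈ Ioo a b, |f' t| ≤ K * |f t|)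
    {s t : ℝ} (hs : s ∈ Ioo a b) (ht : t ∈ Ioo a b) (h0 : f s = 0) : f t = 0 := by
  have key : ∀ (g g' : ℝ → ℝ) (c d : ℝ), (∀ t ∈ Icc c d, HasDerivAt g (g' t) t) →
      (∀ t ∈ Icc c d, |g' t| ≤ K * |g t|) → g c = 0 → c ≤ d → g d = 0 := by
    intro g g' c d hg hb h0 hcd
    exact eq_zero_of_abs_deriv_le_mul_abs_self_of_eq_zero_right (f' := g') (K := K)
      (fun t ht ↦ (hg t ht).continuousAt.continuousWithinAt)
      (fun t ht ↦ (hg t (Ico_subset_Icc_self ht)).hasDerivWithinAt) h0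
      (fun t ht ↦ hb t (Ico_subset_Icc_self ht)) d (right_mem_Icc.2 hcd)
  rcases le_total s t with hst | hst
  · exact key f f' s t (fun u hu ↦ hf u ⟨hs.1.trans_le hu.1, hu.2.trans_lt ht.2⟩)
      (fun u hu ↦ h u ⟨hs.1.trans_le hu.1, hu.2.trans_lt ht.2⟩) h0 hst
  · have hm : ∀ u ∈ Icc (-s) (-t), -u ∈ Ioo a b := fun u hu ↦
      ⟨by linarith [hu.2, ht.1], by linarith [hu.1, hs.2]⟩
    have := key (fun u ↦ f (-u)) (fun u ↦ - f' (-u)) (-s) (-t)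
      (fun u hu ↦ by
        have := (hf _ (hm u hu)).scomp u (hasDerivAt_neg u)
        simpa [Function.comp_def] using this)
      (fun u hu ↦ by simpa using h _ (hm u hu)) (by simpa using h0) (by linarith)
    simpa using this

section Split

lemma prod_eq_inl_add_inr {E V W : Type*} [NormedAddCommGroup E] [NormedSpace ℝ E]
    [NormedAddCommGroup V] [NormedSpace ℝ V] [NormedAddCommGroup W] [NormedSpace ℝ W]
    (f : E →L[ℝ] V) (g : E →L[ℝ] W) :
    f.prod g = ContinuousLinearMap.inl ℝ V W ∘L f + ContinuousLinearMap.inr ℝ V W ∘L g := by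
  ext <;> simp

variable {E G : Type*} [NormedAddCommGroup E] [NormedSpace ℝ E] [FiniteDimensional ℝ E]
  [NormedAddCommGroup G] [NormedSpace ℝ G]

/-- Projections that make `A` invertible modulo its kernel. -/
lemma exists_split (A : E →L[ℝ] G) : ∃ (P : G →L[ℝ] A.range) (T : E →L[ℝ] A.ker)
    (Θ : E ≃L[ℝ] A.range × A.ker), (Θ : E →L[ℝ] A.range × A.ker) = (P ∘L A).prod T ∧
      ∀ u : A.ker, T u = u := by
  obtain ⟨P, hP⟩ := Submodule.ClosedComplemented.of_finiteDimensional A.range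
  obtain ⟨T, hT⟩ := Submodule.ClosedComplemented.of_finiteDimensional A.ker
  have hA : ∀ u, P (A u) = ⟨A u, LinearMap.mem_range_self _ u⟩ :=
    fun u ↦ hP ⟨A u, LinearMap.mem_range_self _ u⟩
  have hbij : Function.Bijective ((P ∘L A).prod T : E →ₗ[ℝ] A.range × A.ker) := by
    constructor
    · rw [← LinearMap.ker_eq_bot, Submodule.eq_bot_iff]
      intro u hu
      have h1 : P (A u) = 0 := congrArg Prod.fst hu
      have h2 : T u = 0 := congrArg Prod.snd hu
      rw [hA] at h1
      have h3 : u ∈ A.ker := congrArg Subtype.val h1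
      have h4 := hT ⟨u, h3⟩
      rw [h2] at h4
      exact (congrArg Subtype.val h4).symm
    · rintro ⟨⟨_, x, rfl⟩, k⟩
      have hk : ∀ k : A.ker, A k = 0 := fun k ↦ k.2
      refine ⟨x - T x + k, Prod.ext ?_ ?_⟩
      · change P (A (x - T x + k)) = _
        have : A (x - T x + k) = A x := by simp [hk]
        rw [this, hA]; rfl
      · change T (x - T x + k) = k
        simp [hT]
  refine ⟨P, T, (LinearEquiv.ofBijective _ hbij).toContinuousLinearEquiv, ?_, hT⟩
  ext <;> rfl

variable {X : Type*} [TopologicalSpace X] {A : X → E →L[ℝ] G} {z₀ : X} {k : ℕ}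

/-- Invertibility of `(P ∘ A z, T)` is an open condition. Where it holds, `T` is injective on `ker
(P ∘ A z)`, which therefore has dimension at most `k`; it contains `ker (A z)`, of dimension `k`, so
the two coincide. -/
lemma eventually_ker_eq (hA : ContinuousAt A z₀)
    (hk : ∀ᶠ z in 𝓝 z₀, Module.finrank ℝ (A z).ker = k)
    {P : G →L[ℝ] (A z₀).range} {T : E →L[ℝ] (A z₀).ker} {Θ : E ≃L[ℝ] (A z₀).range × (A z₀).ker}
    (hΘ : (Θ : E →L[ℝ] (A z₀).range × (A z₀).ker) = (P ∘L A z₀).prod T) :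
    ∀ᶠ z in 𝓝 z₀, (∃ Θ' : E ≃L[ℝ] (A z₀).range × (A z₀).ker,
      (Θ' : E →L[ℝ] (A z₀).range × (A z₀).ker) = (P ∘L A z).prod T) ∧
      ∀ v, P (A z v) = 0 → A z v = 0 := by
  have : CompleteSpace E := FiniteDimensional.complete ℝ E
  have hc : ContinuousAt (fun z ↦ (P ∘L A z).prod T) z₀ :=
    by
      simp_rw [prod_eq_inl_add_inr]
      exact (continuousAt_const.clm_comp (continuousAt_const.clm_comp hA)).add continuousAt_const
  have hn := hc.eventually (p := fun B ↦ B ∈ range ((↑) : (E ≃L[ℝ] (A z₀).range × (A z₀).ker) → _))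
    (by beta_reduce; rw [← hΘ]; exact Θ.nhds)
  filter_upwards [hn, hk] with z ⟨Θ', hΘ'⟩ hz
  refine ⟨⟨Θ', hΘ'⟩, ?_⟩
  have hle : (A z).ker ≤ (P ∘L A z).ker := fun v hv ↦ by
    have : A z v = 0 := hv
    change P (A z v) = 0
    rw [this, map_zero]
  have hinj : Function.Injective ((T : E →ₗ[ℝ] (A z₀).ker).domRestrict (P ∘L A z).ker) := by
    rw [← LinearMap.ker_eq_bot, Submodule.eq_bot_iff]
    rintro ⟨v, hv⟩ hv'
    have h1 : Θ' v = 0 := by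
      have := DFunLike.congr_fun hΘ' v
      exact this.trans (Prod.ext hv hv')
    exact Subtype.ext ((map_eq_zero_iff _ Θ'.injective).1 h1)
  have hfr := LinearMap.finrank_le_finrank_of_injective hinj
  rw [hk.self_of_nhds, ← hz] at hfr
  have heq := Submodule.eq_of_le_of_finrank_le hle hfr
  intro v hv
  have : v ∈ (P ∘L A z).ker := hv
  rw [← heq] at this
  exact this

end Split

lemma ordConnected_preimage_ball {V : Type*} [NormedAddCommGroup V] [NormedSpace ℝ V]
    (x v y : V) (ε : ℝ) : ((fun t : ℝ ↦ x + t • v) ⁻¹' Metric.ball y ε).OrdConnected := by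
  have h : (fun t : ℝ ↦ x + t • v) = AffineMap.lineMap (k := ℝ) x (x + v) := by
    funext t
    rw [AffineMap.lineMap_apply, vsub_eq_sub, vadd_eq_add, add_comm, add_sub_cancel_left]
  rw [h]
  exact ((convex_ball y ε).affine_preimage _).ordConnected

lemma two_le_infty : (2 : WithTop ℕ∞) ≤ ∞ := by
  exact WithTop.coe_le_coe.2 (le_top : (2 : ℕ∞) ≤ ⊤)

section SmoothKernel

variable {E G : Type*} [NormedAddCommGroup E] [NormedSpace ℝ E] [FiniteDimensional ℝ E]
  [NormedAddCommGroup G] [NormedSpace ℝ G]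

/-- The section is the solution of `P (A z X) = 0`, `T X = u`. It is smooth because inversion of
linear maps is, and `P` can be dropped from the first equation because the rank is constant. -/
lemma exists_smooth_ker_section {A : E → E →L[ℝ] G} {O : Set E} (hO : IsOpen O)
    (hA : ContDiffOn ℝ ∞ A O) {k : ℕ} (hk : ∀ z ∈ O, Module.finrank ℝ (A z).ker = k)
    {z₀ : E} (hz₀ : z₀ ∈ O) {u : E} (hu : A z₀ u = 0) :
    ∃ (O' : Set E) (X : E → E), IsOpen O' ∧ O' ⊆ O ∧ z₀ ∈ O' ∧ ContDiffOn ℝ ∞ X O' ∧ X z₀ = u ∧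
      ∀ z ∈ O', A z (X z) = 0 := by
  have : CompleteSpace E := FiniteDimensional.complete ℝ E
  obtain ⟨P, T, Θ, hΘ, hT⟩ := exists_split (A z₀)
  have hOn := hO.mem_nhds hz₀
  have hev := eventually_ker_eq (hA.continuousOn.continuousAt hOn)
    (Filter.eventually_of_mem hOn hk) hΘ
  obtain ⟨O₁, hO₁, hO₁o, hzO₁⟩ := eventually_nhds_iff.1 hev
  let B : E → E →L[ℝ] (A z₀).range × (A z₀).ker := fun z ↦ (P ∘L A z).prod T
  refine ⟨O ∩ O₁, fun z ↦ (B z).inverse (0, ⟨u, hu⟩), hO.inter hO₁o, inter_subset_left,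
    ⟨hz₀, hzO₁⟩, ?_, ?_, ?_⟩
  · intro z hz
    have hBz : ContDiffAt ℝ ∞ B z := by
      have h1 : ContDiffAt ℝ ∞ A z := hA.contDiffAt (hO.mem_nhds hz.1)
      simp_rw [B, prod_eq_inl_add_inr]
      exact (contDiffAt_const.clm_comp (contDiffAt_const.clm_comp h1)).add contDiffAt_const
    obtain ⟨Θ', hΘ'⟩ := (hO₁ z hz.2).1
    have h2 : ContDiffAt ℝ ∞ (ContinuousLinearMap.inverse (R := ℝ)) (B z) := by
      change ContDiffAt ℝ ∞ _ ((P ∘L A z).prod T)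
      rw [← hΘ']
      exact contDiffAt_map_inverse Θ'
    exact ((h2.comp z hBz).clm_apply contDiffAt_const).contDiffWithinAt
  · change ((P ∘L A z₀).prod T).inverse _ = _
    rw [← hΘ, ContinuousLinearMap.inverse_equiv]
    rw [ContinuousLinearEquiv.coe_coe, ContinuousLinearEquiv.symm_apply_eq]
    have := DFunLike.congr_fun hΘ u
    refine Eq.trans ?_ this.symm
    refine Prod.ext ?_ (hT ⟨u, hu⟩).symm
    change 0 = P (A z₀ u)
    rw [hu, map_zero]
  · intro z hz
    obtain ⟨⟨Θ', hΘ'⟩, hker⟩ := hO₁ z hz.2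
    apply hker
    change P (A z (((P ∘L A z).prod T).inverse _)) = 0
    rw [← hΘ', ContinuousLinearMap.inverse_equiv]
    have := DFunLike.congr_fun hΘ' (Θ'.symm (0, ⟨u, hu⟩))
    have h2 := congrArg Prod.fst this
    simpa using h2.symm

/-- Constant rank theorem: nearby points of a level set are joined by a smooth curve tangent to the
kernel of the derivative. -/
lemma exists_curve_in_level {Φ : E → G} {O : Set E} (hO : IsOpen O)
    (hΦ : ContDiffOn ℝ ∞ Φ O) {k : ℕ} (hk : ∀ z ∈ O, Module.finrank ℝ (fderiv ℝ Φ z).ker = k)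
    {z₀ : E} (hz₀ : z₀ ∈ O) :
    ∀ᶠ z in 𝓝 z₀, Φ z = Φ z₀ → ∃ (c : ℝ → E) (J : Set ℝ), IsOpen J ∧ J.OrdConnected ∧
      0 ∈ J ∧ 1 ∈ J ∧ ContDiffOn ℝ ∞ c J ∧ (∀ t ∈ J, c t ∈ O) ∧ c 0 = z₀ ∧ c 1 = z ∧
      ∀ t ∈ J, fderiv ℝ Φ (c t) (deriv c t) = 0 := by
  have : CompleteSpace E := FiniteDimensional.complete ℝ E
  have hOn := hO.mem_nhds hz₀
  have hdΦ : ContDiffOn ℝ ∞ (fderiv ℝ Φ) O := hΦ.fderiv_of_isOpen hO (by simp)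
  obtain ⟨P, T, Θ, hΘ, hT⟩ := exists_split (fderiv ℝ Φ z₀)
  have hev := eventually_ker_eq (hdΦ.continuousOn.continuousAt hOn)
    (Filter.eventually_of_mem hOn hk) hΘ
  obtain ⟨O₁, hO₁, hO₁o, hzO₁⟩ := eventually_nhds_iff.1 hev
  -- A local diffeomorphism whose first component is `P ∘ Φ`. A segment in these coordinates between
  -- two points of the same level of `Φ` keeps `P ∘ Φ` constant, and constancy of the rank removes
  -- `P` at the level of derivatives.
  let Ψ : E → (fderiv ℝ Φ z₀).range × (fderiv ℝ Φ z₀).ker := fun z ↦ (P (Φ z), T z)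
  have hΨ : ∀ z ∈ O, ContDiffAt ℝ ∞ Ψ z := fun z hz ↦
    (P.contDiff.contDiffAt.comp z (hΦ.contDiffAt (hO.mem_nhds hz))).prodMk T.contDiff.contDiffAt
  have hdiff : ∀ z ∈ O, DifferentiableAt ℝ Φ z := fun z hz ↦
    (hΦ.contDiffAt (hO.mem_nhds hz)).differentiableAt (by simp)
  have hΨ' : ∀ z ∈ O, HasFDerivAt Ψ ((P ∘L fderiv ℝ Φ z).prod T) z := fun z hz ↦
    (P.hasFDerivAt.comp z (hdiff z hz).hasFDerivAt).prodMk T.hasFDerivAt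
  have h0 : HasFDerivAt Ψ (Θ : E →L[ℝ] _) z₀ := hΘ ▸ hΨ' z₀ hz₀
  let ψ := (hΨ z₀ hz₀).toOpenPartialHomeomorph Ψ h0 (by simp)
  have hψ : ∀ z, ψ z = Ψ z := fun z ↦ rfl
  have hzs : z₀ ∈ ψ.source := (hΨ z₀ hz₀).mem_toOpenPartialHomeomorph_source h0 (by simp)
  have hV : IsOpen (ψ.target ∩ ψ.symm ⁻¹' (O ∩ O₁)) :=
    ψ.isOpen_inter_preimage_symm (hO.inter hO₁o)
  have hmV : Ψ z₀ ∈ ψ.target ∩ ψ.symm ⁻¹' (O ∩ O₁) := by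
    refine ⟨ψ.map_source hzs, ?_⟩
    change ψ.symm (ψ z₀) ∈ O ∩ O₁
    rw [ψ.left_inv hzs]
    exact ⟨hz₀, hzO₁⟩
  obtain ⟨ε, hε, hball⟩ := Metric.isOpen_iff.1 hV _ hmV
  have hcΨ : ContinuousAt Ψ z₀ := (hΨ z₀ hz₀).continuousAt
  filter_upwards [hcΨ (Metric.ball_mem_nhds _ hε), ψ.open_source.mem_nhds hzs] with z hz hzs' hlev
  let l : ℝ → (fderiv ℝ Φ z₀).range × (fderiv ℝ Φ z₀).ker := fun t ↦ Ψ z₀ + t • (Ψ z - Ψ z₀)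
  have hl : ContDiff ℝ ∞ l := by fun_prop
  have hlc : (l ⁻¹' Metric.ball (Ψ z₀) ε).OrdConnected := by
    exact ordConnected_preimage_ball _ _ _ _
  have hlO : ∀ t ∈ l ⁻¹' Metric.ball (Ψ z₀) ε,
      l t ∈ ψ.target ∧ ψ.symm (l t) ∈ O ∧ ψ.symm (l t) ∈ O₁ := fun t ht ↦ hball ht
  have hsm : ∀ t ∈ l ⁻¹' Metric.ball (Ψ z₀) ε, ContDiffAt ℝ ∞ (fun t ↦ ψ.symm (l t)) t := by
    intro t ht
    obtain ⟨h1, h2, h3⟩ := hlO t ht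
    obtain ⟨Θ', hΘ'⟩ := (hO₁ _ h3).1
    have h4 : HasFDerivAt ψ (Θ' : E →L[ℝ] _) (ψ.symm (l t)) := hΘ' ▸ hΨ' _ h2
    exact (ψ.contDiffAt_symm h1 h4 (hΨ _ h2)).comp t hl.contDiffAt
  have hl1 : l 1 = Ψ z := by simp [l]
  have hl0 : l 0 = Ψ z₀ := by simp [l]
  refine ⟨fun t ↦ ψ.symm (l t), l ⁻¹' Metric.ball (Ψ z₀) ε,
    Metric.isOpen_ball.preimage hl.continuous, hlc, ?_, ?_,
    fun t ht ↦ (hsm t ht).contDiffWithinAt, fun t ht ↦ (hlO t ht).2.1, ?_, ?_, ?_⟩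
  · rw [mem_preimage, hl0]; exact Metric.mem_ball_self hε
  · rw [mem_preimage, hl1]; exact hz
  · change ψ.symm (l 0) = z₀
    rw [hl0]; exact ψ.left_inv hzs
  · change ψ.symm (l 1) = z
    rw [hl1]; exact ψ.left_inv hzs'
  · intro t ht
    obtain ⟨h1, h2, h3⟩ := hlO t ht
    apply (hO₁ _ h3).2
    have hc : HasDerivAt (fun t ↦ ψ.symm (l t)) (deriv (fun t ↦ ψ.symm (l t)) t) t :=
      ((hsm t ht).differentiableAt (by simp)).hasDerivAt
    have h5 := ((P.hasFDerivAt.comp _ (hdiff _ h2).hasFDerivAt).comp_hasDerivAt t hc)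
    have h6 : (P ∘ Φ) ∘ (fun t ↦ ψ.symm (l t)) =ᶠ[𝓝 t] fun _ ↦ P (Φ z₀) := by
      filter_upwards [(Metric.isOpen_ball.preimage hl.continuous).mem_nhds ht] with s hs
      have h7 : Ψ (ψ.symm (l s)) = l s := ψ.right_inv (hlO s hs).1
      have h8 : P (Φ (ψ.symm (l s))) = (l s).1 := congrArg Prod.fst h7
      change P (Φ (ψ.symm (l s))) = _
      rw [h8]
      simp [l, Ψ, hlev]
    exact (h5.congr_of_eventuallyEq h6.symm).unique (hasDerivAt_const t _)

/-- Picard–Lindelöf gives the curve; smoothness is a bootstrap, since `c' = X ∘ c` has the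
regularity already known for `c`. -/
lemma exists_smooth_integralCurve {X : E → E} {O : Set E} (hO : IsOpen O)
    (hX : ContDiffOn ℝ ∞ X O) {z₀ : E} (hz₀ : z₀ ∈ O) :
    ∃ (c : ℝ → E) (ε : ℝ), 0 < ε ∧ c 0 = z₀ ∧ ContDiffOn ℝ ∞ c (Ioo (-ε) ε) ∧
      ∀ t ∈ Ioo (-ε) ε, c t ∈ O ∧ HasDerivAt c (X (c t)) t := by
  have : CompleteSpace E := FiniteDimensional.complete ℝ E
  obtain ⟨c, hc0, ε, hε, hc⟩ := ContDiffAt.exists_forall_mem_closedBall_exists_eq_forall_mem_Ioo_hasDerivAt₀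
    ((hX.contDiffAt (hO.mem_nhds hz₀)).of_le (by simp)) 0
  simp only [zero_sub, zero_add] at hc
  have hcc : ContinuousAt c 0 := (hc 0 (by simp [hε])).continuousAt
  obtain ⟨δ, hδ, hball⟩ := Metric.mem_nhds_iff.1 (hcc (hO.mem_nhds (hc0 ▸ hz₀)))
  have hsub : ∀ t ∈ Ioo (-(min ε δ)) (min ε δ), c t ∈ O ∧ HasDerivAt c (X (c t)) t := by
    intro t ht
    rw [mem_Ioo, ← abs_lt, lt_min_iff] at ht
    exact ⟨hball (by simpa using ht.2), hc t (abs_lt.1 ht.1)⟩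
  refine ⟨c, min ε δ, lt_min hε hδ, hc0, contDiffOn_infty.2 fun n ↦ ?_, hsub⟩
  induction n with
  | zero =>
    exact contDiffOn_zero.2 fun t ht ↦ (hsub t ht).2.continuousAt.continuousWithinAt
  | succ n ih =>
    have : ContDiffOn ℝ ((n : WithTop ℕ∞) + 1) c (Ioo (-(min ε δ)) (min ε δ)) := by
      rw [contDiffOn_succ_iff_deriv_of_isOpen isOpen_Ioo]
      refine ⟨fun t ht ↦ (hsub t ht).2.differentiableAt.differentiableWithinAt, by simp, ?_⟩
      have h1 : ContDiffOn ℝ n (X ∘ c) (Ioo (-(min ε δ)) (min ε δ)) :=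
        (hX.of_le (by exact_mod_cast le_top)).comp ih fun t ht ↦ (hsub t ht).1
      exact h1.congr fun t ht ↦ (hsub t ht).2.deriv
    exact_mod_cast this

end SmoothKernel

/-- The exterior derivative commutes with pullbacks. -/
lemma fderiv_pullback_sub {E G : Type*} [NormedAddCommGroup E] [NormedSpace ℝ E]
    [NormedAddCommGroup G] [NormedSpace ℝ G] {a : G → G →L[ℝ] ℝ} {h : E → G} {z : E}
    (ha : DifferentiableAt ℝ a (h z)) (hh : ContDiffAt ℝ ∞ h z) (v w : E) :
    fderiv ℝ (fun y ↦ (a (h y)).comp (fderiv ℝ h y)) z v w -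
      fderiv ℝ (fun y ↦ (a (h y)).comp (fderiv ℝ h y)) z w v =
    fderiv ℝ a (h z) (fderiv ℝ h z v) (fderiv ℝ h z w) -
      fderiv ℝ a (h z) (fderiv ℝ h z w) (fderiv ℝ h z v) := by
  have hd : DifferentiableAt ℝ h z := hh.differentiableAt (by simp)
  have hd2 : DifferentiableAt ℝ (fderiv ℝ h) z :=
    (hh.fderiv_right (m := 1) (by norm_cast)).differentiableAt (by simp)
  have hah : HasFDerivAt (fun y ↦ a (h y)) ((fderiv ℝ a (h z)).comp (fderiv ℝ h z)) z :=
    ha.hasFDerivAt.comp z hd.hasFDerivAt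
  have hF := hah.clm_comp hd2.hasFDerivAt
  rw [hF.fderiv]
  -- The terms in which `a` is applied to second derivatives of `h` cancel in the
  -- antisymmetrization.
  have hsym : IsSymmSndFDerivAt ℝ h z := hh.isSymmSndFDerivAt
    (by simpa using two_le_infty)
  simp [hsym.eq v w]

end Calculus

/-! ### Vector fields and hyperplane fields in charts. -/

section Charts

variable {E : Type*} [NormedAddCommGroup E] [NormedSpace ℝ E]
  {M : Type*} [TopologicalSpace M] [ChartedSpace E M]

/-- The coordinate expression of tangent vectors at `x` in the chart `e`. -/
abbrev chartDeriv (e : OpenPartialHomeomorph M E) (x : M) : TangentSpace 𝓘(ℝ, E) x →L[ℝ] E :=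
  mfderiv 𝓘(ℝ, E) 𝓘(ℝ, E) e x

variable {e : OpenPartialHomeomorph M E}

lemma mdifferentiable_chart (he : e ∈ IsManifold.maximalAtlas 𝓘(ℝ, E) ∞ M) :
    e.MDifferentiable 𝓘(ℝ, E) 𝓘(ℝ, E) :=
  ⟨(contMDiffOn_of_mem_maximalAtlas he).mdifferentiableOn (by simp),
    (contMDiffOn_symm_of_mem_maximalAtlas he).mdifferentiableOn (by simp)⟩

variable [IsManifold 𝓘(ℝ, E) ∞ M]

lemma chartDeriv_injective (he : e ∈ IsManifold.maximalAtlas 𝓘(ℝ, E) ∞ M) {x : M}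
    (hx : x ∈ e.source) : Function.Injective (chartDeriv e x) :=
  (mdifferentiable_chart he).mfderiv_injective hx

lemma chartDeriv_surjective (he : e ∈ IsManifold.maximalAtlas 𝓘(ℝ, E) ∞ M) {x : M}
    (hx : x ∈ e.source) : Function.Surjective (chartDeriv e x) :=
  (mdifferentiable_chart he).mfderiv_surjective hx

lemma isInvertible_chartDeriv (he : e ∈ IsManifold.maximalAtlas 𝓘(ℝ, E) ∞ M) {x : M}
    (hx : x ∈ e.source) : (mfderiv 𝓘(ℝ, E) 𝓘(ℝ, E) e x).IsInvertible :=
  ⟨(mdifferentiable_chart he).mfderiv hx, rfl⟩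

lemma isInvertible_mfderiv_symm (he : e ∈ IsManifold.maximalAtlas 𝓘(ℝ, E) ∞ M) {z : E}
    (hz : z ∈ e.target) : (mfderiv 𝓘(ℝ, E) 𝓘(ℝ, E) e.symm z).IsInvertible :=
  ⟨(mdifferentiable_chart he).symm.mfderiv hz, rfl⟩

lemma chartDeriv_mpullback (he : e ∈ IsManifold.maximalAtlas 𝓘(ℝ, E) ∞ M) (X : E → E) {x : M}
    (hx : x ∈ e.source) :
    chartDeriv e x (mpullback 𝓘(ℝ, E) 𝓘(ℝ, E) e X x) = X (e x) :=
  (isInvertible_chartDeriv he hx).self_apply_inverse _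

lemma mpullback_symm (he : e ∈ IsManifold.maximalAtlas 𝓘(ℝ, E) ∞ M)
    (V : ∀ x : M, TangentSpace 𝓘(ℝ, E) x) {z : E} (hz : z ∈ e.target) :
    mpullback 𝓘(ℝ, E) 𝓘(ℝ, E) e.symm V z = chartDeriv e (e.symm z) (V (e.symm z)) := by
  have h := (mdifferentiable_chart he).comp_symm_deriv hz
  have h2 := (isInvertible_mfderiv_symm he hz).self_apply_inverse (V (e.symm z))
  have h3 := DFunLike.congr_fun h ((mfderiv 𝓘(ℝ, E) 𝓘(ℝ, E) e.symm z).inverse (V (e.symm z)))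
  rw [mpullback_apply]
  refine h3.symm.trans ?_
  exact congrArg (chartDeriv e (e.symm z)) h2

variable [CompleteSpace E]

lemma contDiffAt_coord (he : e ∈ IsManifold.maximalAtlas 𝓘(ℝ, E) ∞ M)
    {V : ∀ x : M, TangentSpace 𝓘(ℝ, E) x} {z : E} (hz : z ∈ e.target)
    (hV : ContMDiffAt 𝓘(ℝ, E) 𝓘(ℝ, E).tangent ∞
      (fun y ↦ (⟨y, V y⟩ : TangentBundle 𝓘(ℝ, E) M)) (e.symm z)) :
    ContDiffAt ℝ ∞ (fun z ↦ chartDeriv e (e.symm z) (V (e.symm z))) z := by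
  have h1 := hV.mpullback_vectorField_preimage (n := ∞)
    (contMDiffAt_symm_of_mem_maximalAtlas he hz) (isInvertible_mfderiv_symm he hz) (by simp)
  rw [contMDiffAt_vectorSpace_iff_contDiffAt] at h1
  refine h1.congr_of_eventuallyEq ?_
  filter_upwards [e.open_target.mem_nhds hz] with y hy
  exact (mpullback_symm he V hy).symm

lemma contMDiffAt_mpullback_chart (he : e ∈ IsManifold.maximalAtlas 𝓘(ℝ, E) ∞ M) {X : E → E}
    {x : M} (hx : x ∈ e.source) (hX : ContDiffAt ℝ ∞ X (e x)) :
    ContMDiffAt 𝓘(ℝ, E) 𝓘(ℝ, E).tangent ∞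
      (fun y ↦ (⟨y, mpullback 𝓘(ℝ, E) 𝓘(ℝ, E) e X y⟩ : TangentBundle 𝓘(ℝ, E) M)) x := by
  have h : ContMDiffAt 𝓘(ℝ, E) 𝓘(ℝ, E).tangent ∞
      (fun y ↦ (⟨y, X y⟩ : TangentBundle 𝓘(ℝ, E) E)) (e x) :=
    contMDiffAt_vectorSpace_iff_contDiffAt.2 hX
  exact h.mpullback_vectorField_preimage (n := ∞) (contMDiffAt_of_mem_maximalAtlas he hx)
    (isInvertible_chartDeriv he hx) (by simp)

/-- A nowhere vanishing 1-form on the open set `O` of the chart `e` that defines `C`. -/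
structure IsCoordForm (C : ∀ x : M, Submodule ℝ (TangentSpace 𝓘(ℝ, E) x))
    (e : OpenPartialHomeomorph M E) (O : Set E) (a : E → E →L[ℝ] ℝ) : Prop where
  isOpen : IsOpen O
  subset : O ⊆ e.target
  smooth : ContDiffOn ℝ ∞ a O
  ne_zero : ∀ z ∈ O, a z ≠ 0
  mem_iff : ∀ x ∈ e.source, e x ∈ O → ∀ u, u ∈ C x ↔ a (e x) (chartDeriv e x u) = 0

lemma IsHyperplaneField.exists_coordForm [FiniteDimensional ℝ E]
    {C : ∀ x : M, Submodule ℝ (TangentSpace 𝓘(ℝ, E) x)}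
    (hC : IsHyperplaneField C) (he : e ∈ IsManifold.maximalAtlas 𝓘(ℝ, E) ∞ M) {x : M}
    (hx : x ∈ e.source) : ∃ O a, e x ∈ O ∧ IsCoordForm C e O a := by
  obtain ⟨W, hWo, hxW, α, hα, hαC⟩ := hC x
  have key : ∀ y ∈ e.source, (mfderiv 𝓘(ℝ, E) 𝓘(ℝ, E) e y).inverse.comp (chartDeriv e y) =
      ContinuousLinearMap.id ℝ _ := fun y hy ↦
    ContinuousLinearMap.ext fun v ↦ (isInvertible_chartDeriv he hy).inverse_apply_self v
  let a : E → E →L[ℝ] ℝ := fun z ↦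
    (α (e.symm z)).comp (mfderiv 𝓘(ℝ, E) 𝓘(ℝ, E) e (e.symm z)).inverse
  have ha : ∀ y ∈ e.source, ∀ u, a (e y) (chartDeriv e y u) = α y u := by
    intro y hy u
    have hy' := e.left_inv hy
    change α (e.symm (e y)) ((mfderiv 𝓘(ℝ, E) 𝓘(ℝ, E) e (e.symm (e y))).inverse
      (chartDeriv e y u)) = α y u
    rw [hy']
    exact congrArg (α y) (DFunLike.congr_fun (key y hy) u)
  refine ⟨e.target ∩ e.symm ⁻¹' W, a, ⟨e.map_source hx, ?_⟩,
    e.isOpen_inter_preimage_symm hWo, inter_subset_left, ?_, ?_, ?_⟩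
  · rwa [mem_preimage, e.left_inv hx]
  · rw [contDiffOn_clm_apply]
    intro v z hz
    refine ContDiffAt.contDiffWithinAt ?_
    -- In finite dimension smoothness of `a` can be tested on constant vectors `v`; the value `a z
    -- v` is the pairing of `α` with the field that is constant `v` in the chart.
    have h1 : ContMDiffAt 𝓘(ℝ, E) 𝓘(ℝ, E).tangent ∞ (fun y ↦ (⟨y, mpullback 𝓘(ℝ, E) 𝓘(ℝ, E) e
        (fun _ : E ↦ (v : E)) y⟩ : TangentBundle 𝓘(ℝ, E) M)) (e.symm z) :=
      contMDiffAt_mpullback_chart he (e.map_target hz.1) contDiffAt_const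
    have h2 := (hα.contMDiffAt (hWo.mem_nhds hz.2)).clm_bundle_apply h1
    rw [Bundle.contMDiffAt_section] at h2
    have h3 := h2.comp z (contMDiffAt_symm_of_mem_maximalAtlas he hz.1)
    exact h3.contDiffAt
  · rintro z ⟨hz, hzW⟩ h0
    apply (hαC _ hzW).1
    ext u
    rw [← ha _ (e.map_target hz), e.right_inv hz, h0]
    rfl
  · rintro y hy ⟨-, hyW⟩ u
    rw [mem_preimage, e.left_inv hy] at hyW
    rw [ha y hy, (hαC y hyW).2]
    rfl

lemma isHyperplaneField_of_coordForm [FiniteDimensional ℝ E]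
    {C : ∀ x : M, Submodule ℝ (TangentSpace 𝓘(ℝ, E) x)}
    (h : ∀ x : M, ∃ e ∈ IsManifold.maximalAtlas 𝓘(ℝ, E) ∞ M, ∃ O a, x ∈ e.source ∧ e x ∈ O ∧
      IsCoordForm C e O a) : IsHyperplaneField C := by
  intro x
  obtain ⟨e, he, O, a, hx, hxO, ha⟩ := h x
  have hWo : IsOpen (e.source ∩ e ⁻¹' O) := e.isOpen_inter_preimage ha.isOpen
  refine ⟨e.source ∩ e ⁻¹' O, hWo, ⟨hx, hxO⟩, fun y ↦ (a (e y)).comp (chartDeriv e y), ?_, ?_⟩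
  · intro y hy
    refine ContMDiffAt.contMDiffWithinAt ?_
    rw [contMDiffAt_hom_bundle]
    refine ⟨contMDiffAt_id, ?_⟩
    have h1 := (contMDiffAt_of_mem_maximalAtlas he hy.1).mfderiv_const (m := ∞) (by simp)
    have h2 : ContMDiffAt 𝓘(ℝ, E) 𝓘(ℝ, E →L[ℝ] ℝ) ∞ (fun y ↦ a (e y)) y :=
      (ha.smooth.contDiffAt (ha.isOpen.mem_nhds hy.2)).contMDiffAt.comp y
        (contMDiffAt_of_mem_maximalAtlas he hy.1)
    refine (h2.clm_comp h1).congr_of_eventuallyEq (Filter.Eventually.of_forall fun z ↦ ?_)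
    ext v
    simp [ContinuousLinearMap.inCoordinates, inTangentCoordinates]
    rfl
  · rintro y ⟨hy, hyO⟩
    constructor
    · intro h0
      apply ha.ne_zero _ hyO
      ext v
      obtain ⟨u, rfl⟩ := chartDeriv_surjective he hy v
      exact DFunLike.congr_fun h0 u
    · ext u
      exact ha.mem_iff y hy hyO u

end Charts

/-! ### Characteristic directions as the kernel of `da` on `ker a`. -/

section CharSpace

/-- `v` lies in the kernel of the restriction of `da` to `ker a`, at `z`. -/
def IsCharVec {E : Type*} [NormedAddCommGroup E] [NormedSpace ℝ E] (a : E → E →L[ℝ] ℝ)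
    (z v : E) : Prop :=
  a z v = 0 ∧ ∀ w, a z w = 0 → fderiv ℝ a z v w = fderiv ℝ a z w v

variable {E : Type*} [NormedAddCommGroup E] [NormedSpace ℝ E]
  {M : Type*} [TopologicalSpace M] [ChartedSpace E M] [IsManifold 𝓘(ℝ, E) ∞ M]
  {C : ∀ x : M, Submodule ℝ (TangentSpace 𝓘(ℝ, E) x)}
  {e : OpenPartialHomeomorph M E} {O : Set E} {a : E → E →L[ℝ] ℝ}

lemma IsCoordForm.differentiableAt (ha : IsCoordForm C e O a) {z : E} (hz : z ∈ O) :
    DifferentiableAt ℝ a z :=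
  (ha.smooth.contDiffAt (ha.isOpen.mem_nhds hz)).differentiableAt (by simp)

lemma IsCoordForm.mono (ha : IsCoordForm C e O a) {O' : Set E} (hO' : IsOpen O') (h : O' ⊆ O) :
    IsCoordForm C e O' a :=
  ⟨hO', h.trans ha.subset, ha.smooth.mono h, fun z hz ↦ ha.ne_zero z (h hz),
    fun x hx hxO ↦ ha.mem_iff x hx (h hxO)⟩

lemma exists_apply_ne_zero {f : E →L[ℝ] ℝ} (h : f ≠ 0) : ∃ R, f R ≠ 0 := by
  by_contra! hc
  exact h (ContinuousLinearMap.ext hc)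

variable [CompleteSpace E]

/-- Extend `u` as a constant vector of the chart and project it to `ker (a z)` along a vector `R`
transversal to the hyperplane; at `x` itself the correction vanishes. -/
lemma IsCoordForm.exists_section (ha : IsCoordForm C e O a)
    (he : e ∈ IsManifold.maximalAtlas 𝓘(ℝ, E) ∞ M) {x : M} (hx : x ∈ e.source) (hxO : e x ∈ O)
    {u : TangentSpace 𝓘(ℝ, E) x} (hu : u ∈ C x) :
    ∃ V : ∀ y : M, TangentSpace 𝓘(ℝ, E) y, IsSectionNear C V x ∧ V x = u := by
  obtain ⟨R, hR⟩ := exists_apply_ne_zero (ha.ne_zero _ hxO)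
  set v : E := chartDeriv e x u with hv
  have hav : a (e x) v = 0 := (ha.mem_iff x hx hxO u).1 hu
  let X : E → E := fun z ↦ v - (a z v / a z R) • R
  have haR : ∀ w, ContDiffOn ℝ ∞ (fun z ↦ a z w) O := fun w ↦
    ha.smooth.clm_apply contDiffOn_const
  have hO₁ : IsOpen (O ∩ (fun z ↦ a z R) ⁻¹' {0}ᶜ) :=
    (haR R).continuousOn.isOpen_inter_preimage ha.isOpen isOpen_compl_singleton
  set O₁ := O ∩ (fun z ↦ a z R) ⁻¹' {0}ᶜ with hO₁d
  have hX : ContDiffOn ℝ ∞ X O₁ := contDiffOn_const.sub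
    ((((haR v).mono inter_subset_left).div ((haR R).mono inter_subset_left)
      fun z hz ↦ hz.2).smul contDiffOn_const)
  have hVx : ∀ y ∈ e.source, chartDeriv e y (mpullback 𝓘(ℝ, E) 𝓘(ℝ, E) e X y) = X (e y) :=
    fun y hy ↦ chartDeriv_mpullback he X hy
  refine ⟨mpullback 𝓘(ℝ, E) 𝓘(ℝ, E) e X, ⟨e.source ∩ e ⁻¹' O₁, e.isOpen_inter_preimage hO₁,
    ⟨hx, hxO, hR⟩, ?_, ?_⟩, ?_⟩
  · intro y hy
    exact (contMDiffAt_mpullback_chart he hy.1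
      (hX.contDiffAt (hO₁.mem_nhds hy.2))).contMDiffWithinAt
  · rintro y ⟨hy, hyO, hyR⟩
    rw [ha.mem_iff y hy hyO, hVx y hy]
    have : a (e y) R ≠ 0 := hyR
    simp [X, this]
  · apply chartDeriv_injective he hx
    rw [hVx x hx]
    simp only [X]
    rw [hav, zero_div, zero_smul, sub_zero]

lemma mlieBracket_vectorSpace (X Y : ∀ z : E, TangentSpace 𝓘(ℝ, E) z) (z : E) :
    mlieBracket 𝓘(ℝ, E) X Y z = lieBracket ℝ X Y z := by
  rw [← mlieBracketWithin_univ, mlieBracketWithin_eq_lieBracketWithin]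
  exact congrFun (lieBracketWithin_univ (𝕜 := ℝ) (V := (X : E → E)) (W := (Y : E → E))) z

/-- Cartan's formula: differentiating `a(V) = 0` and `a(W) = 0` gives `a([V, W]) = -da(V, W)`, an
expression in the values of `V` and `W` at the point only. -/
lemma IsCoordForm.mlieBracket_mem_iff (ha : IsCoordForm C e O a)
    (he : e ∈ IsManifold.maximalAtlas 𝓘(ℝ, E) ∞ M) {x : M} (hx : x ∈ e.source) (hxO : e x ∈ O)
    {V W : ∀ y : M, TangentSpace 𝓘(ℝ, E) y} (hV : IsSectionNear C V x)
    (hW : IsSectionNear C W x) :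
    mlieBracket 𝓘(ℝ, E) V W x ∈ C x ↔
      fderiv ℝ a (e x) (chartDeriv e x (V x)) (chartDeriv e x (W x)) =
        fderiv ℝ a (e x) (chartDeriv e x (W x)) (chartDeriv e x (V x)) := by
  obtain ⟨z, hz, rfl⟩ : ∃ z ∈ e.target, e.symm z = x := ⟨e x, e.map_source hx, e.left_inv hx⟩
  have hez := e.right_inv hz
  have hcoord : ∀ {V : ∀ y : M, TangentSpace 𝓘(ℝ, E) y}, IsSectionNear C V (e.symm z) →
      ContDiffAt ℝ ∞ (fun z ↦ chartDeriv e (e.symm z) (V (e.symm z))) z ∧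
      ∀ᶠ y in 𝓝 z, a y (chartDeriv e (e.symm y) (V (e.symm y))) = 0 := by
    rintro V ⟨S, hSo, hxS, hVs, hVC⟩
    refine ⟨contDiffAt_coord he hz (hVs.contMDiffAt (hSo.mem_nhds hxS)), ?_⟩
    have h1 : e.symm ⁻¹' S ∈ 𝓝 z := (e.continuousAt_symm hz) (hSo.mem_nhds hxS)
    filter_upwards [h1, e.open_target.mem_nhds hz, ha.isOpen.mem_nhds (hez ▸ hxO)]
      with y hyS hyt hyO
    have := (ha.mem_iff (e.symm y) (e.map_target hyt) ((e.right_inv hyt).symm ▸ hyO) _).1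
      (hVC _ hyS)
    rwa [e.right_inv hyt] at this
  obtain ⟨hVs, hV0⟩ := hcoord hV
  obtain ⟨hWs, hW0⟩ := hcoord hW
  have hDa := (ha.differentiableAt (hez ▸ hxO : z ∈ O)).hasFDerivAt
  have hder : ∀ {X : E → E}, ContDiffAt ℝ ∞ X z → (∀ᶠ y in 𝓝 z, a y (X y) = 0) → ∀ u,
      a z (fderiv ℝ X z u) + fderiv ℝ a z u (X z) = 0 := by
    intro X hX h0 u
    have h1 := hDa.clm_apply (hX.differentiableAt (by simp)).hasFDerivAt
    have h2 : HasFDerivAt (fun y ↦ a y (X y)) (0 : E →L[ℝ] ℝ) z :=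
      (hasFDerivAt_const (0 : ℝ) z).congr_of_eventuallyEq h0
    simpa using DFunLike.congr_fun (h1.unique h2) u
  have : IsManifold 𝓘(ℝ, E) (minSmoothness ℝ 2) M :=
    .of_le (n := ∞) (by simpa using two_le_infty)
  have hbr := mpullback_mlieBracket (n := ∞) hV.mdifferentiableAt hW.mdifferentiableAt
    (contMDiffAt_symm_of_mem_maximalAtlas he hz) (by simpa using two_le_infty)
  rw [mpullback_symm he _ hz] at hbr
  have hev : ∀ V : ∀ y : M, TangentSpace 𝓘(ℝ, E) y, mpullback 𝓘(ℝ, E) 𝓘(ℝ, E) e.symm V =ᶠ[𝓝 z]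
      fun z ↦ chartDeriv e (e.symm z) (V (e.symm z)) := fun V ↦ by
    filter_upwards [e.open_target.mem_nhds hz] with y hy using mpullback_symm he V hy
  rw [Filter.EventuallyEq.mlieBracket_vectorField_eq (hev V) (hev W)] at hbr
  replace hbr := hbr.trans (mlieBracket_vectorSpace _ _ z)
  rw [ha.mem_iff _ hx hxO, hbr, hez, lieBracket_eq]
  have h1 := hder hVs hV0 (chartDeriv e (e.symm z) (W (e.symm z)))
  have h2 := hder hWs hW0 (chartDeriv e (e.symm z) (V (e.symm z)))
  rw [map_sub]
  constructor <;> intro h <;> linarith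

/-- Every vector of `C x` is the value of a local section, and the bracket modulo `C` depends only
on values; so sections may be replaced by vectors on both sides. -/
lemma IsCoordForm.mem_charSpace_iff [FiniteDimensional ℝ E] (ha : IsCoordForm C e O a)
    (he : e ∈ IsManifold.maximalAtlas 𝓘(ℝ, E) ∞ M) {x : M} (hx : x ∈ e.source) (hxO : e x ∈ O)
    (u : TangentSpace 𝓘(ℝ, E) x) :
    u ∈ charSpace C x ↔ IsCharVec a (e x) (chartDeriv e x u) := by
  constructor
  · rintro ⟨V, hV, rfl, h⟩
    refine ⟨?_, fun w hw ↦ ?_⟩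
    · obtain ⟨S, hSo, hxS, hVs, hVC⟩ := hV
      exact (ha.mem_iff x hx hxO _).1 (hVC x hxS)
    · obtain ⟨w, rfl⟩ := chartDeriv_surjective he hx w
      obtain ⟨W, hW, rfl⟩ := ha.exists_section he hx hxO ((ha.mem_iff x hx hxO _).2 hw)
      exact (ha.mlieBracket_mem_iff he hx hxO hV hW).1 (h W hW)
  · rintro ⟨h0, h⟩
    obtain ⟨V, hV, rfl⟩ := ha.exists_section he hx hxO ((ha.mem_iff x hx hxO _).2 h0)
    refine ⟨V, hV, rfl, fun W hW ↦ (ha.mlieBracket_mem_iff he hx hxO hV hW).2 (h _ ?_)⟩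
    obtain ⟨S, hSo, hxS, hWs, hWC⟩ := hW
    exact (ha.mem_iff x hx hxO _).1 (hWC x hxS)

end CharSpace

/-! ### Curves in charts and existence of characteristic curves. -/

section Curves

variable {E : Type*} [NormedAddCommGroup E] [NormedSpace ℝ E]
  {M : Type*} [TopologicalSpace M] [ChartedSpace E M] [IsManifold 𝓘(ℝ, E) ∞ M]
  {C : ∀ x : M, Submodule ℝ (TangentSpace 𝓘(ℝ, E) x)}
  {e : OpenPartialHomeomorph M E} {O : Set E} {a : E → E →L[ℝ] ℝ}

lemma contDiffAt_chart_comp_curve (he : e ∈ IsManifold.maximalAtlas 𝓘(ℝ, E) ∞ M) {γ : ℝ → M}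
    {t : ℝ} (hγ : ContMDiffAt 𝓘(ℝ, ℝ) 𝓘(ℝ, E) ∞ γ t) (ht : γ t ∈ e.source) :
    ContDiffAt ℝ ∞ (e ∘ γ) t :=
  ((contMDiffAt_of_mem_maximalAtlas he ht).comp t hγ).contDiffAt

lemma hasDerivAt_chart_comp_curve (he : e ∈ IsManifold.maximalAtlas 𝓘(ℝ, E) ∞ M) {γ : ℝ → M}
    {t : ℝ} (hγ : ContMDiffAt 𝓘(ℝ, ℝ) 𝓘(ℝ, E) ∞ γ t) (ht : γ t ∈ e.source) :
    HasDerivAt (e ∘ γ) (chartDeriv e (γ t) (mfderiv 𝓘(ℝ, ℝ) 𝓘(ℝ, E) γ t (1 : ℝ))) t := by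
  have h1 := ((contMDiffAt_of_mem_maximalAtlas he ht).mdifferentiableAt (by simp)).hasMFDerivAt.comp
    t (hγ.mdifferentiableAt (by simp)).hasMFDerivAt
  have h2 : HasFDerivAt (𝕜 := ℝ) (E := ℝ) (F := E) (e ∘ γ)
      ((chartDeriv e (γ t)).comp (mfderiv 𝓘(ℝ, ℝ) 𝓘(ℝ, E) γ t)) t :=
    hasMFDerivAt_iff_hasFDerivAt.1 h1
  exact h2.hasDerivAt

lemma IsCurveIn.contMDiffAt {U : Set M} {γ : ℝ → M} {J : Set ℝ} (h : IsCurveIn (E := E) U γ J)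
    {t : ℝ} (ht : t ∈ J) : ContMDiffAt 𝓘(ℝ, ℝ) 𝓘(ℝ, E) ∞ γ t :=
  h.2.2.1.contMDiffAt (h.1.mem_nhds ht)

lemma IsCurveIn.isPreconnected {U : Set M} {γ : ℝ → M} {J : Set ℝ}
    (h : IsCurveIn (E := E) U γ J) : IsPreconnected J :=
  h.2.1.isPreconnected

lemma isCurveIn_symm_comp (he : e ∈ IsManifold.maximalAtlas 𝓘(ℝ, E) ∞ M) {U : Set M}
    {c : ℝ → E} {J : Set ℝ} (hJ : IsOpen J) (hJ' : J.OrdConnected) (hc : ContDiffOn ℝ ∞ c J)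
    (hct : ∀ t ∈ J, c t ∈ e.target ∧ e.symm (c t) ∈ U) :
    IsCurveIn (E := E) U (fun t ↦ e.symm (c t)) J ∧ ∀ t ∈ J,
      chartDeriv e (e.symm (c t)) (mfderiv 𝓘(ℝ, ℝ) 𝓘(ℝ, E) (fun t ↦ e.symm (c t)) t (1 : ℝ)) =
        deriv c t := by
  have h1 : IsCurveIn (E := E) U (fun t ↦ e.symm (c t)) J :=
    ⟨hJ, hJ', (contMDiffOn_symm_of_mem_maximalAtlas he).comp hc.contMDiffOn
      fun t ht ↦ (hct t ht).1, fun t ht ↦ (hct t ht).2⟩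
  refine ⟨h1, fun t ht ↦ ?_⟩
  rw [← (hasDerivAt_chart_comp_curve he (h1.contMDiffAt ht) (e.map_target (hct t ht).1)).deriv]
  refine Filter.EventuallyEq.deriv_eq ?_
  filter_upwards [hJ.mem_nhds ht] with s hs
  exact e.right_inv (hct s hs).1

variable [FiniteDimensional ℝ E]

instance : CompleteSpace E := FiniteDimensional.complete ℝ E

lemma IsCoordForm.isCharacteristic_symm_comp (ha : IsCoordForm C e O a)
    (he : e ∈ IsManifold.maximalAtlas 𝓘(ℝ, E) ∞ M) {U : Set M}
    {c : ℝ → E} {J : Set ℝ} (hJ : IsOpen J) (hJ' : J.OrdConnected) (hc : ContDiffOn ℝ ∞ c J)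
    (hct : ∀ t ∈ J, c t ∈ O ∧ e.symm (c t) ∈ U) (hK : ∀ t ∈ J, IsCharVec a (c t) (deriv c t)) :
    IsCurveIn (E := E) U (fun t ↦ e.symm (c t)) J ∧
      IsCharacteristic C (fun t ↦ e.symm (c t)) J := by
  obtain ⟨h1, h2⟩ := isCurveIn_symm_comp he hJ hJ' hc
    fun t ht ↦ ⟨ha.subset (hct t ht).1, (hct t ht).2⟩
  refine ⟨h1, fun t ht ↦ ?_⟩
  have hr := e.right_inv (ha.subset (hct t ht).1)
  rw [ha.mem_charSpace_iff he (e.map_target (ha.subset (hct t ht).1)) (hr.symm ▸ (hct t ht).1),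
    hr, h2 t ht]
  exact hK t ht

lemma finrank_eq_of_mem_iff {V W : Type*} [AddCommGroup V] [Module ℝ V] [AddCommGroup W]
    [Module ℝ W] (f : V →ₗ[ℝ] W) (hf : Function.Bijective f) {S : Submodule ℝ V}
    {T : Submodule ℝ W} (h : ∀ u, u ∈ S ↔ f u ∈ T) :
    Module.finrank ℝ S = Module.finrank ℝ T := by
  have : S = T.comap (LinearEquiv.ofBijective f hf : V →ₗ[ℝ] W) := by
    ext u; exact h u
  rw [this]
  exact (LinearEquiv.ofSubmodule' (LinearEquiv.ofBijective f hf) T).finrank_eq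

/-- A family of linear maps whose kernels are the characteristic directions of `a`, where
`a z R ≠ 0`. -/
def charMap (a : E → E →L[ℝ] ℝ) (R z : E) : E →L[ℝ] ℝ × (E →L[ℝ] ℝ) :=
  (a z).prod (a z R • (fderiv ℝ a z - (fderiv ℝ a z).flip) -
    ((fderiv ℝ a z - (fderiv ℝ a z).flip).flip R).smulRight (a z))

/-- The second component of `charMap` is `w ↦ da(v, a z R • w - a z w • R)`. Its arguments run over
`ker (a z)` as `w` varies freely, so that a condition on a varying hyperplane becomes the vanishing
of one smooth family of linear maps. -/
lemma charMap_eq_zero_iff {R z : E} (hR : a z R ≠ 0) (v : E) :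
    charMap a R z v = 0 ↔ IsCharVec a z v := by
  have h1 : charMap a R z v = 0 ↔ a z v = 0 ∧ ∀ w, a z R * (fderiv ℝ a z v w - fderiv ℝ a z w v) -
      (fderiv ℝ a z v R - fderiv ℝ a z R v) * a z w = 0 := by
    rw [Prod.ext_iff, ContinuousLinearMap.ext_iff]
    simp [charMap]
  rw [h1, IsCharVec]
  refine and_congr_right fun hv ↦ ⟨fun h w hw ↦ ?_, fun h w ↦ ?_⟩
  · have := h w
    rw [hw, mul_zero, sub_zero, mul_eq_zero] at this
    linarith [this.resolve_left hR]
  · have := h (a z R • w - a z w • R) (by simp [mul_comm])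
    simp only [map_sub, map_smul, smul_eq_mul, sub_apply,
      smul_apply] at this
    linarith

lemma contDiffOn_charMap {R : E} (hO : IsOpen O) (ha : ContDiffOn ℝ ∞ a O) :
    ContDiffOn ℝ ∞ (charMap a R) O := by
  have hD : ContDiffOn ℝ ∞ (fderiv ℝ a) O := ha.fderiv_of_isOpen hO (by simp)
  have haw : ∀ w, ContDiffOn ℝ ∞ (fun z ↦ a z w) O := fun w ↦ ha.clm_apply contDiffOn_const
  have hDw : ∀ v w, ContDiffOn ℝ ∞ (fun z ↦ fderiv ℝ a z v w) O := fun v w ↦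
    (hD.clm_apply contDiffOn_const).clm_apply contDiffOn_const
  rw [contDiffOn_clm_apply]
  intro v
  refine (haw v).prodMk (contDiffOn_clm_apply.2 fun w ↦ ?_)
  have : ContDiffOn ℝ ∞ (fun z ↦ a z R * (fderiv ℝ a z v w - fderiv ℝ a z w v) -
      (fderiv ℝ a z v R - fderiv ℝ a z R v) * a z w) O :=
    ((haw R).mul ((hDw v w).sub (hDw w v))).sub (((hDw v R).sub (hDw R v)).mul (haw w))
  exact this.congr fun z _ ↦ by simp

/-- Every characteristic direction is the velocity of a characteristic curve. -/
lemma exists_characteristic (hC : IsHyperplaneField C) {k : ℕ}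
    (hk : ∀ x, Module.finrank ℝ (charSpace C x) = k) {U : Set M} (hU : IsOpen U) {x : M}
    (hx : x ∈ U) {u : TangentSpace 𝓘(ℝ, E) x} (hu : u ∈ charSpace C x) :
    ∃ (γ : ℝ → M) (J : Set ℝ), IsCurveIn (E := E) U γ J ∧ IsCharacteristic C γ J ∧ 0 ∈ J ∧
      (⟨γ 0, mfderiv 𝓘(ℝ, ℝ) 𝓘(ℝ, E) γ 0 (1 : ℝ)⟩ : TangentBundle 𝓘(ℝ, E) M) = ⟨x, u⟩ := by
  set e := chartAt E x
  have he : e ∈ IsManifold.maximalAtlas 𝓘(ℝ, E) ∞ M := IsManifold.chart_mem_maximalAtlas x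
  have hxe : x ∈ e.source := mem_chart_source E x
  obtain ⟨O, a, hxO, ha⟩ := hC.exists_coordForm he hxe
  obtain ⟨R, hR⟩ := exists_apply_ne_zero (ha.ne_zero _ hxO)
  have hO₁ : IsOpen ((O ∩ (fun z ↦ a z R) ⁻¹' {0}ᶜ) ∩ (e.target ∩ e.symm ⁻¹' U)) :=
    ((ha.smooth.clm_apply contDiffOn_const).continuousOn.isOpen_inter_preimage ha.isOpen
      isOpen_compl_singleton).inter (e.isOpen_inter_preimage_symm hU)
  set O₁ := (O ∩ (fun z ↦ a z R) ⁻¹' {0}ᶜ) ∩ (e.target ∩ e.symm ⁻¹' U)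
  have hrank : ∀ z ∈ O₁, Module.finrank ℝ (charMap a R z).ker = k := by
    rintro z ⟨⟨hzO, hzR⟩, hzt, hzU⟩
    rw [← hk (e.symm z)]
    refine (finrank_eq_of_mem_iff (chartDeriv e (e.symm z) : _ →ₗ[ℝ] E)
      ⟨chartDeriv_injective he (e.map_target hzt), chartDeriv_surjective he (e.map_target hzt)⟩
      fun v ↦ ?_).symm
    have hr := e.right_inv hzt
    rw [ha.mem_charSpace_iff he (e.map_target hzt) (hr.symm ▸ hzO), hr]
    exact (charMap_eq_zero_iff hzR _).symm
  have hxO₁ : e x ∈ O₁ := ⟨⟨hxO, hR⟩, e.map_source hxe, by rwa [mem_preimage, e.left_inv hxe]⟩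
  -- Constancy of `dim K` makes `u` extend to a smooth field of characteristic vectors, whose
  -- integral curve is the one sought.
  obtain ⟨O', X, hO', hO'O, hxO', hX, hX0, hXk⟩ := exists_smooth_ker_section hO₁
    (contDiffOn_charMap hO₁ (ha.smooth.mono fun z hz ↦ hz.1.1)) hrank hxO₁
    (u := chartDeriv e x u)
    ((charMap_eq_zero_iff hR _).2 ((ha.mem_charSpace_iff he hxe hxO u).1 hu))
  obtain ⟨c, ε, hε, hc0, hcs, hc⟩ := exists_smooth_integralCurve hO' hX hxO'
  have hcO : ∀ t ∈ Ioo (-ε) ε, c t ∈ O₁ := fun t ht ↦ hO'O (hc t ht).1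
  have h0 : (0 : ℝ) ∈ Ioo (-ε) ε := by simp [hε]
  have hct : ∀ t ∈ Ioo (-ε) ε, c t ∈ O ∧ e.symm (c t) ∈ U :=
    fun t ht ↦ ⟨(hcO t ht).1.1, (hcO t ht).2.2⟩
  obtain ⟨h1, h2⟩ := ha.isCharacteristic_symm_comp he isOpen_Ioo ordConnected_Ioo hcs
    hct (fun t ht ↦ by
      rw [(hc t ht).2.deriv]
      exact (charMap_eq_zero_iff (hcO t ht).1.2 _).1 (hXk _ (hc t ht).1))
  have hx0 : e.symm (c 0) = x := by rw [hc0, e.left_inv hxe]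
  have h3 := (isCurveIn_symm_comp he isOpen_Ioo ordConnected_Ioo hcs
    fun t ht ↦ ⟨ha.subset (hct t ht).1, (hct t ht).2⟩).2 0 h0
  have h5 : deriv c 0 = chartDeriv e x u := by rw [(hc 0 h0).2.deriv, hc0, hX0]
  have h4 : ∀ y (_ : y = x) (w : TangentSpace 𝓘(ℝ, E) y), chartDeriv e y w = chartDeriv e x u →
      (⟨y, w⟩ : TangentBundle 𝓘(ℝ, E) M) = ⟨x, u⟩ := by
    rintro _ rfl w hw
    rw [chartDeriv_injective he hxe hw]
  refine ⟨_, _, h1, h2, h0, h4 _ hx0 _ (h3.trans h5)⟩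

end Curves

/-! ### Lying on the same characteristic is an equivalence relation. -/

section Leaf

variable {E : Type*} [NormedAddCommGroup E] [NormedSpace ℝ E]
  {M : Type*} [TopologicalSpace M] [ChartedSpace E M] [IsManifold 𝓘(ℝ, E) ∞ M]
  [FiniteDimensional ℝ E]
  {C : ∀ x : M, Submodule ℝ (TangentSpace 𝓘(ℝ, E) x)}

lemma velocity_mem_congr {γ γ' : ℝ → M} {t : ℝ} (h : γ =ᶠ[𝓝 t] γ')
    (D : ∀ x : M, Submodule ℝ (TangentSpace 𝓘(ℝ, E) x)) :
    mfderiv 𝓘(ℝ, ℝ) 𝓘(ℝ, E) γ t (1 : ℝ) ∈ D (γ t) ↔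
      mfderiv 𝓘(ℝ, ℝ) 𝓘(ℝ, E) γ' t (1 : ℝ) ∈ D (γ' t) := by
  have key : ∀ y y' : M, y = y' → ∀ w w' : E, w = w' → (w ∈ D y ↔ w' ∈ D y') := by
    rintro y _ rfl w _ rfl
    exact Iff.rfl
  have h1 : (mfderiv 𝓘(ℝ, ℝ) 𝓘(ℝ, E) γ t : ℝ →L[ℝ] E) = mfderiv 𝓘(ℝ, ℝ) 𝓘(ℝ, E) γ' t :=
    h.mfderiv_eq
  exact key _ _ h.eq_of_nhds _ _ (DFunLike.congr_fun h1 1)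

lemma IsCurveIn.comp {U : Set M} {γ : ℝ → M} {J : Set ℝ} (h : IsCurveIn (E := E) U γ J)
    (hK : IsCharacteristic C γ J) {ρ : ℝ → ℝ} (hρ : ContDiff ℝ ∞ ρ) (hJ : ∀ t, ρ t ∈ J) :
    IsCurveIn (E := E) U (γ ∘ ρ) univ ∧ IsCharacteristic C (γ ∘ ρ) univ := by
  refine ⟨⟨isOpen_univ, ordConnected_univ, ?_, fun t _ ↦ h.2.2.2 _ (hJ t)⟩, fun t _ ↦ ?_⟩
  · exact h.2.2.1.comp hρ.contMDiff.contMDiffOn fun t _ ↦ hJ t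
  · have h1 := mfderiv_comp t ((h.contMDiffAt (hJ t)).mdifferentiableAt (by simp))
      (hρ.contMDiff.mdifferentiable (by simp) t)
    have h2 : mfderiv 𝓘(ℝ, ℝ) 𝓘(ℝ, E) (γ ∘ ρ) t (1 : ℝ) =
        (deriv ρ t) • mfderiv 𝓘(ℝ, ℝ) 𝓘(ℝ, E) γ (ρ t) (1 : ℝ) := by
      rw [h1]
      change mfderiv 𝓘(ℝ, ℝ) 𝓘(ℝ, E) γ (ρ t) (mfderiv 𝓘(ℝ, ℝ) 𝓘(ℝ, ℝ) ρ t (1 : ℝ)) = _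
      rw [mfderiv_eq_fderiv]
      have : fderiv ℝ ρ t (1 : ℝ) = deriv ρ t • (1 : ℝ) := by simp
      exact (congrArg (mfderiv 𝓘(ℝ, ℝ) 𝓘(ℝ, E) γ (ρ t)) this).trans (map_smul _ _ _)
    rw [h2]
    exact (charSpace C (γ (ρ t))).smul_mem _ (hK _ (hJ t))

lemma leaf_symm {U : Set M} {x y : M} (h : y ∈ leaf C U x) : x ∈ leaf C U y := by
  obtain ⟨γ, J, h1, h2, s, hs, t, ht, hx, hy⟩ := h
  exact ⟨γ, J, h1, h2, t, ht, s, hs, hy, hx⟩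

/-- A smooth reparametrization that is constant near infinity at both ends makes concatenations
smooth; multiplying velocities by a factor keeps them in `K`. -/
lemma exists_flat_curve {U : Set M} {x y : M} (h : y ∈ leaf C U x) :
    ∃ γ : ℝ → M, IsCurveIn (E := E) U γ univ ∧ IsCharacteristic C γ univ ∧
      (∀ t ≤ 0, γ t = x) ∧ ∀ t, 1 ≤ t → γ t = y := by
  obtain ⟨γ, J, h1, h2, s, hs, t, ht, rfl, rfl⟩ := h
  have hρ : ContDiff ℝ ∞ fun τ ↦ s + Real.smoothTransition τ * (t - s) :=
    contDiff_const.add (Real.smoothTransition.contDiff.mul contDiff_const)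
  have hJ : ∀ τ, s + Real.smoothTransition τ * (t - s) ∈ J := fun τ ↦ by
    have := h1.2.1.convex.add_smul_sub_mem hs ht
      ⟨Real.smoothTransition.nonneg τ, Real.smoothTransition.le_one τ⟩
    simpa using this
  obtain ⟨h3, h4⟩ := h1.comp h2 hρ hJ
  refine ⟨_, h3, h4, fun τ hτ ↦ ?_, fun τ hτ ↦ ?_⟩
  · simp [Real.smoothTransition.zero_of_nonpos hτ]
  · simp [Real.smoothTransition.one_of_one_le hτ]

lemma leaf_trans {U : Set M} {x y z : M} (hy : y ∈ leaf C U x) (hz : z ∈ leaf C U y) :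
    z ∈ leaf C U x := by
  obtain ⟨γ₁, h1, k1, s1, t1⟩ := exists_flat_curve hy
  obtain ⟨γ₀, h0, k0, s0, t0⟩ := exists_flat_curve hz
  obtain ⟨h2, k2⟩ := h0.comp k0 (ρ := fun t ↦ t - 2) (contDiff_id.sub contDiff_const)
    fun t ↦ mem_univ _
  set γ₂ := γ₀ ∘ fun t : ℝ ↦ t - 2
  have s2 : ∀ t ≤ 2, γ₂ t = y := fun t ht ↦ s0 _ (by linarith)
  have t2 : ∀ t, 3 ≤ t → γ₂ t = z := fun t ht ↦ t0 _ (by linarith)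
  -- After the shift by `2` both curves rest at `y` on `[1, 2]`, so switching at `3 / 2` leaves the
  -- result locally equal to one of them.
  let γ : ℝ → M := fun t ↦ if t < 3 / 2 then γ₁ t else γ₂ t
  have e1 : ∀ t < 2, γ t = γ₁ t := fun t ht ↦ by
    by_cases h : t < 3 / 2
    · simp [γ, h]
    · simp only [γ, h, if_false]
      rw [s2 t ht.le, t1 t (by linarith)]
  have e2 : ∀ t, 1 < t → γ t = γ₂ t := fun t ht ↦ by
    by_cases h : t < 3 / 2
    · simp only [γ, h, if_true]
      rw [s2 t (by linarith), t1 t ht.le]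
    · simp [γ, h]
  have hev : ∀ t, γ =ᶠ[𝓝 t] γ₁ ∨ γ =ᶠ[𝓝 t] γ₂ := fun t ↦ by
    rcases lt_or_ge t 2 with ht | ht
    · left
      filter_upwards [Iio_mem_nhds ht] with s hs using e1 s hs
    · right
      filter_upwards [Ioi_mem_nhds (show 1 < t by linarith)] with s hs using e2 s hs
  have hxU : ∀ t, γ₁ t ∈ U ∧ γ₂ t ∈ U := fun t ↦ ⟨h1.2.2.2 t trivial, h2.2.2.2 t trivial⟩
  refine ⟨γ, univ, ⟨isOpen_univ, ordConnected_univ, fun t _ ↦ ?_, fun t _ ↦ ?_⟩, fun t _ ↦ ?_,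
    0, trivial, 3, trivial, ?_, ?_⟩
  · refine ContMDiffAt.contMDiffWithinAt ?_
    rcases hev t with h | h
    · exact (h1.contMDiffAt (mem_univ t)).congr_of_eventuallyEq h
    · exact (h2.contMDiffAt (mem_univ t)).congr_of_eventuallyEq h
  · rcases hev t with h | h
    · rw [h.eq_of_nhds]; exact (hxU t).1
    · rw [h.eq_of_nhds]; exact (hxU t).2
  · rcases hev t with h | h
    · exact (velocity_mem_congr h (charSpace C)).2 (k1 t trivial)
    · exact (velocity_mem_congr h (charSpace C)).2 (k2 t trivial)
  · rw [e1 0 (by norm_num), s1 0 le_rfl]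
  · rw [e2 3 (by norm_num), t2 3 le_rfl]

end Leaf

/-! ### Smooth maps and submersions written in charts. -/

section Maps

variable {E : Type*} [NormedAddCommGroup E] [NormedSpace ℝ E]
  {M : Type*} [TopologicalSpace M] [ChartedSpace E M] [IsManifold 𝓘(ℝ, E) ∞ M]
  {F : Type*} [NormedAddCommGroup F] [NormedSpace ℝ F]
  {N : Type*} [TopologicalSpace N] [ChartedSpace F N] [IsManifold 𝓘(ℝ, F) ∞ N]
  {e : OpenPartialHomeomorph M E} {e' : OpenPartialHomeomorph N F} {f : N → M}

lemma contDiffAt_written_in_charts (he : e ∈ IsManifold.maximalAtlas 𝓘(ℝ, E) ∞ M)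
    (he' : e' ∈ IsManifold.maximalAtlas 𝓘(ℝ, F) ∞ N) {n : N} (hn : n ∈ e'.source)
    (hfn : f n ∈ e.source) (hf : ContMDiffAt 𝓘(ℝ, F) 𝓘(ℝ, E) ∞ f n) :
    ContDiffAt ℝ ∞ (e ∘ f ∘ e'.symm) (e' n) := by
  have h1 := contMDiffAt_symm_of_mem_maximalAtlas he' (e'.map_source hn)
  have hl := e'.left_inv hn
  have h2 : ContMDiffAt 𝓘(ℝ, F) 𝓘(ℝ, E) ∞ f (e'.symm (e' n)) := by rwa [hl]
  have h3 : ContMDiffAt 𝓘(ℝ, E) 𝓘(ℝ, E) ∞ e (f (e'.symm (e' n))) := by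
    rw [hl]; exact contMDiffAt_of_mem_maximalAtlas he hfn
  have h4 : ContMDiffAt 𝓘(ℝ, F) 𝓘(ℝ, E) ∞ (f ∘ e'.symm) (e' n) := h2.comp (e' n) h1
  exact (ContMDiffAt.comp (g := e) (f := f ∘ e'.symm) (e' n) h3 h4).contDiffAt

lemma fderiv_written_in_charts (he : e ∈ IsManifold.maximalAtlas 𝓘(ℝ, E) ∞ M)
    (he' : e' ∈ IsManifold.maximalAtlas 𝓘(ℝ, F) ∞ N) {n : N} (hn : n ∈ e'.source)
    (hfn : f n ∈ e.source) (hf : ContMDiffAt 𝓘(ℝ, F) 𝓘(ℝ, E) ∞ f n)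
    (v : TangentSpace 𝓘(ℝ, F) n) :
    fderiv ℝ (e ∘ f ∘ e'.symm) (e' n) (chartDeriv e' n v) =
      chartDeriv e (f n) (mfderiv 𝓘(ℝ, F) 𝓘(ℝ, E) f n v) := by
  have hd := (contDiffAt_written_in_charts he he' hn hfn hf).differentiableAt (by simp)
  have h1 : HasMFDerivAt 𝓘(ℝ, F) 𝓘(ℝ, E) ((e ∘ f ∘ e'.symm) ∘ e') n _ :=
    hd.hasFDerivAt.hasMFDerivAt.comp n
      ((mdifferentiable_chart he').mdifferentiableAt hn).hasMFDerivAt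
  have h2 : HasMFDerivAt 𝓘(ℝ, F) 𝓘(ℝ, E) (e ∘ f) n _ :=
    ((mdifferentiable_chart he).mdifferentiableAt hfn).hasMFDerivAt.comp n
      (hf.mdifferentiableAt (by simp)).hasMFDerivAt
  have h3 : (e ∘ f ∘ e'.symm) ∘ e' =ᶠ[𝓝 n] e ∘ f := by
    filter_upwards [e'.open_source.mem_nhds hn] with m hm
    simp [e'.left_inv hm]
  have h4 := h3.mfderiv_eq (I := 𝓘(ℝ, F)) (I' := 𝓘(ℝ, E))
  have h5 : (mfderiv 𝓘(ℝ, F) 𝓘(ℝ, E) ((e ∘ f ∘ e'.symm) ∘ e') n : F →L[ℝ] E) =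
    mfderiv 𝓘(ℝ, F) 𝓘(ℝ, E) (e ∘ f) n := h4
  rw [h1.mfderiv, h2.mfderiv] at h5
  exact DFunLike.congr_fun h5 v

/-- In suitable charts a submersion is a linear projection. -/
lemma IsSubmersionAt.exists_charts {π : M → N} {x : M}
    (h : IsSubmersionAt 𝓘(ℝ, E) 𝓘(ℝ, F) ∞ π x) :
    ∃ e ∈ IsManifold.maximalAtlas 𝓘(ℝ, E) ∞ M, ∃ e' ∈ IsManifold.maximalAtlas 𝓘(ℝ, F) ∞ N,
      ∃ (L : E →L[ℝ] F) (s : F →L[ℝ] E), x ∈ e.source ∧ (∀ w, L (s w) = w) ∧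
        ∀ y ∈ e.source, π y ∈ e'.source ∧ e' (π y) = L (e y) ∧
          ContMDiffAt 𝓘(ℝ, E) 𝓘(ℝ, F) ∞ π y ∧
          ∀ v, chartDeriv e' (π y) (mfderiv 𝓘(ℝ, E) 𝓘(ℝ, F) π y v) = L (chartDeriv e y v) := by
  have h1 : ∀ y ∈ h.domChart.source, h.codChart (π y) = (h.equiv (h.domChart y)).1 := by
    intro y hy
    have hz : h.domChart y ∈ (h.domChart.extend 𝓘(ℝ, E)).target := by
      simpa using h.domChart.map_source hy
    have := h.writtenInCharts hz
    simpa [h.domChart.left_inv hy] using this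
  refine ⟨h.domChart, h.domChart_mem_maximalAtlas, h.codChart, h.codChart_mem_maximalAtlas,
    (ContinuousLinearMap.fst ℝ F h.complement).comp (h.equiv : E →L[ℝ] F × h.complement),
    (h.equiv.symm : _ →L[ℝ] E).comp (ContinuousLinearMap.inl ℝ F h.complement),
    h.mem_domChart_source, by simp, fun y hy ↦ ?_⟩
  have hs := h.source_subset_preimage_source hy
  have hsm := h.contMDiffOn.contMDiffAt (h.domChart.open_source.mem_nhds hy)
  refine ⟨hs, h1 y hy, hsm, fun v ↦ ?_⟩
  rw [← fderiv_written_in_charts h.codChart_mem_maximalAtlas h.domChart_mem_maximalAtlas hy hs hsm]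
  have h2 : h.codChart ∘ π ∘ h.domChart.symm =ᶠ[𝓝 (h.domChart y)]
      (ContinuousLinearMap.fst ℝ F h.complement).comp (h.equiv : E →L[ℝ] F × h.complement) := by
    filter_upwards [h.domChart.open_target.mem_nhds (h.domChart.map_source hy)] with z hz
    have := h1 _ (h.domChart.map_target hz)
    rw [h.domChart.right_inv hz] at this
    exact this
  rw [h2.fderiv_eq, ContinuousLinearMap.fderiv]

end Maps

/-! ### The field cut by `C` along a map, and its characteristic directions. -/

section Cut

variable {E : Type*} [NormedAddCommGroup E] [NormedSpace ℝ E] [FiniteDimensional ℝ E]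
  {M : Type*} [TopologicalSpace M] [ChartedSpace E M] [IsManifold 𝓘(ℝ, E) ∞ M]
  {F : Type*} [NormedAddCommGroup F] [NormedSpace ℝ F] [FiniteDimensional ℝ F]
  {N : Type*} [TopologicalSpace N] [ChartedSpace F N] [IsManifold 𝓘(ℝ, F) ∞ N]
  {C : ∀ x : M, Submodule ℝ (TangentSpace 𝓘(ℝ, E) x)}
  {e : OpenPartialHomeomorph M E} {e' : OpenPartialHomeomorph N F} {f : N → M}
  {O : Set E} {a : E → E →L[ℝ] ℝ}

/-- The cut field is the kernel of the pulled back form, which vanishes nowhere because the cut is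
proper at every point. -/
lemma IsCoordForm.cut (ha : IsCoordForm C e O a)
    (he : e ∈ IsManifold.maximalAtlas 𝓘(ℝ, E) ∞ M)
    (he' : e' ∈ IsManifold.maximalAtlas 𝓘(ℝ, F) ∞ N) (hf : ContMDiff 𝓘(ℝ, F) 𝓘(ℝ, E) ∞ f)
    (hcut : ∀ n, cut (F := F) C f n ≠ ⊤) :
    IsCoordForm (cut (F := F) C f) e' (e'.target ∩ e'.symm ⁻¹' (f ⁻¹' (e.source ∩ e ⁻¹' O)))
      fun z ↦ (a ((e ∘ f ∘ e'.symm) z)).comp (fderiv ℝ (e ∘ f ∘ e'.symm) z) := by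
  have hmem : ∀ n ∈ e'.source, f n ∈ e.source → e (f n) ∈ O → ∀ u, u ∈ ContactRed.cut (F := F) C f n ↔
      (a ((e ∘ f ∘ e'.symm) (e' n))).comp (fderiv ℝ (e ∘ f ∘ e'.symm) (e' n))
        (chartDeriv e' n u) = 0 := by
    intro n hn hfn hfO u
    rw [ContinuousLinearMap.comp_apply, fderiv_written_in_charts he he' hn hfn hf.contMDiffAt]
    simp only [Function.comp_apply, e'.left_inv hn]
    exact ha.mem_iff _ hfn hfO _
  have hsm : ∀ z ∈ e'.target ∩ e'.symm ⁻¹' (f ⁻¹' (e.source ∩ e ⁻¹' O)),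
      ContDiffAt ℝ ∞ (e ∘ f ∘ e'.symm) z := by
    rintro z ⟨hz, hzs, hzO⟩
    have := contDiffAt_written_in_charts he he' (e'.map_target hz) hzs hf.contMDiffAt
    rwa [e'.right_inv hz] at this
  have hopen : IsOpen (e'.target ∩ e'.symm ⁻¹' (f ⁻¹' (e.source ∩ e ⁻¹' O))) :=
    e'.isOpen_inter_preimage_symm ((e.isOpen_inter_preimage ha.isOpen).preimage hf.continuous)
  refine ⟨hopen, inter_subset_left, ?_, ?_, ?_⟩
  · have h1 : ContDiffOn ℝ ∞ (e ∘ f ∘ e'.symm)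
        (e'.target ∩ e'.symm ⁻¹' (f ⁻¹' (e.source ∩ e ⁻¹' O))) :=
      fun z hz ↦ (hsm z hz).contDiffWithinAt
    exact (ha.smooth.comp h1 fun z hz ↦ hz.2.2).clm_comp (h1.fderiv_of_isOpen hopen (by simp))
  · rintro z ⟨hz, hzs, hzO⟩ h0
    apply hcut (e'.symm z)
    rw [eq_top_iff]
    intro u _
    rw [hmem _ (e'.map_target hz) hzs hzO, e'.right_inv hz, h0]
    rfl
  · rintro n hn ⟨-, hfn, hfO⟩ u
    rw [e'.left_inv hn] at hfn hfO
    exact hmem n hn hfn hfO u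

/-- Since `d` commutes with pullback, the characteristic condition on `N` can be tested with the
form `a` of `M` on image vectors. -/
lemma IsCoordForm.mem_charSpace_cut_iff (ha : IsCoordForm C e O a)
    (he : e ∈ IsManifold.maximalAtlas 𝓘(ℝ, E) ∞ M) (hf : ContMDiff 𝓘(ℝ, F) 𝓘(ℝ, E) ∞ f)
    (hcut : ∀ n, ContactRed.cut (F := F) C f n ≠ ⊤) {n : N} (hn : f n ∈ e.source)
    (hnO : e (f n) ∈ O) (v : TangentSpace 𝓘(ℝ, F) n) :
    v ∈ charSpace (ContactRed.cut (F := F) C f) n ↔ v ∈ ContactRed.cut (F := F) C f n ∧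
      ∀ w ∈ ContactRed.cut (F := F) C f n,
        fderiv ℝ a (e (f n)) (chartDeriv e (f n) (mfderiv 𝓘(ℝ, F) 𝓘(ℝ, E) f n v))
          (chartDeriv e (f n) (mfderiv 𝓘(ℝ, F) 𝓘(ℝ, E) f n w)) =
        fderiv ℝ a (e (f n)) (chartDeriv e (f n) (mfderiv 𝓘(ℝ, F) 𝓘(ℝ, E) f n w))
          (chartDeriv e (f n) (mfderiv 𝓘(ℝ, F) 𝓘(ℝ, E) f n v)) := by
  have he' : chartAt F n ∈ IsManifold.maximalAtlas 𝓘(ℝ, F) ∞ N :=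
    IsManifold.chart_mem_maximalAtlas n
  have hns : n ∈ (chartAt F n).source := mem_chart_source F n
  set e' := chartAt F n
  have hb := ha.cut he he' hf hcut
  have hnO' : e' n ∈ e'.target ∩ e'.symm ⁻¹' (f ⁻¹' (e.source ∩ e ⁻¹' O)) := by
    refine ⟨e'.map_source hns, ?_⟩
    rw [mem_preimage, e'.left_inv hns]
    exact ⟨hn, hnO⟩
  have hh := contDiffAt_written_in_charts he he' hns hn hf.contMDiffAt
  have hhn : (e ∘ f ∘ e'.symm) (e' n) = e (f n) := by simp [e'.left_inv hns]
  have hda : DifferentiableAt ℝ a ((e ∘ f ∘ e'.symm) (e' n)) := by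
    rw [hhn]; exact ha.differentiableAt hnO
  have hsub := fun v w ↦ fderiv_pullback_sub hda hh v w
  rw [hb.mem_charSpace_iff he' hns hnO', IsCharVec, ← hb.mem_iff n hns hnO']
  refine and_congr_right fun hv ↦ ?_
  have hd := fun v ↦ fderiv_written_in_charts he he' hns hn hf.contMDiffAt v
  constructor
  · intro h w hw
    have h1 := h _ ((hb.mem_iff n hns hnO' w).1 hw)
    have h2 := hsub (chartDeriv e' n v) (chartDeriv e' n w)
    rw [hd, hd, hhn] at h2
    rw [← sub_eq_zero] at h1 ⊢
    rw [← h2]; exact h1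
  · intro h w hw
    obtain ⟨w, rfl⟩ := chartDeriv_surjective he' hns w
    have h1 := h w ((hb.mem_iff n hns hnO' w).2 hw)
    have h2 := hsub (chartDeriv e' n v) (chartDeriv e' n w)
    rw [hd, hd, hhn] at h2
    rw [← sub_eq_zero] at h1 ⊢
    rw [← h1]; exact h2

lemma isHyperplaneField_cut (hC : IsHyperplaneField C) (hf : ContMDiff 𝓘(ℝ, F) 𝓘(ℝ, E) ∞ f)
    (hcut : ∀ n, cut (F := F) C f n ≠ ⊤) : IsHyperplaneField (cut (F := F) C f) := by
  refine isHyperplaneField_of_coordForm fun n ↦ ?_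
  have he : chartAt E (f n) ∈ IsManifold.maximalAtlas 𝓘(ℝ, E) ∞ M :=
    IsManifold.chart_mem_maximalAtlas _
  have he' : chartAt F n ∈ IsManifold.maximalAtlas 𝓘(ℝ, F) ∞ N :=
    IsManifold.chart_mem_maximalAtlas n
  obtain ⟨O, a, hO, ha⟩ := hC.exists_coordForm he (mem_chart_source E (f n))
  refine ⟨_, he', _, _, mem_chart_source F n, ?_, ha.cut he he' hf hcut⟩
  refine ⟨mem_chart_target F n, ?_⟩
  rw [mem_preimage, (chartAt F n).left_inv (mem_chart_source F n)]
  exact ⟨mem_chart_source E (f n), hO⟩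

/-- On `N` the vanishing of `da(v, ·)` is required on fewer test vectors than on `M`. -/
lemma mem_charSpace_cut_of_mfderiv_mem (hC : IsHyperplaneField C)
    (hf : ContMDiff 𝓘(ℝ, F) 𝓘(ℝ, E) ∞ f) (hcut : ∀ n, cut (F := F) C f n ≠ ⊤) {n : N}
    {v : TangentSpace 𝓘(ℝ, F) n}
    (hv : mfderiv 𝓘(ℝ, F) 𝓘(ℝ, E) f n v ∈ charSpace C (f n)) :
    v ∈ charSpace (cut (F := F) C f) n := by
  have he : chartAt E (f n) ∈ IsManifold.maximalAtlas 𝓘(ℝ, E) ∞ M :=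
    IsManifold.chart_mem_maximalAtlas _
  have hs := mem_chart_source E (f n)
  obtain ⟨O, a, hO, ha⟩ := hC.exists_coordForm he hs
  rw [ha.mem_charSpace_iff he hs hO] at hv
  rw [ha.mem_charSpace_cut_iff he hf hcut hs hO]
  exact ⟨(ha.mem_iff _ hs hO _).2 hv.1, fun w hw ↦ hv.2 _ ((ha.mem_iff _ hs hO _).1 hw)⟩

/-- When the differential is onto, every test vector on `M` lifts to one on `N`, so nothing is lost
in passing to the cut. -/
lemma mfderiv_mem_charSpace_of_surjective (hC : IsHyperplaneField C)
    (hf : ContMDiff 𝓘(ℝ, F) 𝓘(ℝ, E) ∞ f) (hcut : ∀ n, cut (F := F) C f n ≠ ⊤) {n : N}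
    (hsurj : Function.Surjective (mfderiv 𝓘(ℝ, F) 𝓘(ℝ, E) f n)) {v : TangentSpace 𝓘(ℝ, F) n}
    (hv : v ∈ charSpace (cut (F := F) C f) n) :
    mfderiv 𝓘(ℝ, F) 𝓘(ℝ, E) f n v ∈ charSpace C (f n) := by
  have he : chartAt E (f n) ∈ IsManifold.maximalAtlas 𝓘(ℝ, E) ∞ M :=
    IsManifold.chart_mem_maximalAtlas _
  have hs := mem_chart_source E (f n)
  obtain ⟨O, a, hO, ha⟩ := hC.exists_coordForm he hs
  rw [ha.mem_charSpace_cut_iff he hf hcut hs hO] at hv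
  rw [ha.mem_charSpace_iff he hs hO]
  refine ⟨(ha.mem_iff _ hs hO _).1 hv.1, fun w hw ↦ ?_⟩
  obtain ⟨w, rfl⟩ := chartDeriv_surjective he hs w
  obtain ⟨w, rfl⟩ := hsurj w
  exact hv.2 w ((ha.mem_iff _ hs hO _).2 hw)

end Cut

/-! ### Curves in the fibres of a submersion tangent to `C`, and the projected hyperplane. -/

lemma fderiv_apply_eq_zero_of_eventually {V : Type*} [NormedAddCommGroup V] [NormedSpace ℝ V]
    {a : V → V →L[ℝ] ℝ} {c : ℝ → V} {v w : V} {t : ℝ} (ha : DifferentiableAt ℝ a (c t))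
    (hc : HasDerivAt c v t) (h : ∀ᶠ s in 𝓝 t, a (c s) w = 0) : fderiv ℝ a (c t) v w = 0 := by
  have h1 : HasDerivAt (fun s ↦ a (c s) w) (fderiv ℝ a (c t) v w) t := by
    simpa using (ha.hasFDerivAt.comp_hasDerivAt t hc).clm_apply (hasDerivAt_const t w)
  exact h1.unique ((hasDerivAt_const t (0 : ℝ)).congr_of_eventuallyEq h)

section Fibration

variable {E : Type*} [NormedAddCommGroup E] [NormedSpace ℝ E] [FiniteDimensional ℝ E]
  {M : Type*} [TopologicalSpace M] [ChartedSpace E M] [IsManifold 𝓘(ℝ, E) ∞ M]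
  {F : Type*} [NormedAddCommGroup F] [NormedSpace ℝ F] [FiniteDimensional ℝ F]
  {B : Type*} [TopologicalSpace B] [ChartedSpace F B] [IsManifold 𝓘(ℝ, F) ∞ B]
  {C : ∀ x : M, Submodule ℝ (TangentSpace 𝓘(ℝ, E) x)} {U : Set M} {π : M → B}

lemma IsSubmersionAt.mfderiv_surjective {x : M} (h : IsSubmersionAt 𝓘(ℝ, E) 𝓘(ℝ, F) ∞ π x) :
    Function.Surjective (mfderiv 𝓘(ℝ, E) 𝓘(ℝ, F) π x) := by
  obtain ⟨e, he, e', he', L, s, hx, hs, hπ⟩ := IsSubmersionAt.exists_charts h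
  obtain ⟨h1, -, -, h2⟩ := hπ x hx
  intro w
  obtain ⟨v, hv⟩ := chartDeriv_surjective he hx (s (chartDeriv e' (π x) w))
  refine ⟨v, chartDeriv_injective he' h1 ?_⟩
  rw [h2, hv, hs]

lemma sigma_submodule_eq_iff {e' : OpenPartialHomeomorph B F}
    (he' : e' ∈ IsManifold.maximalAtlas 𝓘(ℝ, F) ∞ B)
    {p q : Σ b : B, Submodule ℝ (TangentSpace 𝓘(ℝ, F) b)} (hp : p.1 ∈ e'.source) :
    p = q ↔ p.1 = q.1 ∧ chartDeriv e' p.1 '' p.2 = chartDeriv e' q.1 '' q.2 := by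
  obtain ⟨b, S⟩ := p
  obtain ⟨b', S'⟩ := q
  constructor
  · intro h
    rw [h]
    exact ⟨rfl, rfl⟩
  · rintro ⟨h1, h2⟩
    dsimp only at h1
    subst h1
    have := (chartDeriv_injective he' hp).image_injective h2
    have h3 : S = S' := SetLike.coe_injective this
    rw [h3]

/-- A coordinate form of `C` on a submersion chart of `π` with values in `U`. -/
structure IsFibredForm (C : ∀ x : M, Submodule ℝ (TangentSpace 𝓘(ℝ, E) x)) (U : Set M) (π : M → B)
    (e : OpenPartialHomeomorph M E) (e' : OpenPartialHomeomorph B F) (L : E →L[ℝ] F) (O : Set E)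
    (a : E → E →L[ℝ] ℝ) : Prop where
  mem_atlas : e ∈ IsManifold.maximalAtlas 𝓘(ℝ, E) ∞ M
  mem_atlas' : e' ∈ IsManifold.maximalAtlas 𝓘(ℝ, F) ∞ B
  written : ∀ y ∈ e.source, π y ∈ e'.source ∧ e' (π y) = L (e y) ∧
      ContMDiffAt 𝓘(ℝ, E) 𝓘(ℝ, F) ∞ π y ∧
      ∀ v, chartDeriv e' (π y) (mfderiv 𝓘(ℝ, E) 𝓘(ℝ, F) π y v) = L (chartDeriv e y v)
  form : IsCoordForm C e O a
  mapsTo : ∀ z ∈ O, e.symm z ∈ U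
  ker : ∀ z ∈ O, ∀ v, L v = 0 → a z v = 0

lemma exists_fibredForm (hC : IsHyperplaneField C) (hU : IsOpen U)
    (hker : ∀ x ∈ U, ∀ v, mfderiv 𝓘(ℝ, E) 𝓘(ℝ, F) π x v = 0 → v ∈ C x) {x : M} (hx : x ∈ U)
    (hsub : IsSubmersionAt 𝓘(ℝ, E) 𝓘(ℝ, F) ∞ π x) :
    ∃ e e' L O a, IsFibredForm C U π e e' L O a ∧ x ∈ e.source ∧ e x ∈ O ∧
      ∃ s : F →L[ℝ] E, ∀ w, L (s w) = w := by
  obtain ⟨e, he, e', he', L, s, hxe, hs, hπ⟩ := IsSubmersionAt.exists_charts hsub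
  obtain ⟨O, a, hxO, ha⟩ := hC.exists_coordForm he hxe
  refine ⟨e, e', L, O ∩ (e.target ∩ e.symm ⁻¹' U), a, ⟨he, he', hπ,
    ha.mono (ha.isOpen.inter (e.isOpen_inter_preimage_symm hU)) inter_subset_left,
    fun z hz ↦ hz.2.2, ?_⟩, hxe, ⟨hxO, e.map_source hxe, ?_⟩, s, hs⟩
  · rintro z ⟨hzO, hzt, hzU⟩ v hv
    have hr := e.right_inv hzt
    have hzs := e.map_target hzt
    obtain ⟨u, rfl⟩ := chartDeriv_surjective he hzs v
    obtain ⟨h1, -, -, h2⟩ := hπ _ hzs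
    have h3 := (ha.mem_iff _ hzs (hr.symm ▸ hzO) u).1 (hker _ hzU u
      (chartDeriv_injective he' h1 (by rw [h2, hv, map_zero])))
    rwa [hr] at h3
  · rwa [mem_preimage, e.left_inv hxe]

section FibredForm

variable {e : OpenPartialHomeomorph M E} {e' : OpenPartialHomeomorph B F} {L : E →L[ℝ] F}
  {O : Set E} {a : E → E →L[ℝ] ℝ}

/-- As `ker L ⊂ ker a`, the hyperplane `ker a` is recovered from its image under `L`. -/
lemma IsFibredForm.proj_eq_iff (h : IsFibredForm C U π e e' L O a) {x y : M} (hx : x ∈ e.source)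
    (hxO : e x ∈ O) (hy : y ∈ e.source) (hyO : e y ∈ O) :
    proj (F := F) C π x = proj C π y ↔ π x = π y ∧ ∀ v, a (e x) v = 0 ↔ a (e y) v = 0 := by
  have himg : ∀ {y : M}, y ∈ e.source → e y ∈ O →
      (chartDeriv e' (proj (F := F) C π y).1 '' (proj (F := F) C π y).2 : Set F) =
        L '' {v | a (e y) v = 0} := by
    intro y hy hyO
    ext w
    constructor
    · rintro ⟨_, ⟨v, hv, rfl⟩, rfl⟩
      exact ⟨chartDeriv e y v, (h.form.mem_iff y hy hyO v).1 hv, ((h.written y hy).2.2.2 v).symm⟩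
    · rintro ⟨v, hv, rfl⟩
      obtain ⟨u, rfl⟩ := chartDeriv_surjective h.mem_atlas hy v
      exact ⟨_, ⟨u, (h.form.mem_iff y hy hyO u).2 hv, rfl⟩, (h.written y hy).2.2.2 u⟩
  have hsub : ∀ {z z' : E}, z' ∈ O → L '' {v | a z v = 0} ⊆ L '' {v | a z' v = 0} →
      ∀ v, a z v = 0 → a z' v = 0 := by
    intro z z' hz' hs v hv
    obtain ⟨v', hv', hvv'⟩ := hs ⟨v, hv, rfl⟩
    have := h.ker z' hz' (v - v') (by rw [map_sub, hvv', sub_self])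
    rw [map_sub, hv', sub_zero] at this
    exact this
  rw [sigma_submodule_eq_iff h.mem_atlas' (h.written x hx).1, himg hx hxO, himg hy hyO]
  refine and_congr_right fun _ ↦ ⟨fun hi v ↦ ⟨hsub hyO hi.le v, hsub hxO hi.ge v⟩, fun hi ↦ ?_⟩
  simp_rw [hi]

/-- For a fixed vertical `v` the function `y ↦ a y v` vanishes identically on `O`. Consequently
`da(v, w)` reduces to `fderiv ℝ a z v w`, the variation of the form along the fibre. -/
lemma IsFibredForm.fderiv_eq_zero (h : IsFibredForm C U π e e' L O a) {z : E} (hz : z ∈ O) {v : E}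
    (hv : L v = 0) (w : E) : fderiv ℝ a z w v = 0 := by
  have h1 := ((h.form.differentiableAt hz).hasFDerivAt.clm_apply (hasFDerivAt_const v z))
  have h2 : HasFDerivAt (fun y ↦ a y v) (0 : E →L[ℝ] ℝ) z :=
    (hasFDerivAt_const (0 : ℝ) z).congr_of_eventuallyEq <| by
      filter_upwards [h.form.isOpen.mem_nhds hz] with y hy using h.ker y hy v hv
  simpa using DFunLike.congr_fun (h1.unique h2) w

/-- Near each of its parameters, a curve in a fibre stays in the domain of a fibred form and its
coordinate velocity is vertical. -/
lemma IsFibredForm.exists_interval (h : IsFibredForm C U π e e' L O a) {γ : ℝ → M} {J : Set ℝ}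
    (hγ : IsCurveIn (E := E) U γ J) (hπγ : ∀ s ∈ J, ∀ t ∈ J, π (γ s) = π (γ t)) {t₀ : ℝ}
    (ht₀ : t₀ ∈ J) (hs : γ t₀ ∈ e.source) (hO : e (γ t₀) ∈ O) :
    ∃ ε > 0, ∀ t ∈ Metric.ball t₀ ε, t ∈ J ∧ γ t ∈ e.source ∧ e (γ t) ∈ O ∧
      L (chartDeriv e (γ t) (mfderiv 𝓘(ℝ, ℝ) 𝓘(ℝ, E) γ t (1 : ℝ))) = 0 := by
  have hopen : IsOpen (e.source ∩ e ⁻¹' O) := e.isOpen_inter_preimage h.form.isOpen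
  have hn : J ∩ γ ⁻¹' (e.source ∩ e ⁻¹' O) ∈ 𝓝 t₀ :=
    Filter.inter_mem (hγ.1.mem_nhds ht₀)
      ((hγ.contMDiffAt ht₀).continuousAt (hopen.mem_nhds ⟨hs, hO⟩))
  obtain ⟨ε, hε, hball⟩ := Metric.mem_nhds_iff.1 hn
  refine ⟨ε, hε, fun t ht ↦ ⟨(hball ht).1, (hball ht).2.1, (hball ht).2.2, ?_⟩⟩
  obtain ⟨htJ, hts, htO⟩ := hball ht
  have h1 := L.hasFDerivAt.comp_hasDerivAt t
    (hasDerivAt_chart_comp_curve h.mem_atlas (hγ.contMDiffAt htJ) hts)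
  have h2 : HasDerivAt (L ∘ (e ∘ γ)) 0 t := by
    refine (hasDerivAt_const t (e' (π (γ t)))).congr_of_eventuallyEq ?_
    filter_upwards [Metric.isOpen_ball.mem_nhds ht] with s hs
    rw [hπγ t htJ s (hball hs).1]
    exact ((h.written _ (hball hs).2.1).2.1).symm
  exact h1.unique h2

end FibredForm

/-- Along a characteristic curve in a fibre the projected hyperplane is constant. -/
lemma proj_eq_of_isCharacteristic (hC : IsHyperplaneField C) (hU : IsOpen U)
    (hsub : ∀ x ∈ U, IsSubmersionAt 𝓘(ℝ, E) 𝓘(ℝ, F) ∞ π x)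
    (hker : ∀ x ∈ U, ∀ v, mfderiv 𝓘(ℝ, E) 𝓘(ℝ, F) π x v = 0 → v ∈ C x) {γ : ℝ → M} {J : Set ℝ}
    (hγ : IsCurveIn (E := E) U γ J) (hK : IsCharacteristic C γ J)
    (hπγ : ∀ s ∈ J, ∀ t ∈ J, π (γ s) = π (γ t)) {s t : ℝ} (hs : s ∈ J) (ht : t ∈ J) :
    proj (F := F) C π (γ s) = proj C π (γ t) := by
  refine hγ.isPreconnected.induction₂ (fun s t ↦ proj (F := F) C π (γ s) = proj C π (γ t)) ?_
    (fun _ _ _ _ _ _ ↦ Eq.trans) (fun _ _ _ _ ↦ Eq.symm) hs ht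
  intro t₀ ht₀
  obtain ⟨e, e', L, O, a, h, hxe, hxO, -⟩ := exists_fibredForm hC hU hker (hγ.2.2.2 t₀ ht₀)
    (hsub _ (hγ.2.2.2 t₀ ht₀))
  obtain ⟨ε, hε, hball⟩ := h.exists_interval hγ hπγ ht₀ hxe hxO
  refine Filter.Eventually.filter_mono nhdsWithin_le_nhds ?_
  filter_upwards [Metric.ball_mem_nhds t₀ hε] with t ht
  obtain ⟨htJ, hts, htO, -⟩ := hball t ht
  rw [h.proj_eq_iff hxe hxO hts htO]
  refine ⟨hπγ _ ht₀ _ htJ, fun w ↦ ?_⟩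
  refine ker_transport (β := fun t ↦ a (e (γ t)))
    (β' := fun t ↦ fderiv ℝ a (e (γ t))
      (chartDeriv e (γ t) (mfderiv 𝓘(ℝ, ℝ) 𝓘(ℝ, E) γ t (1 : ℝ)))) Metric.isOpen_ball
    (convex_ball t₀ ε).ordConnected (fun t ht ↦ ?_) (fun t ht ↦ h.form.ne_zero _ (hball t ht).2.2.1)
    (fun t ht w hw ↦ ?_) (Metric.mem_ball_self hε) ht w
  · obtain ⟨htJ, hts, htO, -⟩ := hball t ht
    exact (h.form.differentiableAt htO).hasFDerivAt.comp_hasDerivAt t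
      (hasDerivAt_chart_comp_curve h.mem_atlas (hγ.contMDiffAt htJ) hts)
  · obtain ⟨htJ, hts, htO, htL⟩ := hball t ht
    -- For a vertical characteristic velocity, the derivative of `a` along the curve kills `ker a`,
    -- which is the hypothesis of `ker_transport`.
    rw [((h.form.mem_charSpace_iff h.mem_atlas hts htO _).1 (hK t htJ)).2 w hw]
    exact h.fderiv_eq_zero htO htL w

/-- A constant projection makes the velocity vertical, hence tangent to `C`, and makes each `w ∈ ker
a` stay in the kernel along the curve; so the derivative of `a` along the velocity vanishes on `w`,
and this derivative is all of `da`. -/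
lemma isCharacteristic_of_proj_eq (hC : IsHyperplaneField C) (hU : IsOpen U)
    (hsub : ∀ x ∈ U, IsSubmersionAt 𝓘(ℝ, E) 𝓘(ℝ, F) ∞ π x)
    (hker : ∀ x ∈ U, ∀ v, mfderiv 𝓘(ℝ, E) 𝓘(ℝ, F) π x v = 0 → v ∈ C x) {γ : ℝ → M} {J : Set ℝ}
    (hγ : IsCurveIn (E := E) U γ J)
    (hproj : ∀ s ∈ J, ∀ t ∈ J, proj (F := F) C π (γ s) = proj C π (γ t)) :
    IsCharacteristic C γ J := by
  intro t₀ ht₀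
  obtain ⟨e, e', L, O, a, h, hxe, hxO, -⟩ := exists_fibredForm hC hU hker (hγ.2.2.2 t₀ ht₀)
    (hsub _ (hγ.2.2.2 t₀ ht₀))
  obtain ⟨ε, hε, hball⟩ := h.exists_interval hγ
    (fun s hs t ht ↦ congrArg Sigma.fst (hproj s hs t ht)) ht₀ hxe hxO
  have h0 := Metric.mem_ball_self (x := t₀) hε
  obtain ⟨-, -, -, hL⟩ := hball t₀ h0
  rw [h.form.mem_charSpace_iff h.mem_atlas hxe hxO]
  refine ⟨h.ker _ hxO _ hL, fun w hw ↦ ?_⟩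
  rw [h.fderiv_eq_zero hxO hL]
  refine fderiv_apply_eq_zero_of_eventually (h.form.differentiableAt hxO)
    (hasDerivAt_chart_comp_curve h.mem_atlas (hγ.contMDiffAt ht₀) hxe) ?_
  filter_upwards [Metric.isOpen_ball.mem_nhds h0] with t ht
  obtain ⟨htJ, hts, htO, -⟩ := hball t ht
  exact (((h.proj_eq_iff hxe hxO hts htO).1 (hproj _ ht₀ _ htJ)).2 w).1 hw

end Fibration

/-! ### Level sets of the projected hyperplane are unions of characteristics. -/

section Normalized

variable {E : Type*} [NormedAddCommGroup E] [NormedSpace ℝ E]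

/-- Functionals with the same kernel are proportional, and the value `1` on `R` fixes the factor.
Thus `a / a R` is a vector-valued function encoding the hyperplane. -/
lemma inv_smul_eq_inv_smul_of_ker {f g : E →L[ℝ] ℝ} {R : E} (hf : f R ≠ 0) (hg : g R ≠ 0)
    (h : ∀ v, f v = 0 ↔ g v = 0) : (f R)⁻¹ • f = (g R)⁻¹ • g := by
  ext w
  have h1 := (h (f R • w - f w • R)).1 (by simp [mul_comm])
  simp only [map_sub, map_smul, smul_eq_mul] at h1
  simp only [smul_apply, smul_eq_mul]
  field_simp
  linarith

lemma fderiv_normalized {a : E → E →L[ℝ] ℝ} {z R : E} (ha : DifferentiableAt ℝ a z)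
    (hR : a z R ≠ 0) (v w : E) :
    fderiv ℝ (fun y ↦ (a y R)⁻¹ • a y) z v w =
      (a z R * fderiv ℝ a z v w - fderiv ℝ a z v R * a z w) / a z R ^ 2 := by
  have h1 : HasFDerivAt (fun y ↦ a y R) ((fderiv ℝ a z).flip R) z := by
    have := ha.hasFDerivAt.clm_apply (hasFDerivAt_const R z)
    refine this.congr_fderiv ?_
    ext v
    simp
  have h2 := ((hasDerivAt_inv hR).comp_hasFDerivAt z h1).smul ha.hasFDerivAt
  rw [show (fun y ↦ (a y R)⁻¹ • a y) = (fun y ↦ (Inv.inv ∘ fun y ↦ a y R) y • a y) from rfl]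
  erw [h2.fderiv]
  simp
  field_simp
  ring

end Normalized

section Fibration

variable {E : Type*} [NormedAddCommGroup E] [NormedSpace ℝ E] [FiniteDimensional ℝ E]
  {M : Type*} [TopologicalSpace M] [ChartedSpace E M] [IsManifold 𝓘(ℝ, E) ∞ M]
  {F : Type*} [NormedAddCommGroup F] [NormedSpace ℝ F] [FiniteDimensional ℝ F]
  {B : Type*} [TopologicalSpace B] [ChartedSpace F B] [IsManifold 𝓘(ℝ, F) ∞ B]
  {C : ∀ x : M, Submodule ℝ (TangentSpace 𝓘(ℝ, E) x)} {U : Set M} {π : M → B}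
  {e : OpenPartialHomeomorph M E} {e' : OpenPartialHomeomorph B F} {L : E →L[ℝ] F}
  {O : Set E} {a : E → E →L[ℝ] ℝ}

/-- For vertical `v`, the normalized form is stationary along `v` exactly when `D_v a` is
proportional to `a`, i.e. kills `ker a`; this is the characteristic condition. `hKL` supplies
verticality in the converse direction. -/
lemma IsFibredForm.fderiv_normalized_eq_zero_iff (h : IsFibredForm C U π e e' L O a)
    (hKL : ∀ z ∈ O, ∀ v, IsCharVec a z v → L v = 0) {z R : E} (hz : z ∈ O) (hR : a z R ≠ 0)
    (v : E) : fderiv ℝ (fun y ↦ (L y, (a y R)⁻¹ • a y)) z v = 0 ↔ IsCharVec a z v := by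
  have hd := h.form.differentiableAt hz
  have hdR : DifferentiableAt ℝ (fun y ↦ (a y R)⁻¹ • a y) z :=
    ((hd.clm_apply (differentiableAt_const R)).inv hR).smul hd
  have h1 : fderiv ℝ (fun y ↦ (L y, (a y R)⁻¹ • a y)) z v = 0 ↔
      L v = 0 ∧ ∀ w, a z R * fderiv ℝ a z v w - fderiv ℝ a z v R * a z w = 0 := by
    rw [(L.hasFDerivAt.prodMk hdR.hasFDerivAt).fderiv, ContinuousLinearMap.prod_apply,
      Prod.mk_eq_zero]
    refine and_congr_right fun _ ↦ ?_
    rw [ContinuousLinearMap.ext_iff]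
    refine forall_congr' fun w ↦ ?_
    rw [fderiv_normalized hd hR, zero_apply, div_eq_zero_iff]
    simp [hR]
  rw [h1]
  constructor
  · rintro ⟨hL, hw⟩
    refine ⟨h.ker z hz v hL, fun w haw ↦ ?_⟩
    have := hw w
    rw [haw, mul_zero, sub_zero, mul_eq_zero] at this
    rw [this.resolve_left hR, h.fderiv_eq_zero hz hL]
  · intro hv
    have hL := hKL z hz v hv
    refine ⟨hL, fun w ↦ ?_⟩
    have := hv.2 (a z R • w - a z w • R) (by simp [mul_comm])
    rw [h.fderiv_eq_zero hz hL, map_sub, map_smul, map_smul, smul_eq_mul, smul_eq_mul] at this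
    linarith

/-- The level sets of the projected hyperplane are locally contained in the characteristics. -/
lemma IsFibredForm.eventually_mem_leaf (h : IsFibredForm C U π e e' L O a)
    (hKL : ∀ z ∈ O, ∀ v, IsCharVec a z v → L v = 0) {k : ℕ}
    (hk : ∀ x, Module.finrank ℝ (charSpace C x) = k) {x : M} (hx : x ∈ e.source) (hxO : e x ∈ O) :
    ∀ᶠ y in 𝓝 x, proj (F := F) C π y = proj C π x → y ∈ leaf C U x := by
  obtain ⟨R, hR⟩ := exists_apply_ne_zero (h.form.ne_zero _ hxO)
  have haR : ContDiffOn ℝ ∞ (fun z ↦ a z R) O := h.form.smooth.clm_apply contDiffOn_const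
  have hO₁ : IsOpen (O ∩ (fun z ↦ a z R) ⁻¹' {0}ᶜ) :=
    haR.continuousOn.isOpen_inter_preimage h.form.isOpen isOpen_compl_singleton
  set O₁ := O ∩ (fun z ↦ a z R) ⁻¹' {0}ᶜ
  have hΦ : ContDiffOn ℝ ∞ (fun y ↦ (L y, (a y R)⁻¹ • a y)) O₁ :=
    L.contDiff.contDiffOn.prodMk (((haR.mono inter_subset_left).inv fun z hz ↦ hz.2).smul
      (h.form.smooth.mono inter_subset_left))
  have hrank : ∀ z ∈ O₁,
      Module.finrank ℝ (fderiv ℝ (fun y ↦ (L y, (a y R)⁻¹ • a y)) z).ker = k := by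
    intro z hz
    have hr := e.right_inv (h.form.subset hz.1)
    have hs := e.map_target (h.form.subset hz.1)
    rw [← hk (e.symm z)]
    refine (finrank_eq_of_mem_iff (chartDeriv e (e.symm z) : _ →ₗ[ℝ] E)
      ⟨chartDeriv_injective h.mem_atlas hs, chartDeriv_surjective h.mem_atlas hs⟩ fun u ↦ ?_).symm
    rw [h.form.mem_charSpace_iff h.mem_atlas hs (hr.symm ▸ hz.1), hr]
    exact (h.fderiv_normalized_eq_zero_iff hKL hz.1 hz.2 _).symm
  have hev := exists_curve_in_level hO₁ hΦ hrank ⟨hxO, hR⟩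
  have hc := e.continuousAt hx
  filter_upwards [hc.eventually hev, hc (hO₁.mem_nhds ⟨hxO, hR⟩), e.open_source.mem_nhds hx]
    with y hy hyO hys hproj
  obtain ⟨hπ, hker⟩ := (h.proj_eq_iff hys hyO.1 hx hxO).1 hproj
  obtain ⟨c, J, hJ, hJ', h0, h1, hcs, hcO, hc0, hc1, hcd⟩ := hy <| Prod.ext
    (by rw [← (h.written y hys).2.1, ← (h.written x hx).2.1, hπ])
    (inv_smul_eq_inv_smul_of_ker hyO.2 hR hker)
  obtain ⟨h2, h3⟩ := h.form.isCharacteristic_symm_comp h.mem_atlas (U := U) hJ hJ' hcs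
    (fun t ht ↦ ⟨(hcO t ht).1, h.mapsTo _ (hcO t ht).1⟩) fun t ht ↦
      (h.fderiv_normalized_eq_zero_iff hKL (hcO t ht).1 (hcO t ht).2 _).1 (hcd t ht)
  exact ⟨_, J, h2, h3, 0, h0, 1, h1, by rw [hc0, e.left_inv hx], by rw [hc1, e.left_inv hys]⟩

lemma isCoatom_proj (hC : IsHyperplaneField C) {x : M}
    (hsub : IsSubmersionAt 𝓘(ℝ, E) 𝓘(ℝ, F) ∞ π x)
    (hker : ∀ v, mfderiv 𝓘(ℝ, E) 𝓘(ℝ, F) π x v = 0 → v ∈ C x) :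
    IsCoatom (proj (F := F) C π x).2 := by
  obtain ⟨W, -, hxW, α, -, hα⟩ := hC x
  obtain ⟨h0, hCx⟩ := hα x hxW
  have hco : IsCoatom (C x) := by
    rw [hCx]
    exact LinearMap.isCoatom_ker_of_surjective (f := (α x : TangentSpace 𝓘(ℝ, E) x →ₗ[ℝ] ℝ))
      (LinearMap.surjective fun h ↦ h0 (ContinuousLinearMap.coe_injective h))
  refine Submodule.isCoatom_map_of_ker_le
    (f := (mfderiv 𝓘(ℝ, E) 𝓘(ℝ, F) π x : TangentSpace 𝓘(ℝ, E) x →ₗ[ℝ] TangentSpace 𝓘(ℝ, F) (π x)))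
    (IsSubmersionAt.mfderiv_surjective hsub) ?_ hco
  exact fun v hv ↦ hker v hv

/-- If the fibres of a submersion contain the characteristics and are tangent to the field, then
the projected hyperplane determines the characteristics. -/
theorem determinesCharacteristics (hC : IsHyperplaneField C) {k : ℕ}
    (hk : ∀ x, Module.finrank ℝ (charSpace C x) = k) (hU : IsOpen U)
    (hsub : ∀ x ∈ U, IsSubmersionAt 𝓘(ℝ, E) 𝓘(ℝ, F) ∞ π x)
    (hleaf : ∀ x ∈ U, ∀ y ∈ leaf C U x, π y = π x)
    (hK : ∀ x ∈ U, ∀ v ∈ charSpace C x, mfderiv 𝓘(ℝ, E) 𝓘(ℝ, F) π x v = 0)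
    (hker : ∀ x ∈ U, ∀ v, mfderiv 𝓘(ℝ, E) 𝓘(ℝ, F) π x v = 0 → v ∈ C x) :
    DeterminesCharacteristics (F := F) C U π := by
  have hchar : ∀ (γ : ℝ → M) (J : Set ℝ), IsCurveIn (E := E) U γ J → IsCharacteristic C γ J →
      ∀ s ∈ J, ∀ t ∈ J, proj (F := F) C π (γ s) = proj C π (γ t) := by
    intro γ J hγ h s hs t ht
    exact proj_eq_of_isCharacteristic hC hU hsub hker hγ h
      (fun s hs t ht ↦ hleaf _ (hγ.2.2.2 t ht) _ ⟨γ, J, hγ, h, t, ht, s, hs, rfl, rfl⟩) hs ht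
  refine ⟨fun x hx ↦ isCoatom_proj hC (hsub x hx) (hker x hx), fun γ J hγ ↦
    ⟨hchar γ J hγ, isCharacteristic_of_proj_eq hC hU hsub hker hγ⟩, fun x hx ↦ ?_⟩
  refine Subset.antisymm ?_ ?_
  · rintro y ⟨γ, J, h1, h2, s, hs, t, ht, rfl, rfl⟩
    refine (h1.isPreconnected.image γ h1.2.2.1.continuousOn).subset_connectedComponentIn
      (mem_image_of_mem γ hs) ?_ (mem_image_of_mem γ ht)
    rintro _ ⟨τ, hτ, rfl⟩
    exact ⟨h1.2.2.2 τ hτ, hchar γ J h1 h2 τ hτ s hs⟩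
  · intro y hy
    have hsubset := connectedComponentIn_subset {y | y ∈ U ∧ proj (F := F) C π y = proj C π x} x
    have hxx : x ∈ {y | y ∈ U ∧ proj (F := F) C π y = proj C π x} := ⟨hx, rfl⟩
    -- An equivalence relation which locally relates all points of a connected set relates all of
    -- them; here the local statement is `IsFibredForm.eventually_mem_leaf`.
    refine isPreconnected_connectedComponentIn.induction₂ (fun x y ↦ y ∈ leaf C U x) ?_
      (fun _ _ _ _ _ _ ↦ leaf_trans) (fun _ _ _ _ ↦ leaf_symm) (mem_connectedComponentIn hxx) hy
    intro z hz
    obtain ⟨hzU, hzx⟩ := hsubset hz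
    obtain ⟨e, e', L, O, a, h, hze, hzO, -⟩ := exists_fibredForm hC hU (hker) hzU (hsub z hzU)
    refine (Filter.Eventually.filter_mono nhdsWithin_le_nhds
      (h.eventually_mem_leaf ?_ hk hze hzO)).mp ?_
    · intro z hzO v hv
      have hr := e.right_inv (h.form.subset hzO)
      have hs := e.map_target (h.form.subset hzO)
      obtain ⟨u, rfl⟩ := chartDeriv_surjective h.mem_atlas hs v
      have h1 := (h.form.mem_charSpace_iff h.mem_atlas hs (hr.symm ▸ hzO) u).2 (hr.symm ▸ hv)
      rw [← (h.written _ hs).2.2.2, hK _ (h.mapsTo z hzO) u h1, map_zero]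
    · filter_upwards [self_mem_nhdsWithin] with w hw hw'
      exact hw' ((hsubset hw).2.trans hzx.symm)

/-- Every characteristic direction is the velocity of a characteristic curve, and that curve stays
in one fibre. -/
lemma mfderiv_eq_zero_of_leaf_subset (hC : IsHyperplaneField C) {k : ℕ}
    (hk : ∀ x, Module.finrank ℝ (charSpace C x) = k) (hU : IsOpen U)
    (hsub : ∀ x ∈ U, IsSubmersionAt 𝓘(ℝ, E) 𝓘(ℝ, F) ∞ π x)
    (hleaf : ∀ x ∈ U, ∀ y ∈ leaf C U x, π y = π x) {x : M} (hx : x ∈ U)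
    {v : TangentSpace 𝓘(ℝ, E) x} (hv : v ∈ charSpace C x) :
    mfderiv 𝓘(ℝ, E) 𝓘(ℝ, F) π x v = 0 := by
  obtain ⟨γ, J, h1, h2, h0, h3⟩ := exists_characteristic hC hk hU hx hv
  obtain ⟨e, he, e', he', L, s, hxe, hs, hπ⟩ := IsSubmersionAt.exists_charts (hsub x hx)
  have h4 : ∀ q : TangentBundle 𝓘(ℝ, E) M, q = ⟨x, v⟩ →
      q.1 ∈ e.source ∧ (L (chartDeriv e q.1 q.2) = 0 →  mfderiv 𝓘(ℝ, E) 𝓘(ℝ, F) π x v = 0) := by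
    rintro _ rfl
    refine ⟨hxe, fun h ↦ chartDeriv_injective he' (hπ x hxe).1 ?_⟩
    rw [(hπ x hxe).2.2.2, h, map_zero]
  obtain ⟨h5, h6⟩ := h4 _ h3
  refine h6 ?_
  have h7 := L.hasFDerivAt.comp_hasDerivAt 0 (hasDerivAt_chart_comp_curve he (h1.contMDiffAt h0) h5)
  have h8 : HasDerivAt (L ∘ (e ∘ γ)) 0 0 := by
    refine (hasDerivAt_const 0 (e' (π (γ 0)))).congr_of_eventuallyEq ?_
    filter_upwards [h1.1.mem_nhds h0, (h1.contMDiffAt h0).continuousAt (e.open_source.mem_nhds h5)]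
      with t ht hts
    rw [← hleaf _ (h1.2.2.2 0 h0) _ ⟨γ, J, h1, h2, 0, h0, t, ht, rfl, rfl⟩]
    exact (hπ _ hts).2.1.symm
  exact h7.unique h8

/-- A characteristic curve whose directions are vertical lies in a fibre. -/
lemma proj_const_of_mem_leaf (hsub : ∀ x ∈ U, IsSubmersionAt 𝓘(ℝ, E) 𝓘(ℝ, F) ∞ π x)
    (hK : ∀ x ∈ U, ∀ v ∈ charSpace C x, mfderiv 𝓘(ℝ, E) 𝓘(ℝ, F) π x v = 0) {x y : M}
    (hy : y ∈ leaf C U x) : π y = π x := by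
  obtain ⟨γ, J, h1, h2, s, hs, t, ht, rfl, rfl⟩ := hy
  refine h1.isPreconnected.induction₂ (fun s t ↦ π (γ t) = π (γ s)) ?_
    (fun _ _ _ _ _ _ h h' ↦ h'.trans h) (fun _ _ _ _ ↦ Eq.symm) hs ht
  intro t₀ ht₀
  obtain ⟨e, he, e', he', L, s, hxe, -, hπ⟩ :=
    IsSubmersionAt.exists_charts (hsub _ (h1.2.2.2 t₀ ht₀))
  have hn : J ∩ γ ⁻¹' e.source ∈ 𝓝 t₀ := Filter.inter_mem (h1.1.mem_nhds ht₀)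
      ((h1.contMDiffAt ht₀).continuousAt (e.open_source.mem_nhds hxe))
  obtain ⟨ε, hε, hball⟩ := Metric.mem_nhds_iff.1 hn
  refine Filter.Eventually.filter_mono nhdsWithin_le_nhds ?_
  have hd : ∀ t ∈ Metric.ball t₀ ε, HasDerivAt (L ∘ (e ∘ γ)) 0 t := fun t ht ↦ by
    have h3 := L.hasFDerivAt.comp_hasDerivAt t
      (hasDerivAt_chart_comp_curve he (h1.contMDiffAt (hball ht).1) (hball ht).2)
    rwa [← (hπ _ (hball ht).2).2.2.2, hK _ (h1.2.2.2 t (hball ht).1) _ (h2 t (hball ht).1),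
      map_zero] at h3
  filter_upwards [Metric.ball_mem_nhds t₀ hε] with t ht
  have h0 := Metric.mem_ball_self (x := t₀) hε
  have h4 : L (e (γ t)) = L (e (γ t₀)) :=
    Metric.isOpen_ball.is_const_of_deriv_eq_zero (convex_ball t₀ ε).isPreconnected
      (fun t ht ↦ (hd t ht).differentiableAt.differentiableWithinAt)
      (fun t ht ↦ (hd t ht).deriv) ht h0
  refine e'.injOn (hπ _ (hball ht).2).1 (hπ _ hxe).1 ?_
  rw [(hπ _ (hball ht).2).2.1, (hπ _ hxe).2.1, h4]

end Fibration

/-! ### Infinitesimal form of the invariance of `C`. -/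

section Infinitesimal

variable {V : Type*} [NormedAddCommGroup V] [NormedSpace ℝ V]
  {E : Type*} [NormedAddCommGroup E] [NormedSpace ℝ E]

/-- The derivative at the identity of a family of transformations preserving the kernel of `a`. -/
lemma lie_derivative_apply_eq_zero {Ψ : V × E → E} {u₀ ξ : V} {z w : E}
    (hΨ : ContDiffAt ℝ ∞ Ψ (u₀, z)) (hid : ∀ᶠ y in 𝓝 z, Ψ (u₀, y) = y) {a : E → E →L[ℝ] ℝ}
    (ha : DifferentiableAt ℝ a z)
    (h : ∀ᶠ u in 𝓝 u₀, a (Ψ (u, z)) (fderiv ℝ Ψ (u, z) (0, w)) = 0) :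
    fderiv ℝ a z (fderiv ℝ Ψ (u₀, z) (ξ, 0)) w +
      a z (fderiv ℝ (fun y ↦ fderiv ℝ Ψ (u₀, y) (ξ, 0)) z w) = 0 := by
  have hD : DifferentiableAt ℝ (fderiv ℝ Ψ) (u₀, z) :=
    (hΨ.fderiv_right (m := 1) (by norm_cast)).differentiableAt (by simp)
  have hΨd : DifferentiableAt ℝ Ψ (u₀, z) := hΨ.differentiableAt (by simp)
  have hz : Ψ (u₀, z) = z := hid.self_of_nhds
  -- Mixed partials commute: the parameter derivative of the differential of the transformations is
  -- the differential of the generated field.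
  have hsymm : fderiv ℝ (fderiv ℝ Ψ) (u₀, z) (ξ, 0) (0, w) =
      fderiv ℝ (fderiv ℝ Ψ) (u₀, z) (0, w) (ξ, 0) :=
    (hΨ.isSymmSndFDerivAt (by simpa using two_le_infty)).eq _ _
  have h1 : HasFDerivAt (fun y : E ↦ (u₀, y)) (ContinuousLinearMap.inr ℝ V E) z :=
    hasFDerivAt_prodMk_right u₀ z
  have h2 : HasDerivAt (fun t : ℝ ↦ (u₀ + t • ξ, z)) (ξ, 0) 0 := by
    have := ((hasDerivAt_id (0 : ℝ)).smul_const ξ).const_add u₀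
    simpa using this.prodMk (hasDerivAt_const (0 : ℝ) z)
  have h20 : (u₀ + (0 : ℝ) • ξ, z) = (u₀, z) := by simp
  have h3 : fderiv ℝ (fun y ↦ fderiv ℝ Ψ (u₀, y) (ξ, 0)) z w =
      fderiv ℝ (fderiv ℝ Ψ) (u₀, z) (0, w) (ξ, 0) := by
    have := (HasFDerivAt.comp z hD.hasFDerivAt h1).clm_apply (hasFDerivAt_const (ξ, (0 : E)) z)
    have h4 := this.fderiv
    simp only [Function.comp_def] at h4
    rw [h4]
    simp
  have h5 : fderiv ℝ Ψ (u₀, z) (0, w) = w := by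
    have h6 := (HasFDerivAt.comp z hΨd.hasFDerivAt h1).unique
      ((hasFDerivAt_id z).congr_of_eventuallyEq hid)
    simpa using DFunLike.congr_fun h6 w
  have h7 : HasDerivAt (fun t : ℝ ↦ Ψ (u₀ + t • ξ, z)) (fderiv ℝ Ψ (u₀, z) (ξ, 0)) 0 :=
    HasFDerivAt.comp_hasDerivAt_of_eq 0 hΨd.hasFDerivAt h2 h20.symm
  have h8 : HasDerivAt (fun t : ℝ ↦ a (Ψ (u₀ + t • ξ, z)))
      (fderiv ℝ a z (fderiv ℝ Ψ (u₀, z) (ξ, 0))) 0 :=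
    HasFDerivAt.comp_hasDerivAt_of_eq 0 ha.hasFDerivAt h7 (by rw [h20, hz])
  have h9 : HasDerivAt (fun t : ℝ ↦ fderiv ℝ Ψ (u₀ + t • ξ, z) (0, w))
      (fderiv ℝ (fderiv ℝ Ψ) (u₀, z) (ξ, 0) (0, w)) 0 := by
    have := (HasFDerivAt.comp_hasDerivAt_of_eq 0 hD.hasFDerivAt h2 h20.symm).clm_apply
      (hasDerivAt_const (0 : ℝ) ((0 : V), w))
    simpa using this
  have h10 := h8.clm_apply h9
  have h11 : HasDerivAt (fun t : ℝ ↦ a (Ψ (u₀ + t • ξ, z)) (fderiv ℝ Ψ (u₀ + t • ξ, z) (0, w)))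
      0 0 := by
    refine (hasDerivAt_const (0 : ℝ) (0 : ℝ)).congr_of_eventuallyEq ?_
    have h12 : Filter.Tendsto (fun t : ℝ ↦ u₀ + t • ξ) (𝓝 0) (𝓝 u₀) := by
      have : Continuous fun t : ℝ ↦ u₀ + t • ξ := by fun_prop
      simpa using this.tendsto 0
    exact h12.eventually h
  have h13 := h10.unique h11
  rw [h20, hz, h5, hsymm, ← h3] at h13
  exact h13

end Infinitesimal

section Actions

variable {EG : Type*} [NormedAddCommGroup EG] [NormedSpace ℝ EG]
  {G : Type*} [TopologicalSpace G] [ChartedSpace EG G] [Group G] [IsManifold 𝓘(ℝ, EG) ∞ G]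
  {E : Type*} [NormedAddCommGroup E] [NormedSpace ℝ E] [FiniteDimensional ℝ E]
  {M : Type*} [TopologicalSpace M] [ChartedSpace E M] [IsManifold 𝓘(ℝ, E) ∞ M]
  {C : ∀ x : M, Submodule ℝ (TangentSpace 𝓘(ℝ, E) x)}
  {e : OpenPartialHomeomorph M E} {O : Set E} {a : E → E →L[ℝ] ℝ}

/-- In a chart, the vector fields generated by an action preserving `C` are smooth and satisfy the
infinitesimal form of the invariance of `C`. -/
lemma LocalAction.exists_generator_coord (A : LocalAction (EG := EG) G (E := E) M)
    (he : e ∈ IsManifold.maximalAtlas 𝓘(ℝ, E) ∞ M) (ξ : GroupLieAlgebra 𝓘(ℝ, EG) G) :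
    ∃ X : E → E, ContDiffOn ℝ ∞ X e.target ∧
      (∀ x ∈ e.source, chartDeriv e x (A.generator x ξ) = X (e x)) ∧
      (A.Preserves C → ∀ O a, IsCoordForm C e O a → ∀ z ∈ O, ∀ w, a z w = 0 →
        fderiv ℝ a z (X z) w + a z (fderiv ℝ X z w) = 0) := by
  set φ := chartAt EG (1 : G)
  have hφ : φ ∈ IsManifold.maximalAtlas 𝓘(ℝ, EG) ∞ G := IsManifold.chart_mem_maximalAtlas 1
  have h1φ : (1 : G) ∈ φ.source := mem_chart_source EG 1
  -- The action in charts of `G` at `1` and of `M`; the coordinate field of `ξ` is its partial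
  -- derivative in the group variable at `φ 1`.
  let Ψ : EG × E → E := fun q ↦ e (A.act (φ.symm q.1) (e.symm q.2))
  let D₁ : Set (EG × E) := (φ.target ×ˢ e.target) ∩ (fun q ↦ (φ.symm q.1, e.symm q.2)) ⁻¹' A.dom
  let D : Set (EG × E) := D₁ ∩ (fun q ↦ A.act (φ.symm q.1) (e.symm q.2)) ⁻¹' e.source
  have hs1 : ContMDiffOn (𝓘(ℝ, EG).prod 𝓘(ℝ, E)) (𝓘(ℝ, EG).prod 𝓘(ℝ, E)) ∞
      (fun q : EG × E ↦ (φ.symm q.1, e.symm q.2)) (φ.target ×ˢ e.target) :=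
    (contMDiffOn_symm_of_mem_maximalAtlas hφ).prodMap (contMDiffOn_symm_of_mem_maximalAtlas he)
  have hs2 : ContMDiffOn (𝓘(ℝ, EG).prod 𝓘(ℝ, E)) 𝓘(ℝ, E) ∞
      (fun q : EG × E ↦ A.act (φ.symm q.1) (e.symm q.2)) D₁ :=
    A.smooth.comp (hs1.mono inter_subset_left) fun q hq ↦ hq.2
  have hD₁ : IsOpen D₁ :=
    hs1.continuousOn.isOpen_inter_preimage (φ.open_target.prod e.open_target) A.isOpen_dom
  have hD : IsOpen D := hs2.continuousOn.isOpen_inter_preimage hD₁ e.open_source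
  have hΨ : ContDiffOn ℝ ∞ Ψ D := by
    have h := (contMDiffOn_of_mem_maximalAtlas he).comp (hs2.mono inter_subset_left)
      (s := D) fun q hq ↦ hq.2
    rw [← modelWithCornersSelf_prod, chartedSpaceSelf_prod] at h
    exact h.contDiffOn
  have hact : ∀ z, A.act (φ.symm (φ 1)) (e.symm z) = e.symm z := fun z ↦ by
    rw [φ.left_inv h1φ, A.one_act]
  have hmem : ∀ z ∈ e.target, (φ 1, z) ∈ D := fun z hz ↦
    ⟨⟨⟨φ.map_source h1φ, hz⟩, by
      rw [mem_preimage]; dsimp only; rw [φ.left_inv h1φ]; exact A.one_mem _⟩, by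
      rw [mem_preimage, hact]; exact e.map_target hz⟩
  have hid : ∀ z ∈ e.target, Ψ (φ 1, z) = z := fun z hz ↦ by
    change e (A.act _ _) = z
    rw [hact, e.right_inv hz]
  have hΨa : ∀ q ∈ D, ContDiffAt ℝ ∞ Ψ q := fun q hq ↦ hΨ.contDiffAt (hD.mem_nhds hq)
  set ξ' : EG := chartDeriv φ (1 : G) ξ with hξ'
  have hactx : ∀ g x, (g, x) ∈ A.dom → ContMDiffAt 𝓘(ℝ, E) 𝓘(ℝ, E) ∞ (A.act g) x :=
    fun g x hgx ↦ (A.smooth.contMDiffAt (A.isOpen_dom.mem_nhds hgx)).comp x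
      (contMDiffAt_const.prodMk contMDiffAt_id)
  have hactg : ∀ g x, (g, x) ∈ A.dom → ContMDiffAt 𝓘(ℝ, EG) 𝓘(ℝ, E) ∞ (fun g ↦ A.act g x) g :=
    fun g x hgx ↦ (A.smooth.contMDiffAt (A.isOpen_dom.mem_nhds hgx)).comp g
      (contMDiffAt_id.prodMk contMDiffAt_const)
  refine ⟨fun z ↦ fderiv ℝ Ψ (φ 1, z) (ξ', 0), ?_, ?_, ?_⟩
  · refine ContDiffOn.clm_apply ?_ contDiffOn_const
    exact (hΨ.fderiv_of_isOpen hD (by simp)).comp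
      (contDiff_const.prodMk contDiff_id).contDiffOn hmem
  · intro x hx
    have h1 : fderiv ℝ (e ∘ (fun g ↦ A.act g x) ∘ φ.symm) (φ 1) (chartDeriv φ (1 : G) ξ) =
        chartDeriv e (A.act 1 x) (mfderiv 𝓘(ℝ, EG) 𝓘(ℝ, E) (fun g ↦ A.act g x) 1 ξ) :=
      fderiv_written_in_charts he hφ h1φ (by rw [A.one_act]; exact hx) (hactg 1 x (A.one_mem x)) ξ
    have hcast : ∀ x', x' = x → ∀ v : E, (chartDeriv e x' : E →L[ℝ] E) v =
        (chartDeriv e x : E →L[ℝ] E) v := by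
      rintro _ rfl v; rfl
    refine (hcast _ (A.one_act x) _).symm.trans (h1.symm.trans ?_)
    have hd := (hΨa _ (hmem _ (e.map_source hx))).differentiableAt (by simp)
    have h2 := HasFDerivAt.comp (φ 1) hd.hasFDerivAt (hasFDerivAt_prodMk_left (𝕜 := ℝ) (φ 1) (e x))
    have h3 : (e ∘ (fun g ↦ A.act g x) ∘ φ.symm) = Ψ ∘ fun u ↦ (u, e x) := by
      funext u
      simp only [Function.comp_apply, Ψ, e.left_inv hx]
    rw [h3, h2.fderiv]
    simp [hξ']
  · intro hA O a ha z hz w hw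
    have hzt := ha.subset hz
    have hD0 := hmem z hzt
    refine lie_derivative_apply_eq_zero (hΨa _ hD0)
      (Filter.eventually_of_mem (e.open_target.mem_nhds hzt) hid) (ha.differentiableAt hz) ?_
    have hc : Filter.Tendsto (fun u : EG ↦ (u, z)) (𝓝 (φ 1)) (𝓝 (φ 1, z)) :=
      (Continuous.prodMk_left z).tendsto _
    have hO : ∀ᶠ q in 𝓝 (φ 1, z), Ψ q ∈ O := (hΨa _ hD0).continuousAt
      (by rw [hid z hzt]; exact ha.isOpen.mem_nhds hz)
    filter_upwards [hc.eventually (hD.mem_nhds hD0), hc.eventually hO] with u hu hO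
    have hu' := hu
    obtain ⟨⟨-, hdom⟩, hsrc⟩ := hu'
    have hes := e.map_target hzt
    have hr := e.right_inv hzt
    obtain ⟨v, hv⟩ := chartDeriv_surjective he hes w
    have h1 := fderiv_written_in_charts he he hes hsrc (hactx _ _ hdom) v
    have hvC := (ha.mem_iff _ hes (hr.symm ▸ hz) v).2 (by rw [hr, hv]; exact hw)
    have h2 := (ha.mem_iff _ hsrc hO _).1 (hA _ _ hdom v hvC)
    rw [← h1, hv, hr] at h2
    have h3 := HasFDerivAt.comp z ((hΨa _ hu).differentiableAt (by simp)).hasFDerivAt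
      (hasFDerivAt_prodMk_right u z)
    have h4 : fderiv ℝ (e ∘ A.act (φ.symm u) ∘ e.symm) z w = fderiv ℝ Ψ (u, z) (0, w) := by
      have h5 : (e ∘ A.act (φ.symm u) ∘ e.symm) = Ψ ∘ fun y ↦ (u, y) := rfl
      rw [h5, h3.fderiv]
      simp
    rw [← h4]
    exact h2

end Actions

/-! ### The contact Noether theorem. -/

section Noether

variable {EG : Type*} [NormedAddCommGroup EG] [NormedSpace ℝ EG]
  {G : Type*} [TopologicalSpace G] [ChartedSpace EG G] [Group G] [IsManifold 𝓘(ℝ, EG) ∞ G]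
  {E : Type*} [NormedAddCommGroup E] [NormedSpace ℝ E] [FiniteDimensional ℝ E]
  {M : Type*} [TopologicalSpace M] [ChartedSpace E M] [IsManifold 𝓘(ℝ, E) ∞ M]
  {C : ∀ x : M, Submodule ℝ (TangentSpace 𝓘(ℝ, E) x)}

/-- The left side is the derivative of `a(X)` along `v`. By invariance it equals `da(v, X)`, and
since `v` is characteristic only the component `a(X) / a(R)` of `X` along `R` contributes. -/
lemma IsCharVec.deriv_pairing {a : E → E →L[ℝ] ℝ} {X : E → E} {z v R : E} (hv : IsCharVec a z v)
    (hX : fderiv ℝ a z (X z) v + a z (fderiv ℝ X z v) = 0) (hR : a z R ≠ 0) :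
    fderiv ℝ a z v (X z) + a z (fderiv ℝ X z v) =
      (fderiv ℝ a z v R - fderiv ℝ a z R v) / a z R * a z (X z) := by
  have h := hv.2 (a z R • X z - a z (X z) • R) (by simp [mul_comm])
  simp only [map_sub, map_smul, smul_eq_mul, sub_apply, smul_apply] at h
  field_simp
  linear_combination h + (a z R) * hX

/-- Along a characteristic curve, the vanishing of the pairing of a form with an infinitesimal
symmetry of its kernel is locally constant. -/
lemma eventually_pairing_eq_zero_iff {a : E → E →L[ℝ] ℝ} {X : E → E} {O : Set E} (hO : IsOpen O)
    (ha : ContDiffOn ℝ ∞ a O) (hXs : ContDiffOn ℝ ∞ X O)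
    (hX : ∀ z ∈ O, ∀ w, a z w = 0 → fderiv ℝ a z (X z) w + a z (fderiv ℝ X z w) = 0)
    {c : ℝ → E} {t₀ : ℝ} (hc : ContDiffAt ℝ ∞ c t₀) (h0 : c t₀ ∈ O) (ha0 : a (c t₀) ≠ 0)
    (hK : ∀ᶠ t in 𝓝 t₀, DifferentiableAt ℝ c t ∧ IsCharVec a (c t) (deriv c t)) :
    ∀ᶠ t in 𝓝 t₀, (a (c t₀) (X (c t₀)) = 0 ↔ a (c t) (X (c t)) = 0) := by
  obtain ⟨R, hR⟩ := exists_apply_ne_zero ha0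
  have hc' : ContinuousAt (deriv c) t₀ := by
    have h1 : ContinuousAt (fderiv ℝ c) t₀ := (hc.fderiv_right (m := 0) (by simp)).continuousAt
    exact h1.clm_apply continuousAt_const
  have hac : ContinuousAt (fun t ↦ a (c t)) t₀ :=
    ContinuousAt.comp (g := a) (ha.continuousOn.continuousAt (hO.mem_nhds h0)) hc.continuousAt
  have haR := hac.clm_apply (continuousAt_const (y := R))
  -- The coefficient in `f' = μ f` for `f = a(X)`; by continuity it is bounded by `|μ t₀| + 1` near
  -- `t₀`, as Grönwall's inequality requires.
  let μ : ℝ → ℝ := fun t ↦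
    (fderiv ℝ a (c t) (deriv c t) R - fderiv ℝ a (c t) R (deriv c t)) / a (c t) R
  have hμ : ContinuousAt μ t₀ := by
    have h1 : ContinuousAt (fun t ↦ fderiv ℝ a (c t)) t₀ :=
      ContinuousAt.comp (g := fderiv ℝ a) ((ha.fderiv_of_isOpen (m := ∞) hO
        (by simp)).continuousOn.continuousAt (hO.mem_nhds h0)) hc.continuousAt
    exact (((h1.clm_apply hc').clm_apply continuousAt_const).sub
      ((h1.clm_apply continuousAt_const).clm_apply hc')).div haR hR
  have hn := (hK.and (hc.continuousAt (hO.mem_nhds h0))).and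
    ((hμ.abs.eventually (gt_mem_nhds (lt_add_one _))).and (haR.eventually_ne hR))
  obtain ⟨ε, hε, hball⟩ := Metric.mem_nhds_iff.1 hn
  rw [Real.ball_eq_Ioo] at hball
  have hf : ∀ t ∈ Ioo (t₀ - ε) (t₀ + ε),
      HasDerivAt (fun t ↦ a (c t) (X (c t))) (μ t * a (c t) (X (c t))) t := fun t ht ↦ by
    obtain ⟨⟨⟨hd, hv⟩, htO⟩, -, htR⟩ := hball ht
    have hX1 : DifferentiableAt ℝ X (c t) :=
      (hXs.contDiffAt (hO.mem_nhds htO)).differentiableAt (by simp)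
    have ha1 : DifferentiableAt ℝ a (c t) :=
      (ha.contDiffAt (hO.mem_nhds htO)).differentiableAt (by simp)
    have h2 := (ha1.hasFDerivAt.comp_hasDerivAt t hd.hasDerivAt).clm_apply
      (hX1.hasFDerivAt.comp_hasDerivAt t hd.hasDerivAt)
    exact h2.congr_deriv (hv.deriv_pairing (hX _ htO _ hv.1) htR)
  have hb : ∀ t ∈ Ioo (t₀ - ε) (t₀ + ε),
      |μ t * a (c t) (X (c t))| ≤ (|μ t₀| + 1) * |a (c t) (X (c t))| := fun t ht ↦ by
    rw [abs_mul]
    exact mul_le_mul_of_nonneg_right (hball ht).2.1.le (abs_nonneg _)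
  have h0 : t₀ ∈ Ioo (t₀ - ε) (t₀ + ε) := ⟨by linarith, by linarith⟩
  filter_upwards [isOpen_Ioo.mem_nhds h0] with t ht
  exact ⟨zero_iff_of_abs_deriv_le hf hb h0 ht, zero_iff_of_abs_deriv_le hf hb ht h0⟩

lemma LocalAction.Preserves.generator_mem_iff {A : LocalAction (EG := EG) G (E := E) M}
    (hA : A.Preserves C) (hC : IsHyperplaneField C) (ξ : GroupLieAlgebra 𝓘(ℝ, EG) G) {U : Set M}
    {γ : ℝ → M} {J : Set ℝ} (hγ : IsCurveIn (E := E) U γ J) (hK : IsCharacteristic C γ J)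
    {s t : ℝ} (hs : s ∈ J) (ht : t ∈ J) :
    A.generator (γ s) ξ ∈ C (γ s) ↔ A.generator (γ t) ξ ∈ C (γ t) := by
  refine hγ.isPreconnected.induction₂
    (fun s t ↦ (A.generator (γ s) ξ ∈ C (γ s) ↔ A.generator (γ t) ξ ∈ C (γ t))) ?_
    (fun _ _ _ _ _ _ ↦ Iff.trans) (fun _ _ _ _ ↦ Iff.symm) hs ht
  intro t₀ ht₀
  have he : chartAt E (γ t₀) ∈ IsManifold.maximalAtlas 𝓘(ℝ, E) ∞ M :=
    IsManifold.chart_mem_maximalAtlas _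
  have hxe := mem_chart_source E (γ t₀)
  generalize chartAt E (γ t₀) = e at he hxe
  obtain ⟨O, a, hxO, ha⟩ := hC.exists_coordForm he hxe
  obtain ⟨X, hXs, hX, hXa⟩ := A.exists_generator_coord (C := C) he ξ
  have hn : ∀ᶠ t in 𝓝 t₀, t ∈ J ∧ γ t ∈ e.source ∩ e ⁻¹' O :=
    Filter.inter_mem (hγ.1.mem_nhds ht₀) ((hγ.contMDiffAt ht₀).continuousAt
      ((e.isOpen_inter_preimage ha.isOpen).mem_nhds ⟨hxe, hxO⟩))
  have hmem : ∀ t, γ t ∈ e.source ∩ e ⁻¹' O →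
      (A.generator (γ t) ξ ∈ C (γ t) ↔ a ((e ∘ γ) t) (X ((e ∘ γ) t)) = 0) := by
    rintro t ⟨hts, htO⟩
    exact (ha.mem_iff _ hts htO _).trans (by rw [hX _ hts]; rfl)
  have key := eventually_pairing_eq_zero_iff ha.isOpen ha.smooth (hXs.mono ha.subset)
    (hXa hA O a ha) (contDiffAt_chart_comp_curve he (hγ.contMDiffAt ht₀) hxe) hxO
    (ha.ne_zero _ hxO) (hn.mono fun t ht ↦ by
      have h1 := hasDerivAt_chart_comp_curve he (hγ.contMDiffAt ht.1) ht.2.1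
      refine ⟨h1.differentiableAt, ?_⟩
      rw [h1.deriv]
      exact (ha.mem_charSpace_iff he ht.2.1 ht.2.2 _).1 (hK t ht.1))
  refine Filter.Eventually.filter_mono nhdsWithin_le_nhds ?_
  filter_upwards [hn, key] with t ht h
  exact (hmem t₀ ⟨hxe, hxO⟩).trans (h.trans (hmem t ht.2).symm)

/-- The contact Noether theorem. -/
theorem LocalAction.Preserves.lie_eq {A : LocalAction (EG := EG) G (E := E) M}
    (hA : A.Preserves C) (hC : IsHyperplaneField C) {U : Set M} {x y : M} (hy : y ∈ leaf C U x) :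
    A.lie C y = A.lie C x := by
  obtain ⟨γ, J, h1, h2, s, hs, t, ht, rfl, rfl⟩ := hy
  ext ξ
  exact hA.generator_mem_iff hC ξ h1 h2 ht hs

end Noether

/-! ### Descent of a field along a submersion with connected fibres in characteristic directions. -/

section Quotient

variable {E : Type*} [NormedAddCommGroup E] [NormedSpace ℝ E] [FiniteDimensional ℝ E]
  {N : Type*} [TopologicalSpace N] [ChartedSpace E N] [IsManifold 𝓘(ℝ, E) ∞ N]
  {F : Type*} [NormedAddCommGroup F] [NormedSpace ℝ F] [FiniteDimensional ℝ F]
  {Q : Type*} [TopologicalSpace Q] [ChartedSpace F Q] [IsManifold 𝓘(ℝ, F) ∞ Q]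
  {D : ∀ x : N, Submodule ℝ (TangentSpace 𝓘(ℝ, E) x)} {p : N → Q}

lemma charSpace_le (D : ∀ x : N, Submodule ℝ (TangentSpace 𝓘(ℝ, E) x)) (x : N) :
    charSpace D x ≤ D x := by
  rintro _ ⟨V, ⟨W, -, hx, -, hV⟩, rfl, -⟩
  exact hV x hx

/-- In a submersion chart two nearby points of a fibre are joined by a segment in a vertical, hence
characteristic, direction; `ker_transport` along it carries one hyperplane to the other. -/
lemma eventually_proj_eq (hD : IsHyperplaneField D) {n : N}
    (hsub : IsSubmersionAt 𝓘(ℝ, E) 𝓘(ℝ, F) ∞ p n)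
    (hker : ∀ x v, mfderiv 𝓘(ℝ, E) 𝓘(ℝ, F) p x v = 0 → v ∈ charSpace D x) :
    ∀ᶠ n' in 𝓝 n, p n = p n' → proj (F := F) D p n = proj D p n' := by
  obtain ⟨e, e', L, O, a, h, hne, hnO, -⟩ := exists_fibredForm (U := univ) hD isOpen_univ
    (fun x _ v hv ↦ charSpace_le D x (hker x v hv)) (mem_univ n) hsub
  obtain ⟨ε, hε, hball⟩ := Metric.isOpen_iff.1 h.form.isOpen _ hnO
  filter_upwards [e.open_source.mem_nhds hne,
    e.continuousAt hne (Metric.ball_mem_nhds (e n) hε)] with n' hn' hn'ε hp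
  rw [h.proj_eq_iff hne hnO hn' (hball hn'ε)]
  refine ⟨hp, fun w ↦ ?_⟩
  set v := e n' - e n with hv
  have hLv : L v = 0 := by
    rw [hv, map_sub, ← (h.written _ hn').2.1, ← (h.written _ hne).2.1, hp, sub_self]
  have hc : ∀ t : ℝ, HasDerivAt (fun t : ℝ ↦ e n + t • v) v t := fun t ↦ by
    simpa using ((hasDerivAt_id t).smul_const v).const_add (e n)
  have hJo : IsOpen ((fun t : ℝ ↦ e n + t • v) ⁻¹' Metric.ball (e n) ε) :=
    Metric.isOpen_ball.preimage (by fun_prop)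
  have hJ := ordConnected_preimage_ball (e n) v (e n) ε
  have key := ker_transport (β := fun t : ℝ ↦ a (e n + t • v))
    (β' := fun t : ℝ ↦ fderiv ℝ a (e n + t • v) v) hJo hJ
    (fun t ht ↦ (h.form.differentiableAt (hball ht)).hasFDerivAt.comp_hasDerivAt t (hc t))
    (fun t ht ↦ h.form.ne_zero _ (hball ht)) (fun t ht w hw ↦ by
      have hzO := hball ht
      have hr := e.right_inv (h.form.subset hzO)
      have hs := e.map_target (h.form.subset hzO)
      obtain ⟨u, hu⟩ := chartDeriv_surjective h.mem_atlas hs v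
      have h1 : mfderiv 𝓘(ℝ, E) 𝓘(ℝ, F) p _ u = 0 :=
        chartDeriv_injective h.mem_atlas' (h.written _ hs).1
          (by rw [(h.written _ hs).2.2.2, hu, hLv, map_zero])
      have h2 := (h.form.mem_charSpace_iff h.mem_atlas hs (hr.symm ▸ hzO) u).1 (hker _ u h1)
      rw [hr, hu] at h2
      rw [h2.2 w hw, h.fderiv_eq_zero hzO hLv])
    (s := 0) (t := 1) (by simpa using hε) (by simpa [hv] using hn'ε) w
  simpa [hv] using key

lemma proj_eq_of_fibre (hD : IsHyperplaneField D) (hsub : IsSubmersion 𝓘(ℝ, E) 𝓘(ℝ, F) ∞ p)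
    (hker : ∀ x v, mfderiv 𝓘(ℝ, E) 𝓘(ℝ, F) p x v = 0 → v ∈ charSpace D x)
    (hconn : ∀ q, IsConnected (p ⁻¹' {q})) {n n' : N} (h : p n = p n') :
    proj (F := F) D p n = proj D p n' := by
  refine (hconn (p n')).isPreconnected.induction₂ (fun n n' ↦ proj (F := F) D p n = proj D p n') ?_
    (fun _ _ _ _ _ _ ↦ Eq.trans) (fun _ _ _ _ ↦ Eq.symm) h rfl
  intro x hx
  filter_upwards [self_mem_nhdsWithin, Filter.Eventually.filter_mono nhdsWithin_le_nhds
    (eventually_proj_eq hD (hsub.isSubmersionAt x) hker)] with y hy h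
  exact h (hx.trans hy.symm)

/-- The field on the base obtained by projecting a field on the total space. -/
def quotientField (D : ∀ x : N, Submodule ℝ (TangentSpace 𝓘(ℝ, E) x)) (p : N → Q) (q : Q) :
    Submodule ℝ (TangentSpace 𝓘(ℝ, F) q) :=
  sSup {S | ∃ n : N, proj (F := F) D p n = ⟨q, S⟩}

/-- The supremum defining `quotientField` is over a single subspace, because all points of the fibre
have the same projection. -/
lemma proj_eq_quotientField
    (hproj : ∀ n n', p n = p n' → proj (F := F) D p n = proj D p n') (n : N) :
    proj D p n = ⟨p n, quotientField (F := F) D p (p n)⟩ := by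
  set S₀ : Submodule ℝ (TangentSpace 𝓘(ℝ, F) (p n)) :=
    (D n).map (mfderiv 𝓘(ℝ, E) 𝓘(ℝ, F) p n : TangentSpace 𝓘(ℝ, E) n →ₗ[ℝ] _)
  have h0 : proj (F := F) D p n = ⟨p n, S₀⟩ := rfl
  have h : {S | ∃ n' : N, proj (F := F) D p n' = ⟨p n, S⟩} = {S₀} := by
    ext S
    constructor
    · rintro ⟨n', hn'⟩
      have h1 : p n = p n' := (congrArg Sigma.fst hn').symm
      have h2 : (⟨p n, S₀⟩ : Σ q : Q, Submodule ℝ (TangentSpace 𝓘(ℝ, F) q)) = ⟨p n, S⟩ :=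
        (hproj n n' h1).trans hn'
      exact (eq_of_heq (Sigma.mk.inj h2).2).symm
    · rintro rfl
      exact ⟨n, h0⟩
  rw [quotientField, h, sSup_singleton, h0]

lemma mem_quotientField_iff (hproj : ∀ n n', p n = p n' → proj (F := F) D p n = proj D p n')
    (hker : ∀ x v, mfderiv 𝓘(ℝ, E) 𝓘(ℝ, F) p x v = 0 → v ∈ D x) (n : N)
    (v : TangentSpace 𝓘(ℝ, E) n) :
    mfderiv 𝓘(ℝ, E) 𝓘(ℝ, F) p n v ∈ quotientField (F := F) D p (p n) ↔ v ∈ D n := by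
  have h : (D n).map (mfderiv 𝓘(ℝ, E) 𝓘(ℝ, F) p n : TangentSpace 𝓘(ℝ, E) n →ₗ[ℝ] _) =
      quotientField (F := F) D p (p n) := eq_of_heq (Sigma.mk.inj (proj_eq_quotientField hproj n)).2
  rw [← h]
  constructor
  · rintro ⟨v', hv', hvv'⟩
    have := (D n).add_mem hv' (hker n (v - v') (by
      have h1 : mfderiv 𝓘(ℝ, E) 𝓘(ℝ, F) p n v' = mfderiv 𝓘(ℝ, E) 𝓘(ℝ, F) p n v := hvv'
      rw [map_sub, h1, sub_self]))
    rwa [add_sub_cancel] at this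
  · exact fun hv ↦ ⟨v, hv, rfl⟩

/-- As `D` contains the vertical directions, it is the full preimage of its projection. This lets
the results on cut fields compare characteristic directions upstairs and downstairs. -/
lemma cut_quotientField (hproj : ∀ n n', p n = p n' → proj (F := F) D p n = proj D p n')
    (hker : ∀ x v, mfderiv 𝓘(ℝ, E) 𝓘(ℝ, F) p x v = 0 → v ∈ D x) :
    cut (F := E) (quotientField (F := F) D p) p = D := by
  funext n
  ext v
  exact mem_quotientField_iff hproj hker n v

lemma isHyperplaneField_quotientField (hD : IsHyperplaneField D)
    (hsub : IsSubmersion 𝓘(ℝ, E) 𝓘(ℝ, F) ∞ p) (hsurj : Function.Surjective p)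
    (hproj : ∀ n n', p n = p n' → proj (F := F) D p n = proj D p n')
    (hker : ∀ x v, mfderiv 𝓘(ℝ, E) 𝓘(ℝ, F) p x v = 0 → v ∈ D x) :
    IsHyperplaneField (quotientField (F := F) D p) := by
  refine isHyperplaneField_of_coordForm fun q ↦ ?_
  obtain ⟨n, rfl⟩ := hsurj q
  obtain ⟨e, e', L, O, a, h, hne, hnO, s, hs⟩ := exists_fibredForm (U := univ) hD isOpen_univ
    (fun x _ v hv ↦ hker x v hv) (mem_univ n) (hsub.isSubmersionAt n)
  -- A section of `L` through `e n`; the form downstairs is the pullback of `a` by it.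
  let σ : F → E := fun y ↦ e n + s (y - L (e n))
  have hσ : ContDiff ℝ ∞ σ := contDiff_const.add (s.contDiff.comp (contDiff_id.sub contDiff_const))
  have hLσ : ∀ y, L (σ y) = y := fun y ↦ by simp [σ, hs]
  have hσn : σ (e' (p n)) = e n := by simp [σ, (h.written n hne).2.1]
  refine ⟨e', h.mem_atlas', e'.target ∩ σ ⁻¹' O, fun y ↦ (a (σ y)).comp s, (h.written n hne).1,
    ⟨e'.map_source (h.written n hne).1, by rwa [mem_preimage, hσn]⟩,
    e'.open_target.inter (h.form.isOpen.preimage hσ.continuous), inter_subset_left, ?_, ?_, ?_⟩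
  · exact (h.form.smooth.comp hσ.contDiffOn fun y hy ↦ hy.2).clm_comp contDiffOn_const
  · intro y hy h0
    refine h.form.ne_zero _ hy.2 (ContinuousLinearMap.ext fun v ↦ ?_)
    have h1 := h.ker _ hy.2 (v - s (L v)) (by rw [map_sub, hs, sub_self])
    have h2 : a (σ y) (s (L v)) = 0 := DFunLike.congr_fun h0 (L v)
    rw [map_sub, h2, sub_zero] at h1
    exact h1
  · intro q hq hqO u
    have hr := e.right_inv (h.form.subset hqO.2)
    have hes := e.map_target (h.form.subset hqO.2)
    obtain ⟨h1, h2, -, h3⟩ := h.written _ hes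
    have hpq : p (e.symm (σ (e' q))) = q := e'.injOn h1 hq (by rw [h2, hr, hLσ])
    have key : ∀ q', p (e.symm (σ (e' q))) = q' → ∀ u : TangentSpace 𝓘(ℝ, F) q',
        (u ∈ quotientField (F := F) D p q' ↔
          a (σ (e' q)) (s (chartDeriv e' q' u)) = 0) := by
      rintro _ rfl u
      obtain ⟨v, hv⟩ := chartDeriv_surjective h.mem_atlas hes (s (chartDeriv e' _ u))
      have h4 : mfderiv 𝓘(ℝ, E) 𝓘(ℝ, F) p _ v = u :=
        chartDeriv_injective h.mem_atlas' h1 (by rw [h3, hv, hs])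
      rw [← hv, ← h4, mem_quotientField_iff hproj hker,
        h.form.mem_iff _ hes (hr.symm ▸ hqO.2), hr]
    exact key q hpq u

end Quotient

/-! ### Images of curves and lifts through an embedding. -/

section Pushforward

variable {E : Type*} [NormedAddCommGroup E] [NormedSpace ℝ E] [FiniteDimensional ℝ E]
  {M : Type*} [TopologicalSpace M] [ChartedSpace E M] [IsManifold 𝓘(ℝ, E) ∞ M]
  {F : Type*} [NormedAddCommGroup F] [NormedSpace ℝ F] [FiniteDimensional ℝ F]
  {N : Type*} [TopologicalSpace N] [ChartedSpace F N] [IsManifold 𝓘(ℝ, F) ∞ N]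

lemma velocity_congr {γ γ' : ℝ → M} {t : ℝ} (h : γ =ᶠ[𝓝 t] γ') :
    (⟨γ t, mfderiv 𝓘(ℝ, ℝ) 𝓘(ℝ, E) γ t (1 : ℝ)⟩ : TangentBundle 𝓘(ℝ, E) M) =
      ⟨γ' t, mfderiv 𝓘(ℝ, ℝ) 𝓘(ℝ, E) γ' t (1 : ℝ)⟩ := by
  have key : ∀ y y' : M, y = y' → ∀ w w' : E, w = w' →
      (⟨y, w⟩ : TangentBundle 𝓘(ℝ, E) M) = ⟨y', w'⟩ := by
    rintro y _ rfl w _ rfl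
    rfl
  have h1 : (mfderiv 𝓘(ℝ, ℝ) 𝓘(ℝ, E) γ t : ℝ →L[ℝ] E) = mfderiv 𝓘(ℝ, ℝ) 𝓘(ℝ, E) γ' t :=
    h.mfderiv_eq
  exact key _ _ h.eq_of_nhds _ _ (DFunLike.congr_fun h1 1)

lemma IsCurveIn.map {f : N → M} (hf : ContMDiff 𝓘(ℝ, F) 𝓘(ℝ, E) ∞ f) {U : Set N} {δ : ℝ → N}
    {J : Set ℝ} (h : IsCurveIn (E := F) U δ J) :
    IsCurveIn (E := E) univ (f ∘ δ) J ∧ ∀ t ∈ J,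
      mfderiv 𝓘(ℝ, ℝ) 𝓘(ℝ, E) (f ∘ δ) t (1 : ℝ) =
        mfderiv 𝓘(ℝ, F) 𝓘(ℝ, E) f (δ t) (mfderiv 𝓘(ℝ, ℝ) 𝓘(ℝ, F) δ t (1 : ℝ)) := by
  refine ⟨⟨h.1, h.2.1, hf.comp_contMDiffOn h.2.2.1, fun _ _ ↦ mem_univ _⟩, fun t ht ↦ ?_⟩
  rw [mfderiv_comp t (hf.mdifferentiable (by simp) _)
    ((h.contMDiffAt ht).mdifferentiableAt (by simp))]
  rfl

/-- Curves in the image of an embedding lift. -/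
lemma exists_lift_of_isSmoothEmbedding {f : N → M}
    (hf : IsSmoothEmbedding 𝓘(ℝ, F) 𝓘(ℝ, E) ∞ f) {U : Set M} {γ : ℝ → M} {J : Set ℝ}
    (hγ : IsCurveIn (E := E) U γ J) (hr : ∀ t ∈ J, γ t ∈ range f) {s : ℝ} (hs : s ∈ J) :
    ∃ δ : ℝ → N, IsCurveIn (E := F) univ δ J ∧ ∀ t ∈ J, f (δ t) = γ t := by
  classical
  obtain ⟨n₀, -⟩ := hr s hs
  let δ : ℝ → N := fun t ↦ if h : γ t ∈ range f then h.choose else n₀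
  have hδ : ∀ t ∈ J, f (δ t) = γ t := fun t ht ↦ by
    simp only [δ, dif_pos (hr t ht)]
    exact (hr t ht).choose_spec
  have hc : ContinuousOn δ J := by
    rw [hf.isEmbedding.isInducing.continuousOn_iff]
    exact hγ.2.2.1.continuousOn.congr hδ
  refine ⟨δ, ⟨hγ.1, hγ.2.1, fun t ht ↦ ContMDiffAt.contMDiffWithinAt ?_, fun _ _ ↦ mem_univ _⟩, hδ⟩
  rw [ContMDiffAt.iff_comp_isImmersionAt (hf.isImmersion.isImmersionAt (δ t))]
  refine ⟨hc.continuousAt (hγ.1.mem_nhds ht), (hγ.contMDiffAt ht).congr_of_eventuallyEq ?_⟩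
  filter_upwards [hγ.1.mem_nhds ht] with τ hτ using hδ τ hτ

end Pushforward

/-! ### Reduced spaces and their characteristics. -/

section Reduction

variable {EG : Type*} [NormedAddCommGroup EG] [NormedSpace ℝ EG]
  {G : Type*} [TopologicalSpace G] [ChartedSpace EG G] [Group G] [IsManifold 𝓘(ℝ, EG) ∞ G]
  {E : Type*} [NormedAddCommGroup E] [NormedSpace ℝ E] [FiniteDimensional ℝ E]
  {M : Type*} [TopologicalSpace M] [ChartedSpace E M] [IsManifold 𝓘(ℝ, E) ∞ M]
  {C : ∀ x : M, Submodule ℝ (TangentSpace 𝓘(ℝ, E) x)}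
  {EN : Type*} [NormedAddCommGroup EN] [NormedSpace ℝ EN] [FiniteDimensional ℝ EN]
  {N : Type*} [TopologicalSpace N] [ChartedSpace EN N] [IsManifold 𝓘(ℝ, EN) ∞ N]
  {EQ : Type*} [NormedAddCommGroup EQ] [NormedSpace ℝ EQ] [FiniteDimensional ℝ EQ]
  {Q : Type*} [TopologicalSpace Q] [ChartedSpace EQ Q] [IsManifold 𝓘(ℝ, EQ) ∞ Q]
  {A : LocalAction (EG := EG) G (E := E) M} {l : Submodule ℝ (GroupLieAlgebra 𝓘(ℝ, EG) G)}
  {ι : N → M} {p : N → Q}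

/-- Differentiating `a(X) = 0` along `h` and subtracting the invariance identity leaves `da(X, dh w)
= 0` for `dh w ∈ ker a`. -/
lemma fderiv_pairing_eq {a : E → E →L[ℝ] ℝ} {X : E → E} {h : EN → E} {z : EN}
    (ha : DifferentiableAt ℝ a (h z)) (hX : DifferentiableAt ℝ X (h z))
    (hh : DifferentiableAt ℝ h z) (h0 : ∀ᶠ y in 𝓝 z, a (h y) (X (h y)) = 0)
    (hinv : ∀ w, a (h z) w = 0 → fderiv ℝ a (h z) (X (h z)) w + a (h z) (fderiv ℝ X (h z) w) = 0)
    {w : EN} (hw : a (h z) (fderiv ℝ h z w) = 0) :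
    fderiv ℝ a (h z) (X (h z)) (fderiv ℝ h z w) =
      fderiv ℝ a (h z) (fderiv ℝ h z w) (X (h z)) := by
  have h1 := (ha.hasFDerivAt.comp z hh.hasFDerivAt).clm_apply
    (hX.hasFDerivAt.comp z hh.hasFDerivAt)
  have h2 := h1.unique ((hasFDerivAt_const (0 : ℝ) z).congr_of_eventuallyEq h0)
  have h3 := DFunLike.congr_fun h2 w
  simp at h3
  linarith [hinv _ hw]

/-- The directions of the symmetries tangent to a level are characteristic for the field cut on the
level. -/
lemma mem_charSpace_cut_of_generator (hC : IsHyperplaneField C) (hA : A.Preserves C)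
    (hι : ContMDiff 𝓘(ℝ, EN) 𝓘(ℝ, E) ∞ ι) (hcut : ∀ n, cut (F := EN) C ι n ≠ ⊤)
    {ξ : GroupLieAlgebra 𝓘(ℝ, EG) G} (hξ : ∀ n, A.generator (ι n) ξ ∈ C (ι n)) {n : N}
    {v : TangentSpace 𝓘(ℝ, EN) n}
    (hv : mfderiv 𝓘(ℝ, EN) 𝓘(ℝ, E) ι n v = A.generator (ι n) ξ) :
    v ∈ charSpace (cut (F := EN) C ι) n := by
  have he : chartAt E (ι n) ∈ IsManifold.maximalAtlas 𝓘(ℝ, E) ∞ M :=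
    IsManifold.chart_mem_maximalAtlas _
  have hs := mem_chart_source E (ι n)
  generalize chartAt E (ι n) = e at he hs
  have he' : chartAt EN n ∈ IsManifold.maximalAtlas 𝓘(ℝ, EN) ∞ N :=
    IsManifold.chart_mem_maximalAtlas _
  have hns := mem_chart_source EN n
  generalize chartAt EN n = e' at he' hns
  obtain ⟨O, a, hO, ha⟩ := hC.exists_coordForm he hs
  obtain ⟨X, hXs, hX, hXa⟩ := A.exists_generator_coord (C := C) he ξ
  rw [ha.mem_charSpace_cut_iff he hι hcut hs hO]
  have hvC : v ∈ cut (F := EN) C ι n := by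
    have h1 : mfderiv 𝓘(ℝ, EN) 𝓘(ℝ, E) ι n v ∈ C (ι n) := by rw [hv]; exact hξ n
    exact h1
  refine ⟨hvC, fun w hw ↦ ?_⟩
  have hh := (contDiffAt_written_in_charts he he' hns hs hι.contMDiffAt).differentiableAt
    (n := ∞) (by simp)
  have hz : (e ∘ ι ∘ e'.symm) (e' n) = e (ι n) := by simp [e'.left_inv hns]
  have hw' := fderiv_written_in_charts he he' hns hs hι.contMDiffAt w
  have h0 : ∀ᶠ y in 𝓝 (e' n), a ((e ∘ ι ∘ e'.symm) y) (X ((e ∘ ι ∘ e'.symm) y)) = 0 := by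
    have h1 : ∀ᶠ m in 𝓝 n, ι m ∈ e.source ∩ e ⁻¹' O := hι.continuous.continuousAt
      ((e.isOpen_inter_preimage ha.isOpen).mem_nhds ⟨hs, hO⟩)
    have h2 : Filter.Tendsto e'.symm (𝓝 (e' n)) (𝓝 n) := by
      have := e'.continuousAt_symm (e'.map_source hns)
      rwa [ContinuousAt, e'.left_inv hns] at this
    filter_upwards [h2.eventually h1] with y hy
    have h3 := (ha.mem_iff _ hy.1 hy.2 _).1 (hξ (e'.symm y))
    rw [hX _ hy.1] at h3
    exact h3
  have h4 := (ha.mem_iff _ hs hO _).1 hw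
  have key := fderiv_pairing_eq (h := e ∘ ι ∘ e'.symm) (z := e' n) (X := X) (a := a)
    (by rw [hz]; exact ha.differentiableAt hO)
    (by rw [hz]; exact (hXs.contDiffAt (e.open_target.mem_nhds (ha.subset hO))).differentiableAt
          (by simp)) hh h0 (by rw [hz]; exact hXa hA O a ha _ hO) (w := chartDeriv e' n w)
    (by rw [hz, hw']; exact h4)
  rw [hz, hw', ← hX _ hs, ← hv] at key
  exact key

namespace IsReduction

lemma cut_ne_top (h : IsReduction (EN := EN) (EQ := EQ) A C l ι p) (n : N) :
    cut (F := EN) C ι n ≠ ⊤ := (h.hyperplane n).1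

lemma contMDiff (h : IsReduction (EN := EN) (EQ := EQ) A C l ι p) :
    ContMDiff 𝓘(ℝ, EN) 𝓘(ℝ, E) ∞ ι := h.embedding.contMDiff

lemma mem_charSpace_of_mfderiv_eq_zero (h : IsReduction (EN := EN) (EQ := EQ) A C l ι p)
    (hC : IsHyperplaneField C) (hA : A.Preserves C) (n : N) (v : TangentSpace 𝓘(ℝ, EN) n)
    (hv : mfderiv 𝓘(ℝ, EN) 𝓘(ℝ, EQ) p n v = 0) : v ∈ charSpace (cut (F := EN) C ι) n := by
  obtain ⟨ξ, hξ, hξv⟩ : mfderiv 𝓘(ℝ, EN) 𝓘(ℝ, E) ι n v ∈ A.generator (ι n) '' isotropy l :=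
    (h.orbits n).subset ⟨v, hv, rfl⟩
  refine mem_charSpace_cut_of_generator hC hA h.contMDiff h.cut_ne_top (ξ := ξ) (fun m ↦ ?_)
    hξv.symm
  have h1 : A.lie C (ι m) = l := h.range_eq.subset (mem_range_self m)
  have h2 : ξ ∈ A.lie C (ι m) := h1.symm ▸ hξ.1
  exact h2

lemma mem_cut_of_mfderiv_eq_zero (h : IsReduction (EN := EN) (EQ := EQ) A C l ι p)
    (hC : IsHyperplaneField C) (hA : A.Preserves C) (n : N) (v : TangentSpace 𝓘(ℝ, EN) n)
    (hv : mfderiv 𝓘(ℝ, EN) 𝓘(ℝ, EQ) p n v = 0) : v ∈ cut (F := EN) C ι n :=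
  charSpace_le _ _ (h.mem_charSpace_of_mfderiv_eq_zero hC hA n v hv)

lemma isHyperplaneField_cut (h : IsReduction (EN := EN) (EQ := EQ) A C l ι p)
    (hC : IsHyperplaneField C) : IsHyperplaneField (cut (F := EN) C ι) :=
  ContactRed.isHyperplaneField_cut hC h.contMDiff h.cut_ne_top

lemma proj_eq_of_fibre (h : IsReduction (EN := EN) (EQ := EQ) A C l ι p)
    (hC : IsHyperplaneField C) (hA : A.Preserves C) (n n' : N) (hn : p n = p n') :
    proj (F := EQ) (cut (F := EN) C ι) p n = proj (cut (F := EN) C ι) p n' :=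
  ContactRed.proj_eq_of_fibre (h.isHyperplaneField_cut hC) h.submersion
    (h.mem_charSpace_of_mfderiv_eq_zero hC hA) h.connected hn

lemma proj_eq_reducedField (h : IsReduction (EN := EN) (EQ := EQ) A C l ι p)
    (hC : IsHyperplaneField C) (hA : A.Preserves C) (n : N) :
    proj (F := EQ) (cut (F := EN) C ι) p n = ⟨p n, reducedField (EN := EN) C ι p (p n)⟩ :=
  proj_eq_quotientField (h.proj_eq_of_fibre hC hA) n

lemma isHyperplaneField_reducedField (h : IsReduction (EN := EN) (EQ := EQ) A C l ι p)
    (hC : IsHyperplaneField C) (hA : A.Preserves C) :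
    IsHyperplaneField (reducedField (EN := EN) (EQ := EQ) C ι p) :=
  isHyperplaneField_quotientField (h.isHyperplaneField_cut hC) h.submersion h.surjective
    (h.proj_eq_of_fibre hC hA) (h.mem_cut_of_mfderiv_eq_zero hC hA)

lemma cut_reducedField (h : IsReduction (EN := EN) (EQ := EQ) A C l ι p)
    (hC : IsHyperplaneField C) (hA : A.Preserves C) :
    cut (F := EN) (reducedField (EN := EN) (EQ := EQ) C ι p) p = cut C ι :=
  cut_quotientField (h.proj_eq_of_fibre hC hA) (h.mem_cut_of_mfderiv_eq_zero hC hA)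

/-- Characteristic for `C` implies characteristic for `C'`, by restriction of test vectors; and `C'`
is the cut of `C_𝔩` along the submersion `p`, so `dp` preserves the property. -/
lemma mfderiv_mem_charSpace_reducedField (h : IsReduction (EN := EN) (EQ := EQ) A C l ι p)
    (hC : IsHyperplaneField C) (hA : A.Preserves C) {n : N} {v : TangentSpace 𝓘(ℝ, EN) n}
    (hv : mfderiv 𝓘(ℝ, EN) 𝓘(ℝ, E) ι n v ∈ charSpace C (ι n)) :
    mfderiv 𝓘(ℝ, EN) 𝓘(ℝ, EQ) p n v ∈
      charSpace (reducedField (EN := EN) (EQ := EQ) C ι p) (p n) := by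
  have h1 := mem_charSpace_cut_of_mfderiv_mem hC h.contMDiff h.cut_ne_top hv
  have hcut := h.cut_reducedField hC hA
  refine mfderiv_mem_charSpace_of_surjective (h.isHyperplaneField_reducedField hC hA)
    h.submersion.contMDiff (fun n ↦ ?_)
    (IsSubmersionAt.mfderiv_surjective (h.submersion.isSubmersionAt n)) ?_
  · rw [hcut]; exact h.cut_ne_top n
  · rw [hcut]; exact h1

/-- Characteristic curves meeting the level lift to it. -/
lemma exists_lift (h : IsReduction (EN := EN) (EQ := EQ) A C l ι p)
    (hC : IsHyperplaneField C) (hA : A.Preserves C) {n : N} {γ : ℝ → M} {J : Set ℝ} {s : ℝ}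
    (hγ : IsCurveIn (E := E) univ γ J) (hK : IsCharacteristic C γ J) (hs : s ∈ J)
    (hn : γ s = ι n) : ∃ δ : ℝ → N, IsCurveIn (E := EN) univ δ J ∧ δ s = n ∧
      (∀ t ∈ J, ι (δ t) = γ t) ∧ ∀ t ∈ J,
        mfderiv 𝓘(ℝ, EN) 𝓘(ℝ, E) ι (δ t) (mfderiv 𝓘(ℝ, ℝ) 𝓘(ℝ, EN) δ t (1 : ℝ)) ∈
          charSpace C (ι (δ t)) ∧
        (⟨ι (δ t), mfderiv 𝓘(ℝ, EN) 𝓘(ℝ, E) ι (δ t) (mfderiv 𝓘(ℝ, ℝ) 𝓘(ℝ, EN) δ t (1 : ℝ))⟩ :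
          TangentBundle 𝓘(ℝ, E) M) = ⟨γ t, mfderiv 𝓘(ℝ, ℝ) 𝓘(ℝ, E) γ t (1 : ℝ)⟩ := by
  -- The Noether theorem keeps the curve in the level.
  have hr : ∀ t ∈ J, γ t ∈ range ι := fun t ht ↦ by
    have h1 : A.lie C (γ t) = A.lie C (γ s) :=
      hA.lie_eq hC ⟨γ, J, hγ, hK, s, hs, t, ht, rfl, rfl⟩
    rw [h.range_eq]
    have h2 : A.lie C (ι n) = l := h.range_eq.subset (mem_range_self n)
    exact h1.trans (by rw [hn, h2])
  obtain ⟨δ, hδ, hιδ⟩ := exists_lift_of_isSmoothEmbedding h.embedding hγ hr hs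
  refine ⟨δ, hδ, h.embedding.isEmbedding.injective ((hιδ s hs).trans hn), hιδ, fun t ht ↦ ?_⟩
  have heq : ι ∘ δ =ᶠ[𝓝 t] γ := by
    filter_upwards [hγ.1.mem_nhds ht] with τ hτ using hιδ τ hτ
  have h1 := (hδ.map h.contMDiff).2 t ht
  have h2 := (velocity_mem_congr heq (charSpace C)).2 (hK t ht)
  have h3 := velocity_congr (E := E) heq
  rw [h1] at h2 h3
  exact ⟨h2, h3⟩

lemma leaf_subset (h : IsReduction (EN := EN) (EQ := EQ) A C l ι p)
    (hC : IsHyperplaneField C) (hA : A.Preserves C) (n : N) :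
    leaf C univ (ι n) ⊆ ι '' (p ⁻¹'
      leaf (reducedField (EN := EN) (EQ := EQ) C ι p) univ (p n)) := by
  rintro _ ⟨γ, J, hγ, hK, s, hs, t, ht, hn, rfl⟩
  obtain ⟨δ, hδ, hδs, hιδ, hδK⟩ := h.exists_lift hC hA hγ hK hs hn
  obtain ⟨h1, h2⟩ := hδ.map h.submersion.contMDiff
  refine ⟨δ t, ⟨p ∘ δ, J, h1, fun τ hτ ↦ ?_, s, hs, t, ht, congrArg p hδs, rfl⟩, hιδ t ht⟩
  rw [h2 τ hτ]
  exact h.mfderiv_mem_charSpace_reducedField hC hA (hδK τ hτ).1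

/-- A characteristic curve with initial velocity `u` lifts to `N`; so `u` is tangent to the level,
and its lift projects to a characteristic direction of the reduced field. -/
lemma charSpace_le_tangentPreimage (h : IsReduction (EN := EN) (EQ := EQ) A C l ι p)
    (hC : IsHyperplaneField C) {k : ℕ} (hk : ∀ x, Module.finrank ℝ (charSpace C x) = k)
    (hA : A.Preserves C) (n : N) :
    charSpace C (ι n) ≤ tangentPreimage (EN := EN) (EQ := EQ) ι p n
      (charSpace (reducedField (EN := EN) C ι p) (p n)) := by
  intro u hu
  obtain ⟨γ, J, hγ, hK, h0, hγ0⟩ := exists_characteristic hC hk isOpen_univ (mem_univ _) hu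
  obtain ⟨δ, hδ, hδs, hιδ, hδK⟩ := h.exists_lift hC hA hγ hK h0
    (congrArg Bundle.TotalSpace.proj hγ0)
  obtain ⟨h1, h2⟩ := hδK 0 h0
  have key : ∀ m, m = n → ∀ v : TangentSpace 𝓘(ℝ, EN) m,
      (⟨ι m, mfderiv 𝓘(ℝ, EN) 𝓘(ℝ, E) ι m v⟩ : TangentBundle 𝓘(ℝ, E) M) = ⟨ι n, u⟩ →
      mfderiv 𝓘(ℝ, EN) 𝓘(ℝ, EQ) p m v ∈ charSpace (reducedField (EN := EN) C ι p) (p m) →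
      u ∈ tangentPreimage (EN := EN) (EQ := EQ) ι p n
        (charSpace (reducedField (EN := EN) C ι p) (p n)) := by
    rintro _ rfl v hv hvK
    exact ⟨v, hvK, eq_of_heq (Bundle.TotalSpace.mk.inj hv).2⟩
  exact key _ hδs _ (h2.trans hγ0) (h.mfderiv_mem_charSpace_reducedField hC hA h1)

lemma tangentPreimage_le (h : IsReduction (EN := EN) (EQ := EQ) A C l ι p)
    (hC : IsHyperplaneField C) (hA : A.Preserves C) (n : N) :
    tangentPreimage (EN := EN) (EQ := EQ) ι p n
      (charSpace (reducedField (EN := EN) C ι p) (p n)) ≤ C (ι n) := by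
  rintro _ ⟨v, hv, rfl⟩
  have h1 : v ∈ cut (F := EN) (reducedField (EN := EN) (EQ := EQ) C ι p) p n := by
    have h2 : mfderiv 𝓘(ℝ, EN) 𝓘(ℝ, EQ) p n v ∈ reducedField (EN := EN) C ι p (p n) :=
      charSpace_le _ _ hv
    exact h2
  rw [h.cut_reducedField hC hA] at h1
  exact h1

end IsReduction

end Reduction

end ContactRed

end

/-! ### Assembly of the main theorem. -/

open ContactRed in
theorem mainTheorem3
    {E : Type*} [NormedAddCommGroup E] [NormedSpace ℝ E] [FiniteDimensional ℝ E]
    {M : Type*} [TopologicalSpace M] [ChartedSpace E M] [IsManifold 𝓘(ℝ, E) ∞ M]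
    -- a hyperplane field whose characteristic directions form a distribution of constant rank
    (C : ∀ x : M, Submodule ℝ (TangentSpace 𝓘(ℝ, E) x)) (hC : IsHyperplaneField C)
    (hrank : ∃ k : ℕ, ∀ x : M, Module.finrank ℝ (charSpace C x) = k)
    -- a local action of a Lie group preserving it
    {EG : Type*} [NormedAddCommGroup EG] [NormedSpace ℝ EG] [FiniteDimensional ℝ EG]
    {G : Type*} [TopologicalSpace G] [ChartedSpace EG G] [Group G] [LieGroup 𝓘(ℝ, EG) ∞ G]
    (A : LocalAction (EG := EG) G (E := E) M) (hA : A.Preserves C)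
    -- a family of reductions of it
    {Λ : Type*} (l : Λ → Submodule ℝ (GroupLieAlgebra 𝓘(ℝ, EG) G))
    {EN : Λ → Type*} [∀ i, NormedAddCommGroup (EN i)] [∀ i, NormedSpace ℝ (EN i)]
    [∀ i, FiniteDimensional ℝ (EN i)]
    {N : Λ → Type*} [∀ i, TopologicalSpace (N i)] [∀ i, ChartedSpace (EN i) (N i)]
    [∀ i, IsManifold 𝓘(ℝ, EN i) ∞ (N i)]
    {EQ : Λ → Type*} [∀ i, NormedAddCommGroup (EQ i)] [∀ i, NormedSpace ℝ (EQ i)]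
    [∀ i, FiniteDimensional ℝ (EQ i)]
    {Q : Λ → Type*} [∀ i, TopologicalSpace (Q i)] [∀ i, ChartedSpace (EQ i) (Q i)]
    [∀ i, IsManifold 𝓘(ℝ, EQ i) ∞ (Q i)]
    (ι : ∀ i, N i → M) (p : ∀ i, N i → Q i)
    (hred : ∀ i, IsReduction (EN := EN i) (EQ := EQ i) A C (l i) (ι i) (p i))
    -- a target for fibrations
    {F : Type*} [NormedAddCommGroup F] [NormedSpace ℝ F] [FiniteDimensional ℝ F]
    {B : Type*} [TopologicalSpace B] [ChartedSpace F B] [IsManifold 𝓘(ℝ, F) ∞ B] :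
    -- `𝔩` is constant along the characteristics, so that they lie in the subspaces `M_𝔩`
    (∀ x : M, ∀ y ∈ leaf C univ x, A.lie C y = A.lie C x) ∧
    (∀ x : M, leaf C univ x ⊆ A.level C (A.lie C x)) ∧
    -- the reduced spaces carry hyperplane fields, and the preimages of their characteristics
    -- contain the original characteristics and are tangent to `C`
    (∀ i, IsHyperplaneField (reducedField (EN := EN i) (EQ := EQ i) C (ι i) (p i)) ∧
      ∀ n : N i,
        proj (cut (F := EN i) C (ι i)) (p i) n =
          ⟨p i n, reducedField (EN := EN i) (EQ := EQ i) C (ι i) (p i) (p i n)⟩ ∧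
        leaf C univ (ι i n) ⊆ ι i '' (p i ⁻¹'
          leaf (reducedField (EN := EN i) (EQ := EQ i) C (ι i) (p i)) univ (p i n)) ∧
        charSpace C (ι i n) ≤ tangentPreimage (EN := EN i) (EQ := EQ i) (ι i) (p i) n
          (charSpace (reducedField (EN := EN i) C (ι i) (p i)) (p i n)) ∧
        tangentPreimage (EN := EN i) (EQ := EQ i) (ι i) (p i) n
          (charSpace (reducedField (EN := EN i) C (ι i) (p i)) (p i n)) ≤ C (ι i n)) ∧
    -- for any fibration of an open subset whose fibres contain the characteristics and are tangent
    -- to `C`, the characteristics are given by the constancy of the projected hyperplane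
    (∀ (U : Set M) (π : M → B), IsOpen U →
      (∀ x ∈ U, IsSubmersionAt 𝓘(ℝ, E) 𝓘(ℝ, F) ∞ π x) →
      (∀ x ∈ U, ∀ y ∈ leaf C U x, π y = π x) →
      (∀ x ∈ U, ∀ v, mfderiv 𝓘(ℝ, E) 𝓘(ℝ, F) π x v = 0 → v ∈ C x) →
      DeterminesCharacteristics (F := F) C U π) ∧
    -- in particular this holds when the fibres are those of the foliation formed by the preimages of
    -- the reduced characteristics
    (∀ (U : Set M) (π : M → B), IsOpen U →
      (∀ x ∈ U, IsSubmersionAt 𝓘(ℝ, E) 𝓘(ℝ, F) ∞ π x) →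
      (∀ x ∈ U, ∃ (i : Λ) (n : N i), ι i n = x) →
      (∀ (i : Λ) (n : N i), ι i n ∈ U → ∀ v : TangentSpace 𝓘(ℝ, E) (ι i n),
        mfderiv 𝓘(ℝ, E) 𝓘(ℝ, F) π (ι i n) v = 0 ↔
          v ∈ tangentPreimage (EN := EN i) (EQ := EQ i) (ι i) (p i) n
            (charSpace (reducedField (EN := EN i) C (ι i) (p i)) (p i n))) →
      DeterminesCharacteristics (F := F) C U π) := by
  obtain ⟨k, hk⟩ := hrank
  refine ⟨fun x y hy ↦ hA.lie_eq hC hy, fun x y hy ↦ hA.lie_eq hC hy, fun i ↦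
    ⟨(hred i).isHyperplaneField_reducedField hC hA, fun n ↦ ⟨(hred i).proj_eq_reducedField hC hA n,
      (hred i).leaf_subset hC hA n, (hred i).charSpace_le_tangentPreimage hC hk hA n,
      (hred i).tangentPreimage_le hC hA n⟩⟩, ?_, ?_⟩
  · intro U π hU hsub hleaf hker
    exact determinesCharacteristics hC hk hU hsub hleaf
      (fun x hx v hv ↦ mfderiv_eq_zero_of_leaf_subset hC hk hU hsub hleaf hx hv) hker
  · intro U π hU hsub hcover hπ
    -- From `K ⊂ P = ker dπ`; verticality of `K` then forces the characteristics into the fibres of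
    -- `π`, while `P ⊂ C` makes the fibres tangent to `C`.
    have hK : ∀ x ∈ U, ∀ v ∈ charSpace C x, mfderiv 𝓘(ℝ, E) 𝓘(ℝ, F) π x v = 0 := by
      intro x hx v hv
      obtain ⟨i, n, rfl⟩ := hcover x hx
      exact (hπ i n hx v).2 ((hred i).charSpace_le_tangentPreimage hC hk hA n hv)
    refine determinesCharacteristics hC hk hU hsub
      (fun x _ y hy ↦ proj_const_of_mem_leaf hsub hK hy) hK fun x hx v hv ↦ ?_
    obtain ⟨i, n, rfl⟩ := hcover x hx
    exact (hred i).tangentPreimage_le hC hA n ((hπ i n hx v).1 hv)
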